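/- **Setting.** Let $R$ be a commutative semiring. *Colours* are generated by $A,B ::= 0 \mid 1 \mid A\oplus B \mid A\otimes B$, and $A\approx A'$ is the congruence (for $\oplus$ and $\otimes$) generated by $A\oplus 0\approx A\approx 0\oplus A$, $A\otimes 1\approx A\approx 1\otimes A$ and associativity of $\oplus$ and of $\otimes$. *Diagrams* go between finite lists of colours ($\parallel$ is concatenation, $\emptyset$ the empty list). They are built by sequential composition $;$ (in diagrammatic order) and parallel composition $\parallel$ from identities, swaps $\sigma_{A,B}:A\parallel B\to B\parallel A$ and the following generators. *Functional* generators: $\otimes_{A,B}:A\parallel B\to A\otimes B$, $\oplus_{A,B}:A\parallel B\to A\oplus B$, contraction $\nabla_A:A\parallel A\to A$, null $0_A:\emptyset\to A$, their up-down mirrors $\otimes^\dagger,\oplus^\dagger,\nabla^\dagger,0^\dagger$, adapters $m_{A,A'}:A\to A'$ for $A\approx A'$, and scalars $[s]_A:A\to A$ for $s\in R$. The *full calculus* has in addition the unit $u:\emptyset\to 1$ and its mirror $u^\dagger$. The mirror $d^\dagger$ of a diagram reverses the order of sequential composition and mirrors generators, with $m_{A,A'}^\dagger=m_{A',A}$,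 $[s]^\dagger=[s]$, $\sigma_{A,B}^\dagger=\sigma_{B,A}$. **Equations.** Indices and identities $A=\mathrm{id}_A$ are abbreviated; $m$ is the adapter of the evident type; $X_{A,B}:=\oplus_{A,B};\oplus^\dagger_{A,B}$; $r_A:=m_{A,A\otimes1};\otimes^\dagger_{A,1}$ and $\ell_A:=m_{A,1\otimes A};\otimes^\dagger_{1,A}$. The relation $\equiv$ on functional diagrams is the congruence for $;$ and $\parallel$ generated by the laws of a coloured PROP (strict symmetric monoidal category) together with the following axioms, for all colours $A,B,C$, all $A\approx A'\approx A''$, $B\approx B'$ and all $s,t\in R$, and the mirror of each of them: - $\otimes^\dagger;\otimes=\mathrm{id}_{A\otimes B}$; $\oplus^\dagger;\oplus=\mathrm{id}_{A\oplus B}$; $\otimes_{A,B}^\dagger;\oplus_{A,B}=0^\dagger_{A\otimes B};0_{A\oplus B}$; $\mathrm{id}_0=0_0^\dagger;0_0$ (for the colour $0$); $\sigma_{A,A};\nabla=\nabla$; - $(\otimes_{A,B}^\dagger\parallel C);(A\parallel\otimes_{B,C})=\otimes_{A\otimes B,C};m;\otimes^\dagger_{A,B\otimes C}$; - $X_{A,B}=(r_A\parallel\ell_B);(A\parallel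 X_{1,1}\parallel B);(r_A^\dagger\parallel\ell_B^\dagger)$; - $\oplus_{A,B}=(r_A\parallel r_B);(A\parallel\sigma_{1,B}\parallel1);(\oplus_{A,B}\parallel\nabla_1);r_{A\oplus B}^\dagger$; - $A\parallel B=(\nabla_A^\dagger\parallel\nabla_B^\dagger);(A\parallel\sigma_{A,B}\parallel B);((\otimes_{A,B};\otimes^\dagger_{A,B})\parallel X_{A,B});(A\parallel\sigma_{B,A}\parallel B);(\nabla_A\parallel\nabla_B)$; - $0_{A\otimes B};\otimes^\dagger=0_A\parallel0_B$; $0_{A\oplus B};\oplus^\dagger=0_A\parallel0_B$; $0_A;\nabla^\dagger=0_A\parallel0_A$; $0_A;0_A^\dagger=\mathrm{id}_\emptyset$; $0_A;m_{A,A'}=0_{A'}$; $0_A;[s]=0_A$; $(A\parallel0_A);\nabla=A$; - $\nabla_{A\otimes B};\otimes^\dagger=(\otimes^\dagger\parallel\otimes^\dagger);(A\parallel\sigma_{B,A}\parallel B);(\nabla_A\parallel\nabla_B)$; - $(\nabla_A\parallel B);\otimes_{A,B}=(A\parallel A\parallel\nabla_B^\dagger);(A\parallel\sigma_{A,B}\parallel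 B);(\otimes\parallel\otimes);\nabla_{A\otimes B}$; - $\nabla_{A\oplus B};\oplus^\dagger=X_{A\oplus B,A\oplus B};(\oplus^\dagger\parallel\oplus^\dagger);(A\parallel\sigma_{B,A}\parallel B);(\nabla_A\parallel\nabla_B)$; - $(\nabla_A\parallel B);X_{A,B}=(A\parallel X_{A,B});(A\parallel\sigma_{A,B});(X_{A,B}\parallel A);(A\parallel\sigma_{B,A});(\nabla_A\parallel B)$; - $\nabla_A;\nabla_A^\dagger=X_{A,A};(\nabla^\dagger\parallel\nabla^\dagger);(A\parallel\sigma_{A,A}\parallel A);(\nabla\parallel\nabla)$; $(\nabla\parallel A);\nabla=(A\parallel\nabla);\nabla$; - $([s]\parallel[s]);\nabla=\nabla;[s]$; $(m_{A,A'}\parallel m_{A,A'});\nabla_{A'}=\nabla_A;m_{A,A'}$; - $\star^\dagger_{A,B\star C};(A\parallel\star^\dagger_{B,C})=m;\star^\dagger_{A\star B,C};(\star^\dagger_{A,B}\parallel C)$ and $(m_{A,A'}\parallel m_{B,B'});\star_{A',B'}=\star_{A,B};m$, for $\star\in\{\otimes,\oplus\}$; - $\sigma_{A,1};\otimes_{1,A}=\otimes_{A,1};m_{A\otimes1,1\otimes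 A}$; $(A\parallel0_0);\oplus_{A,0}=m_{A,A\oplus0}$ and $(0_0\parallel A);\oplus_{0,A}=m_{A,0\oplus A}$ (here $0_0$ is the null of colour $0$); $m_{A,A'};m_{A',A''}=m_{A,A''}$; $m_{A,A}=A$; - $[1]_A=A$; $[0]_A=0_A^\dagger;0_A$; $\nabla^\dagger;([s]\parallel[t]);\nabla=[s+t]$; $([s]_A\parallel[t]_B);\otimes=\otimes;[st]_{A\otimes B}$; $[s]_A;m_{A,A'}=m_{A,A'};[s]_{A'}$. On the full calculus, $\equiv$ is generated in the same way with the additional axioms (and mirrors) $r_A;(A\parallel u^\dagger)=A$; $0_1;u^\dagger=\mathrm{id}_\emptyset$; and, whenever $s+1=t+1$ in $R$, $c_s=c_t$, where $c_s:=(1\parallel u);(1\parallel\nabla_1^\dagger);(\sigma_{1,1}\parallel[s]_1);(1\parallel\nabla_1);(1\parallel u^\dagger)$. **Semantics.** Let $\mathbf H$ be a semiadditive category (zero object and biproducts $\oplus$, with $\iota_\ell,\iota_r,\pi_\ell,\pi_r$, diagonal $\Delta$, codiagonal $\nabla$) with a symmetric monoidal structure $(\otimes,1)$ that distributes over $\oplus$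 (the canonical map $H\otimes(K\oplus L)\to(H\otimes K)\oplus(H\otimes L)$ is invertible and $H\otimes0\cong0$), and let $R\cong\mathbf H(1,1)$ be a given isomorphism of semirings, so that $R$ acts on all morphisms. Put $H|K:=(H\otimes K)\oplus(H\oplus K)$, likewise on morphisms; this is a symmetric monoidal product with unit $0$. Colours are interpreted in the evident way, $[\![\emptyset]\!]=0$, and longer lists are interpreted by left-nested $|$. For functional diagrams, with $A,B$ also denoting interpretations: $\sigma_{A,B}$ is the symmetry of $|$, $[s]_A\mapsto s\cdot\mathrm{id}$, $\otimes\mapsto\pi_\ell:A|B\to A\otimes B$, $\otimes^\dagger\mapsto\iota_\ell$, $\oplus\mapsto\pi_r:A|B\to A\oplus B$, $\oplus^\dagger\mapsto\iota_r$, $\nabla_A\mapsto\nabla\circ\pi_r$, $\nabla^\dagger_A\mapsto\iota_r\circ\Delta$, $0_A,0_A^\dagger\mapsto0$, $m_{A,A'}\mapsto$ the canonical structural isomorphism, $;$ is interpreted by composition, and $d\parallel e$ by $[\![d]\!]\,|\,[\![e]\!]$ conjugated by the structural isomorphisms of $|$. Let $\mathbf H^{\oplus1}$ have the objects of $\mathbf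 H$ and, as morphisms $H\to K$, the morphisms $f:H\oplus1\to K\oplus1$ of $\mathbf H$ of the form $f=g+\iota_r\circ\pi_r$. For the full calculus, $[\![d]\!]^{\oplus1}:[\![\mathcal X]\!]\oplus1\to[\![\mathcal Y]\!]\oplus1$ is $[\![g]\!]\oplus\mathrm{id}_1$ on identities, swaps and functional generators $g$; $u\mapsto\Delta$ and $u^\dagger\mapsto\nabla$ up to $0\oplus1\cong1$; $;$ is interpreted by composition; and $d\parallel e$ by $[\![d]\!]^{\oplus1}\otimes[\![e]\!]^{\oplus1}$ conjugated by the canonical isomorphisms $(H\oplus1)\otimes(K\oplus1)\cong(H|K)\oplus1$ and the structural isomorphisms of $|$. **Proposition (Soundness).** For all lists of colours $\mathcal X,\mathcal Y$ and every such $R$, $\mathbf H$ and isomorphism $R\cong\mathbf H(1,1)$: 1. for all functional diagrams $d,e:\mathcal X\to\mathcal Y$, if $d\equiv e$ then $[\![d]\!]=[\![e]\!]$; 2. for all diagrams $d,e:\mathcal X\to\mathcal Y$ of the full calculus, if $d\equiv e$ then $[\![d]\!]^{\oplus1}=[\![e]\!]^{\oplus1}$; 3. the semantics of the full calculus takes values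 in $\mathbf H^{\oplus1}$, and $[\![d]\!]^{\oplus1}=[\![d]\!]\oplus\mathrm{id}_1$ for every functional diagram $d$. -/

import Mathlib

open CategoryTheory MonoidalCategory

universe w v u

namespace TensorPlus

/-- Colours, freely generated from `0` and `1` by a sum and a product. -/
inductive Color : Type
  | zero : Color
  | one : Color
  | plus : Color → Color → Color
  | tensor : Color → Color → Color

namespace Color

/-- Sum of colours. -/
infixl:65 " ⊞ " => Color.plus

/-- Product of colours. -/
infixl:70 " ⊠ " => Color.tensor

/-- Derivations of structural equivalence of colours: the equivalence relation generated by unit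
and associativity laws of sum and product, and congruence. -/
inductive AdapterTerm : Color → Color → Type
  | refl (A : Color) : AdapterTerm A A
  | symm {A B : Color} : AdapterTerm A B → AdapterTerm B A
  | trans {A B C : Color} : AdapterTerm A B → AdapterTerm B C → AdapterTerm A C
  | plusCongr {A A' B B' : Color} :
      AdapterTerm A A' → AdapterTerm B B' → AdapterTerm (A ⊞ B) (A' ⊞ B')
  | tensorCongr {A A' B B' : Color} :
      AdapterTerm A A' → AdapterTerm B B' → AdapterTerm (A ⊠ B) (A' ⊠ B')
  | plusZero (A : Color) : AdapterTerm (A ⊞ zero) A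
  | zeroPlus (A : Color) : AdapterTerm (zero ⊞ A) A
  | plusAssoc (A B C : Color) : AdapterTerm ((A ⊞ B) ⊞ C) (A ⊞ (B ⊞ C))
  | tensorOne (A : Color) : AdapterTerm (A ⊠ one) A
  | oneTensor (A : Color) : AdapterTerm (one ⊠ A) A
  | tensorAssoc (A B C : Color) : AdapterTerm ((A ⊠ B) ⊠ C) (A ⊠ (B ⊠ C))

/-- Structural equivalence of colours. -/
def Approx (A B : Color) : Prop := Nonempty (AdapterTerm A B)

namespace Approx

theorem refl (A : Color) : Approx A A := ⟨.refl A⟩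

theorem symm {A B : Color} (h : Approx A B) : Approx B A := h.map .symm

theorem trans {A B C : Color} (h : Approx A B) (k : Approx B C) : Approx A C :=
  ⟨.trans h.some k.some⟩

theorem plusCongr {A A' B B' : Color} (h : Approx A A') (k : Approx B B') :
    Approx (A ⊞ B) (A' ⊞ B') := ⟨.plusCongr h.some k.some⟩

theorem tensorCongr {A A' B B' : Color} (h : Approx A A') (k : Approx B B') :
    Approx (A ⊠ B) (A' ⊠ B') := ⟨.tensorCongr h.some k.some⟩

theorem plusZero (A : Color) : Approx (A ⊞ zero) A := ⟨.plusZero A⟩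

theorem zeroPlus (A : Color) : Approx (zero ⊞ A) A := ⟨.zeroPlus A⟩

theorem plusAssoc (A B C : Color) : Approx ((A ⊞ B) ⊞ C) (A ⊞ (B ⊞ C)) := ⟨.plusAssoc A B C⟩

theorem tensorOne (A : Color) : Approx (A ⊠ one) A := ⟨.tensorOne A⟩

theorem oneTensor (A : Color) : Approx (one ⊠ A) A := ⟨.oneTensor A⟩

theorem tensorAssoc (A B C : Color) : Approx ((A ⊠ B) ⊠ C) (A ⊠ (B ⊠ C)) := ⟨.tensorAssoc A B C⟩

end Approx

end Color

open Color

/-- Finite lists of colours, extended on the right. -/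
inductive Wires : Type
  | nil : Wires
  | snoc : Wires → Color → Wires

namespace Wires

/-- Concatenation. -/
def append (X : Wires) : Wires → Wires
  | nil => X
  | snoc Y B => snoc (append X Y) B

theorem nil_append (X : Wires) : append nil X = X := by
  induction X with
  | nil => rfl
  | snoc X A ih => simp [append, ih]

theorem append_assoc (X Y Z : Wires) : append (append X Y) Z = append X (append Y Z) := by
  induction Z with
  | nil => rfl
  | snoc Z A ih => simp [append, ih]

end Wires

/-- One wire. -/
abbrev w₁ (A : Color) : Wires := .snoc .nil A

/-- Two parallel wires. -/
abbrev w₂ (A B : Color) : Wires := .snoc (.snoc .nil A) B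

/-- Diagrams over a family of generators (before quotienting by any equation). -/
inductive Diag (G : Wires → Wires → Type w) : Wires → Wires → Type w
  | id (X : Wires) : Diag G X X
  | swap (A B : Color) : Diag G (w₂ A B) (w₂ B A)
  | gen {X Y : Wires} : G X Y → Diag G X Y
  | comp {X Y Z : Wires} : Diag G X Y → Diag G Y Z → Diag G X Z
  | par {X Y X' Y' : Wires} : Diag G X Y → Diag G X' Y' → Diag G (X.append X') (Y.append Y')

/-- Sequential composition, in diagrammatic order. -/
infixl:55 " ⨾ " => Diag.comp

/-- Parallel composition. -/
notation:60 d:60 " ⫽ " e:61 => (Diag.par d e :)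

namespace Diag

variable {G : Wires → Wires → Type w}

/-- Transport along equalities of the interfaces. -/
def cast {X X' Y Y' : Wires} (hX : X = X') (hY : Y = Y') (d : Diag G X Y) : Diag G X' Y' :=
  hX ▸ hY ▸ d

/-- Replace every generator. -/
def map {G' : Wires → Wires → Type w} (φ : ∀ {X Y : Wires}, G X Y → G' X Y) :
    ∀ {X Y : Wires}, Diag G X Y → Diag G' X Y
  | _, _, id X => id X
  | _, _, swap A B => swap A B
  | _, _, gen g => gen (φ g)
  | _, _, comp d e => comp (map φ d) (map φ e)
  | _, _, par d e => par (map φ d) (map φ e)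

/-- Up-down reflection, from a reflection of the generators. -/
def mirror (μ : ∀ {X Y : Wires}, G X Y → G Y X) : ∀ {X Y : Wires}, Diag G X Y → Diag G Y X
  | _, _, id X => id X
  | _, _, swap A B => swap B A
  | _, _, gen g => gen (μ g)
  | _, _, comp d e => comp (mirror μ e) (mirror μ d)
  | _, _, par d e => par (mirror μ d) (mirror μ e)

/-- Move the wire `B` from the right of `X` to its left. -/
def passLeft : ∀ (X : Wires) (B : Color), Diag G (X.append (w₁ B)) ((w₁ B).append X)
  | .nil, B => id (w₁ B)
  | .snoc X A, B => (id X ⫽ swap A B) ⨾ (passLeft X B ⫽ id (w₁ A))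

/-- The symmetry exchanging two blocks of wires. -/
def swapBlock (X : Wires) : ∀ Y : Wires, Diag G (X.append Y) (Y.append X)
  | .nil => cast rfl (Wires.nil_append X).symm (id X)
  | .snoc Y B =>
      cast rfl (Wires.append_assoc Y (w₁ B) X).symm
        ((swapBlock X Y ⫽ id (w₁ B)) ⨾ (id Y ⫽ passLeft X B))

/-- The congruence generated by the laws of a PROP (coloured strict symmetric monoidal category),
a family of axioms, and the up-down reflections of these axioms. -/
inductive Equiv (μ : ∀ {X Y : Wires}, G X Y → G Y X)
    (Ax : ∀ {X Y : Wires}, Diag G X Y → Diag G X Y → Prop) :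
    ∀ {X Y : Wires}, Diag G X Y → Diag G X Y → Prop
  | refl {X Y} (d : Diag G X Y) : Equiv μ Ax d d
  | symm {X Y} {d e : Diag G X Y} : Equiv μ Ax d e → Equiv μ Ax e d
  | trans {X Y} {d e f : Diag G X Y} : Equiv μ Ax d e → Equiv μ Ax e f → Equiv μ Ax d f
  | comp_congr {X Y Z} {d d' : Diag G X Y} {e e' : Diag G Y Z} :
      Equiv μ Ax d d' → Equiv μ Ax e e' → Equiv μ Ax (comp d e) (comp d' e')
  | par_congr {X Y X' Y'} {d d' : Diag G X Y} {e e' : Diag G X' Y'} :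
      Equiv μ Ax d d' → Equiv μ Ax e e' → Equiv μ Ax (par d e) (par d' e')
  | id_comp {X Y} (d : Diag G X Y) : Equiv μ Ax (comp (id X) d) d
  | comp_id {X Y} (d : Diag G X Y) : Equiv μ Ax (comp d (id Y)) d
  | comp_assoc {X Y Z W} (d : Diag G X Y) (e : Diag G Y Z) (f : Diag G Z W) :
      Equiv μ Ax (comp (comp d e) f) (comp d (comp e f))
  | id_par_id (X Y : Wires) : Equiv μ Ax (par (id X) (id Y)) (id (X.append Y))
  | interchange {X Y Z X' Y' Z'} (d : Diag G X Y) (e : Diag G Y Z)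
      (d' : Diag G X' Y') (e' : Diag G Y' Z') :
      Equiv μ Ax (par (comp d e) (comp d' e')) (comp (par d d') (par e e'))
  | par_assoc {X Y X' Y' X'' Y''} (d : Diag G X Y) (e : Diag G X' Y') (f : Diag G X'' Y'') :
      Equiv μ Ax
        (cast (Wires.append_assoc X X' X'') (Wires.append_assoc Y Y' Y'') (par (par d e) f))
        (par d (par e f))
  | nil_par {X Y} (d : Diag G X Y) :
      Equiv μ Ax (cast (Wires.nil_append X) (Wires.nil_append Y) (par (id .nil) d)) d
  | par_nil {X Y} (d : Diag G X Y) : Equiv μ Ax (par d (id .nil)) d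
  | swap_swap (A B : Color) : Equiv μ Ax (comp (swap A B) (swap B A)) (id (w₂ A B))
  | swap_natural {X Y X' Y'} (d : Diag G X Y) (e : Diag G X' Y') :
      Equiv μ Ax (comp (par d e) (swapBlock Y Y')) (comp (swapBlock X X') (par e d))
  | ax {X Y} {d e : Diag G X Y} : Ax d e → Equiv μ Ax d e
  | ax_mirror {X Y} {d e : Diag G X Y} : Ax d e → Equiv μ Ax (mirror μ d) (mirror μ e)

end Diag

/-- Generators of the functional calculus over the semiring `R`, apart from identities and swaps.
The suffix `M` marks the up-down reflection of a generator. -/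
inductive FGen (R : Type w) : Wires → Wires → Type w
  | tensor (A B : Color) : FGen R (w₂ A B) (w₁ (A ⊠ B))
  | tensorM (A B : Color) : FGen R (w₁ (A ⊠ B)) (w₂ A B)
  | plus (A B : Color) : FGen R (w₂ A B) (w₁ (A ⊞ B))
  | plusM (A B : Color) : FGen R (w₁ (A ⊞ B)) (w₂ A B)
  | contr (A : Color) : FGen R (w₂ A A) (w₁ A)
  | contrM (A : Color) : FGen R (w₁ A) (w₂ A A)
  | null (A : Color) : FGen R .nil (w₁ A)
  | nullM (A : Color) : FGen R (w₁ A) .nil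
  | adapter {A B : Color} (h : Approx A B) : FGen R (w₁ A) (w₁ B)
  | scalar (s : R) (A : Color) : FGen R (w₁ A) (w₁ A)

/-- Reflection of the functional generators. -/
def FGen.mirror {R : Type w} : ∀ {X Y : Wires}, FGen R X Y → FGen R Y X
  | _, _, tensor A B => tensorM A B
  | _, _, tensorM A B => tensor A B
  | _, _, plus A B => plusM A B
  | _, _, plusM A B => plus A B
  | _, _, contr A => contrM A
  | _, _, contrM A => contr A
  | _, _, null A => nullM A
  | _, _, nullM A => null A
  | _, _, adapter h => adapter h.symm
  | _, _, scalar s A => scalar s A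

/-- Generators of the full calculus: the functional ones, the unit and its reflection. -/
inductive Gen (R : Type w) : Wires → Wires → Type w
  | fn {X Y : Wires} (g : FGen R X Y) : Gen R X Y
  | unit : Gen R .nil (w₁ .one)
  | unitM : Gen R (w₁ .one) .nil

/-- Reflection of the generators. -/
def Gen.mirror {R : Type w} : ∀ {X Y : Wires}, Gen R X Y → Gen R Y X
  | _, _, fn g => fn g.mirror
  | _, _, unit => unitM
  | _, _, unitM => unit

/-- Functional diagrams. -/
abbrev FDiag (R : Type w) : Wires → Wires → Type w := Diag (FGen R)

/-- Diagrams of the full calculus. -/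
abbrev FullDiag (R : Type w) : Wires → Wires → Type w := Diag (Gen R)

/-- A functional diagram seen as a diagram of the full calculus. -/
def FDiag.incl {R : Type w} {X Y : Wires} (d : FDiag R X Y) : FullDiag R X Y :=
  Diag.map (fun g => Gen.fn g) d

section Shorthands

variable {R : Type w}

/-- Identity wire. -/
abbrev I (A : Color) : FDiag R (w₁ A) (w₁ A) := .id (w₁ A)

/-- Swap of two wires. -/
abbrev σ (A B : Color) : FDiag R (w₂ A B) (w₂ B A) := .swap A B

/-- Tensor generator. -/
abbrev T (A B : Color) : FDiag R (w₂ A B) (w₁ (A ⊠ B)) := .gen (.tensor A B)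

/-- Reflected tensor generator. -/
abbrev Tm (A B : Color) : FDiag R (w₁ (A ⊠ B)) (w₂ A B) := .gen (.tensorM A B)

/-- Plus generator. -/
abbrev P (A B : Color) : FDiag R (w₂ A B) (w₁ (A ⊞ B)) := .gen (.plus A B)

/-- Reflected plus generator. -/
abbrev Pm (A B : Color) : FDiag R (w₁ (A ⊞ B)) (w₂ A B) := .gen (.plusM A B)

/-- Contraction. -/
abbrev K (A : Color) : FDiag R (w₂ A A) (w₁ A) := .gen (.contr A)

/-- Reflected contraction. -/
abbrev Km (A : Color) : FDiag R (w₁ A) (w₂ A A) := .gen (.contrM A)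

/-- Null generator. -/
abbrev N (A : Color) : FDiag R .nil (w₁ A) := .gen (.null A)

/-- Reflected null generator. -/
abbrev Nm (A : Color) : FDiag R (w₁ A) .nil := .gen (.nullM A)

/-- Adapter between structurally equivalent colours. -/
abbrev M {A B : Color} (h : Approx A B) : FDiag R (w₁ A) (w₁ B) := .gen (.adapter h)

/-- Scalar. -/
abbrev S (s : R) (A : Color) : FDiag R (w₁ A) (w₁ A) := .gen (.scalar s A)

/-- The composite of a plus with a reflected plus. -/
abbrev XP (A B : Color) : FDiag R (w₂ A B) (w₂ A B) := P A B ⨾ Pm A B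

/-- Splits a unit wire off, on the right. -/
abbrev splitR (A : Color) : FDiag R (w₁ A) (w₂ A .one) := M (Approx.tensorOne A).symm ⨾ Tm A .one

/-- Splits a unit wire off, on the left. -/
abbrev splitL (A : Color) : FDiag R (w₁ A) (w₂ .one A) := M (Approx.oneTensor A).symm ⨾ Tm .one A

/-- Absorbs a unit wire on the right. -/
abbrev mergeR (A : Color) : FDiag R (w₂ A .one) (w₁ A) := T A .one ⨾ M (Approx.tensorOne A)

/-- Absorbs a unit wire on the left. -/
abbrev mergeL (A : Color) : FDiag R (w₂ .one A) (w₁ A) := T .one A ⨾ M (Approx.oneTensor A)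

end Shorthands

/-- The axioms of the functional calculus, up to reflection. -/
inductive FAx (R : Type w) [CommSemiring R] :
    ∀ {X Y : Wires}, FDiag R X Y → FDiag R X Y → Prop
  | tensor_split (A B : Color) : FAx R (Tm A B ⨾ T A B) (I (A ⊠ B))
  | plus_split (A B : Color) : FAx R (Pm A B ⨾ P A B) (I (A ⊞ B))
  | tensor_plus (A B : Color) : FAx R (Tm A B ⨾ P A B) (Nm (A ⊠ B) ⨾ N (A ⊞ B))
  | zero_wire : FAx R (I .zero) (Nm .zero ⨾ N .zero)
  | swap_contr (A : Color) : FAx R (σ A A ⨾ K A) (K A)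
  | tensor_zigzag (A B C : Color) :
      FAx R (X := .snoc (w₁ (A ⊠ B)) C) (Y := .snoc (w₁ A) (B ⊠ C))
        ((Tm A B ⫽ I C) ⨾ (I A ⫽ T B C))
        (T (A ⊠ B) C ⨾ M (Approx.tensorAssoc A B C) ⨾ Tm A (B ⊠ C))
  | plus_unit (A B : Color) :
      FAx R (XP A B)
        ((splitR A ⫽ splitL B) ⨾ (I A ⫽ XP .one .one ⫽ I B) ⨾ (mergeR A ⫽ mergeL B))
  | plus_contr (A B : Color) :
      FAx R (P A B)
        ((splitR A ⫽ splitR B) ⨾ (I A ⫽ σ .one B ⫽ I .one) ⨾ (P A B ⫽ K .one)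
          ⨾ mergeR (A ⊞ B))
  | mix (A B : Color) :
      FAx R (X := w₂ A B) (Y := w₂ A B) (I A ⫽ I B)
        ((Km A ⫽ Km B) ⨾ (I A ⫽ σ A B ⫽ I B) ⨾ ((T A B ⨾ Tm A B) ⫽ XP A B)
          ⨾ (I A ⫽ σ B A ⫽ I B) ⨾ (K A ⫽ K B))
  | null_tensor (A B : Color) : FAx R (N (A ⊠ B) ⨾ Tm A B) (N A ⫽ N B)
  | null_plus (A B : Color) : FAx R (N (A ⊞ B) ⨾ Pm A B) (N A ⫽ N B)
  | null_contr (A : Color) : FAx R (N A ⨾ Km A) (N A ⫽ N A)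
  | null_null (A : Color) : FAx R (N A ⨾ Nm A) (.id .nil)
  | null_adapter {A B : Color} (h : Approx A B) : FAx R (N A ⨾ M h) (N B)
  | null_scalar (s : R) (A : Color) : FAx R (N A ⨾ S s A) (N A)
  | contr_null (A : Color) : FAx R (X := w₁ A) (Y := w₁ A) ((I A ⫽ N A) ⨾ K A) (I A)
  | contr_tensorM (A B : Color) :
      FAx R (K (A ⊠ B) ⨾ Tm A B)
        ((Tm A B ⫽ Tm A B) ⨾ (I A ⫽ σ B A ⫽ I B) ⨾ (K A ⫽ K B))
  | contr_tensor (A B : Color) :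
      FAx R (X := .snoc (w₂ A A) B) (Y := w₁ (A ⊠ B)) ((K A ⫽ I B) ⨾ T A B)
        ((I A ⫽ I A ⫽ Km B) ⨾ (I A ⫽ σ A B ⫽ I B) ⨾ (T A B ⫽ T A B) ⨾ K (A ⊠ B))
  | contr_plusM (A B : Color) :
      FAx R (K (A ⊞ B) ⨾ Pm A B)
        (XP (A ⊞ B) (A ⊞ B) ⨾ (Pm A B ⫽ Pm A B) ⨾ (I A ⫽ σ B A ⫽ I B) ⨾ (K A ⫽ K B))
  | contr_XP (A B : Color) :
      FAx R (X := .snoc (w₂ A A) B) (Y := w₂ A B) ((K A ⫽ I B) ⨾ XP A B)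
        ((I A ⫽ XP A B) ⨾ (I A ⫽ σ A B) ⨾ (XP A B ⫽ I A) ⨾ (I A ⫽ σ B A) ⨾ (K A ⫽ I B))
  | contr_contrM (A : Color) :
      FAx R (K A ⨾ Km A)
        (XP A A ⨾ (Km A ⫽ Km A) ⨾ (I A ⫽ σ A A ⫽ I A) ⨾ (K A ⫽ K A))
  | contr_assoc (A : Color) :
      FAx R (X := .snoc (w₂ A A) A) (Y := w₁ A) ((K A ⫽ I A) ⨾ K A) ((I A ⫽ K A) ⨾ K A)
  | contr_scalar (s : R) (A : Color) :
      FAx R (X := w₂ A A) (Y := w₁ A) ((S s A ⫽ S s A) ⨾ K A) (K A ⨾ S s A)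
  | contr_adapter {A B : Color} (h : Approx A B) :
      FAx R (X := w₂ A A) (Y := w₁ B) ((M h ⫽ M h) ⨾ K B) (K A ⨾ M h)
  | tensor_assoc (A B C : Color) :
      FAx R (X := w₁ (A ⊠ (B ⊠ C))) (Y := .snoc (w₂ A B) C) (Tm A (B ⊠ C) ⨾ (I A ⫽ Tm B C))
        (M (Approx.tensorAssoc A B C).symm ⨾ Tm (A ⊠ B) C ⨾ (Tm A B ⫽ I C))
  | plus_assoc (A B C : Color) :
      FAx R (X := w₁ (A ⊞ (B ⊞ C))) (Y := .snoc (w₂ A B) C) (Pm A (B ⊞ C) ⨾ (I A ⫽ Pm B C))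
        (M (Approx.plusAssoc A B C).symm ⨾ Pm (A ⊞ B) C ⨾ (Pm A B ⫽ I C))
  | tensor_adapter {A A' B B' : Color} (h : Approx A A') (k : Approx B B') :
      FAx R (X := w₂ A B) (Y := w₁ (A' ⊠ B')) ((M h ⫽ M k) ⨾ T A' B')
        (T A B ⨾ M (h.tensorCongr k))
  | plus_adapter {A A' B B' : Color} (h : Approx A A') (k : Approx B B') :
      FAx R (X := w₂ A B) (Y := w₁ (A' ⊞ B')) ((M h ⫽ M k) ⨾ P A' B')
        (P A B ⨾ M (h.plusCongr k))
  | tensor_one (A : Color) :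
      FAx R (σ A .one ⨾ T .one A)
        (T A .one ⨾ M ((Approx.tensorOne A).trans (Approx.oneTensor A).symm))
  | plus_zero (A : Color) :
      FAx R (X := w₁ A) (Y := w₁ (A ⊞ .zero)) ((I A ⫽ N .zero) ⨾ P A .zero)
        (M (Approx.plusZero A).symm)
  | zero_plus (A : Color) :
      FAx R (X := w₁ A) (Y := w₁ (.zero ⊞ A)) ((N .zero ⫽ I A) ⨾ P .zero A)
        (M (Approx.zeroPlus A).symm)
  | adapter_adapter {A B C : Color} (h : Approx A B) (k : Approx B C) :
      FAx R (M h ⨾ M k) (M (h.trans k))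
  | adapter_refl (A : Color) : FAx R (M (Approx.refl A)) (I A)
  | scalar_one (A : Color) : FAx R (S 1 A) (I A)
  | scalar_zero (A : Color) : FAx R (S 0 A) (Nm A ⨾ N A)
  | scalar_add (s t : R) (A : Color) : FAx R (Km A ⨾ (S s A ⫽ S t A) ⨾ K A) (S (s + t) A)
  | tensor_scalar (s t : R) (A B : Color) :
      FAx R (X := w₂ A B) (Y := w₁ (A ⊠ B)) ((S s A ⫽ S t B) ⨾ T A B)
        (T A B ⨾ S (s * t) (A ⊠ B))
  | scalar_adapter (s : R) {A B : Color} (h : Approx A B) : FAx R (S s A ⨾ M h) (M h ⨾ S s B)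

/-- The unit generator. -/
abbrev U {R : Type w} : FullDiag R .nil (w₁ .one) := .gen .unit

/-- The reflected unit generator. -/
abbrev Um {R : Type w} : FullDiag R (w₁ .one) .nil := .gen .unitM

/-- The diagram compared in the cancellation axiom. -/
def canDiag {R : Type w} (s : R) : FullDiag R (w₁ .one) (w₁ .one) :=
  Diag.comp (X := w₁ .one) (Y := w₂ .one .one) (Z := w₁ .one)
    (FDiag.incl (I .one) ⫽ U)
    (FDiag.incl ((I .one ⫽ Km .one) ⨾ (σ .one .one ⫽ S s .one) ⨾ (I .one ⫽ K .one))
      ⨾ (FDiag.incl (I .one) ⫽ Um))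

/-- The axioms of the full calculus, up to reflection. -/
inductive Ax (R : Type w) [CommSemiring R] :
    ∀ {X Y : Wires}, FullDiag R X Y → FullDiag R X Y → Prop
  | fn {X Y : Wires} {d e : FDiag R X Y} : FAx R d e → Ax R d.incl e.incl
  | tensor_unit (A : Color) :
      Ax R (X := w₁ A) (Y := w₁ A) ((splitR A).incl ⨾ (FDiag.incl (I A) ⫽ Um)) (FDiag.incl (I A))
  | null_unit : Ax R ((N .one).incl ⨾ Um) (.id .nil)
  | can (s t : R) : s + 1 = t + 1 → Ax R (canDiag s) (canDiag t)

/-- The equational theory of functional diagrams. -/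
def FEquiv {R : Type w} [CommSemiring R] {X Y : Wires} (d e : FDiag R X Y) : Prop :=
  Diag.Equiv (fun g => FGen.mirror g) (fun d e => FAx R d e) d e

/-- The equational theory of the full calculus. -/
def FullEquiv {R : Type w} [CommSemiring R] {X Y : Wires} (d e : FullDiag R X Y) : Prop :=
  Diag.Equiv (fun g => Gen.mirror g) (fun d e => Ax R d e) d e

/-- A semiadditive category: a zero object and (chosen) binary biproducts. -/
class Semiadditive (H : Type u) [Category.{v} H] [Limits.HasZeroMorphisms H] where
  /-- The zero object. -/
  zeroObj : H
  isZero_zeroObj : Limits.IsZero zeroObj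
  /-- The biproducts. -/
  biprod (X Y : H) : Limits.BinaryBiproductData X Y

section Biproducts

variable {H : Type u} [Category.{v} H] [Limits.HasZeroMorphisms H] [Semiadditive H]

/-- Biproduct of objects. -/
def sum (X Y : H) : H := (Semiadditive.biprod X Y).bicone.pt

/-- Biproduct of objects. -/
infixr:30 " ⊕' " => sum

/-- Left injection. -/
def inl {X Y : H} : X ⟶ (X ⊕' Y) := (Semiadditive.biprod X Y).bicone.inl

/-- Right injection. -/
def inr {X Y : H} : Y ⟶ (X ⊕' Y) := (Semiadditive.biprod X Y).bicone.inr

/-- Left projection. -/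
def fst {X Y : H} : (X ⊕' Y) ⟶ X := (Semiadditive.biprod X Y).bicone.fst

/-- Right projection. -/
def snd {X Y : H} : (X ⊕' Y) ⟶ Y := (Semiadditive.biprod X Y).bicone.snd

/-- Pairing. -/
def lift {W X Y : H} (f : W ⟶ X) (g : W ⟶ Y) : W ⟶ (X ⊕' Y) :=
  (Semiadditive.biprod X Y).isBilimit.isLimit.lift (Limits.BinaryFan.mk f g)

/-- Copairing. -/
def desc {W X Y : H} (f : X ⟶ W) (g : Y ⟶ W) : (X ⊕' Y) ⟶ W :=
  (Semiadditive.biprod X Y).isBilimit.isColimit.desc (Limits.BinaryCofan.mk f g)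

@[simp]
theorem lift_fst {W X Y : H} (f : W ⟶ X) (g : W ⟶ Y) : lift f g ≫ fst = f :=
  (Semiadditive.biprod X Y).isBilimit.isLimit.fac (Limits.BinaryFan.mk f g)
    ⟨Limits.WalkingPair.left⟩

@[simp]
theorem lift_snd {W X Y : H} (f : W ⟶ X) (g : W ⟶ Y) : lift f g ≫ snd = g :=
  (Semiadditive.biprod X Y).isBilimit.isLimit.fac (Limits.BinaryFan.mk f g)
    ⟨Limits.WalkingPair.right⟩

@[simp]
theorem inl_desc {W X Y : H} (f : X ⟶ W) (g : Y ⟶ W) : inl ≫ desc f g = f :=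
  (Semiadditive.biprod X Y).isBilimit.isColimit.fac (Limits.BinaryCofan.mk f g)
    ⟨Limits.WalkingPair.left⟩

@[simp]
theorem inr_desc {W X Y : H} (f : X ⟶ W) (g : Y ⟶ W) : inr ≫ desc f g = g :=
  (Semiadditive.biprod X Y).isBilimit.isColimit.fac (Limits.BinaryCofan.mk f g)
    ⟨Limits.WalkingPair.right⟩

@[simp]
theorem inl_fst {X Y : H} : (inl : X ⟶ (X ⊕' Y)) ≫ fst = 𝟙 X :=
  (Semiadditive.biprod X Y).bicone.inl_fst

@[simp]
theorem inl_snd {X Y : H} : (inl : X ⟶ (X ⊕' Y)) ≫ snd = 0 :=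
  (Semiadditive.biprod X Y).bicone.inl_snd

@[simp]
theorem inr_fst {X Y : H} : (inr : Y ⟶ (X ⊕' Y)) ≫ fst = 0 :=
  (Semiadditive.biprod X Y).bicone.inr_fst

@[simp]
theorem inr_snd {X Y : H} : (inr : Y ⟶ (X ⊕' Y)) ≫ snd = 𝟙 Y :=
  (Semiadditive.biprod X Y).bicone.inr_snd

theorem sum_hom_ext {W X Y : H} {f g : W ⟶ (X ⊕' Y)}
    (h₁ : f ≫ fst = g ≫ fst) (h₂ : f ≫ snd = g ≫ snd) : f = g :=
  Limits.BinaryFan.IsLimit.hom_ext (Semiadditive.biprod X Y).isBilimit.isLimit h₁ h₂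

theorem sum_hom_ext' {W X Y : H} {f g : (X ⊕' Y) ⟶ W}
    (h₁ : inl ≫ f = inl ≫ g) (h₂ : inr ≫ f = inr ≫ g) : f = g :=
  Limits.BinaryCofan.IsColimit.hom_ext (Semiadditive.biprod X Y).isBilimit.isColimit h₁ h₂

/-- Biproduct of morphisms. -/
def sumMap {X X' Y Y' : H} (f : X ⟶ X') (g : Y ⟶ Y') : (X ⊕' Y) ⟶ (X' ⊕' Y') :=
  desc (f ≫ inl) (g ≫ inr)

/-- Addition of parallel morphisms: the diagonal, then `f` and `g` side by side, then the
codiagonal. -/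
def homAdd {X Y : H} (f g : X ⟶ Y) : X ⟶ Y := lift (𝟙 X) (𝟙 X) ≫ sumMap f g ≫ desc (𝟙 Y) (𝟙 Y)

/-- The right unit isomorphism of the biproduct. -/
def sumRightUnitor (X : H) : (X ⊕' (Semiadditive.zeroObj : H)) ≅ X where
  hom := fst
  inv := inl
  hom_inv_id := by
    apply sum_hom_ext
    · simp
    · exact Semiadditive.isZero_zeroObj.eq_of_tgt _ _

/-- The left unit isomorphism of the biproduct. -/
def sumLeftUnitor (X : H) : ((Semiadditive.zeroObj : H) ⊕' X) ≅ X where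
  hom := snd
  inv := inr
  hom_inv_id := by
    apply sum_hom_ext
    · exact Semiadditive.isZero_zeroObj.eq_of_tgt _ _
    · simp

/-- The associativity isomorphism of the biproduct. -/
def sumAssoc (X Y Z : H) : ((X ⊕' Y) ⊕' Z) ≅ (X ⊕' (Y ⊕' Z)) where
  hom := desc (desc inl (inl ≫ inr)) (inr ≫ inr)
  inv := desc (inl ≫ inl) (desc (inr ≫ inl) inr)
  hom_inv_id := by
    refine sum_hom_ext' (sum_hom_ext' ?_ ?_) ?_ <;> simp [← Category.assoc] <;> simp
  inv_hom_id := by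
    refine sum_hom_ext' ?_ (sum_hom_ext' ?_ ?_) <;> simp [← Category.assoc] <;> simp

/-- Biproduct of isomorphisms. -/
def sumIso {X X' Y Y' : H} (f : X ≅ X') (g : Y ≅ Y') : (X ⊕' Y) ≅ (X' ⊕' Y') where
  hom := sumMap f.hom g.hom
  inv := sumMap f.inv g.inv
  hom_inv_id := by
    refine sum_hom_ext' ?_ ?_ <;> simp [sumMap, ← Category.assoc] <;> simp
  inv_hom_id := by
    refine sum_hom_ext' ?_ ?_ <;> simp [sumMap, ← Category.assoc] <;> simp

end Biproducts

section Distributivity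

variable {H : Type u} [Category.{v} H] [Limits.HasZeroMorphisms H] [Semiadditive H]
  [MonoidalCategory H]

/-- The comparison morphism of left distributivity. -/
def distL (X Y Z : H) : X ⊗ (Y ⊕' Z) ⟶ ((X ⊗ Y) ⊕' (X ⊗ Z)) := lift (X ◁ fst) (X ◁ snd)

/-- The comparison morphism of right distributivity. -/
def distR (X Y Z : H) : (X ⊕' Y) ⊗ Z ⟶ ((X ⊗ Z) ⊕' (Y ⊗ Z)) := lift (fst ▷ Z) (snd ▷ Z)

end Distributivity

/-- The monoidal product distributes over biproducts and annihilates the zero object.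
In the symmetric case the same holds on the other side. -/
class Distributive (H : Type u) [Category.{v} H] [Limits.HasZeroMorphisms H] [Semiadditive H]
    [MonoidalCategory H] : Prop where
  isIso_distL (X Y Z : H) : IsIso (distL X Y Z)
  isZero_tensor_zeroObj (X : H) : Limits.IsZero (X ⊗ (Semiadditive.zeroObj : H))

/-- An identification of the semiring `R` with the endomorphisms of the monoidal unit, where
addition comes from biproducts and multiplication is composition. -/
structure ScalarIso (R : Type w) [CommSemiring R] (H : Type u) [Category.{v} H]
    [Limits.HasZeroMorphisms H] [Semiadditive H] [MonoidalCategory H] where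
  /-- The underlying bijection. -/
  toEquiv : R ≃ (𝟙_ H ⟶ 𝟙_ H)
  map_zero : toEquiv 0 = 0
  map_one : toEquiv 1 = 𝟙 (𝟙_ H)
  map_add (s t : R) : toEquiv (s + t) = homAdd (toEquiv s) (toEquiv t)
  map_mul (s t : R) : toEquiv (s * t) = toEquiv s ≫ toEquiv t

section Par

variable {H : Type u} [Category.{v} H] [Limits.HasZeroMorphisms H] [Semiadditive H]
  [MonoidalCategory H]

/-- The parallel composition of objects. -/
def parObj (X Y : H) : H := (X ⊗ Y) ⊕' (X ⊕' Y)

/-- The parallel composition of morphisms. -/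
def parMap {X X' Y Y' : H} (f : X ⟶ X') (g : Y ⟶ Y') : parObj X Y ⟶ parObj X' Y' :=
  sumMap (f ⊗ₘ g) (sumMap f g)

/-- The symmetry of the parallel composition. -/
def parSwap [SymmetricCategory H] (X Y : H) : parObj X Y ⟶ parObj Y X :=
  sumMap (β_ X Y).hom (lift snd fst)

/-- The left unit isomorphism of the parallel composition. -/
def parLeftHom (X : H) : parObj (Semiadditive.zeroObj : H) X ⟶ X := snd ≫ snd

/-- The inverse of `parLeftHom`. -/
def parLeftInv (X : H) : X ⟶ parObj (Semiadditive.zeroObj : H) X := inr ≫ inr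

/-- The right unit isomorphism of the parallel composition. -/
def parRightHom (X : H) : parObj X (Semiadditive.zeroObj : H) ⟶ X := snd ≫ fst

/-- The inverse of `parRightHom`. -/
def parRightInv (X : H) : X ⟶ parObj X (Semiadditive.zeroObj : H) := inl ≫ inr

/-- The associativity isomorphism of the parallel composition. -/
def parAssocHom (X Y Z : H) : parObj (parObj X Y) Z ⟶ parObj X (parObj Y Z) :=
  desc
    (distR (X ⊗ Y) (X ⊕' Y) Z ≫
      desc ((α_ X Y Z).hom ≫ X ◁ inl ≫ inl)
        (distR X Y Z ≫ desc (X ◁ (inr ≫ inr) ≫ inl) (inl ≫ inr ≫ inr)))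
    (desc
      (desc (X ◁ (inl ≫ inr) ≫ inl) (desc (inl ≫ inr) (inl ≫ inr ≫ inr ≫ inr)))
      (inr ≫ inr ≫ inr ≫ inr))

/-- The inverse of `parAssocHom`. -/
def parAssocInv (X Y Z : H) : parObj X (parObj Y Z) ⟶ parObj (parObj X Y) Z :=
  desc
    (distL X (Y ⊗ Z) (Y ⊕' Z) ≫
      desc ((α_ X Y Z).inv ≫ inl ▷ Z ≫ inl)
        (distL X Y Z ≫ desc (inl ≫ inl ≫ inr) ((inl ≫ inr) ▷ Z ≫ inl)))
    (desc (inl ≫ inr ≫ inl ≫ inr)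
      (desc ((inr ≫ inr) ▷ Z ≫ inl)
        (desc (inr ≫ inr ≫ inl ≫ inr) (inr ≫ inr))))

/-- The isomorphism expanding a product of two objects with a unit adjoined. -/
def expandHom (X Y : H) : (X ⊕' 𝟙_ H) ⊗ (Y ⊕' 𝟙_ H) ⟶ (parObj X Y ⊕' 𝟙_ H) :=
  distR X (𝟙_ H) (Y ⊕' 𝟙_ H) ≫
    desc
      (distL X Y (𝟙_ H) ≫ desc (inl ≫ inl) ((ρ_ X).hom ≫ inl ≫ inr ≫ inl))
      ((λ_ (Y ⊕' 𝟙_ H)).hom ≫ desc (inr ≫ inr ≫ inl) inr)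

/-- The inverse of `expandHom`. -/
def expandInv (X Y : H) : (parObj X Y ⊕' 𝟙_ H) ⟶ (X ⊕' 𝟙_ H) ⊗ (Y ⊕' 𝟙_ H) :=
  desc
    (desc (inl ⊗ₘ inl)
      (desc ((ρ_ X).inv ≫ (inl ⊗ₘ inr)) ((λ_ Y).inv ≫ (inr ⊗ₘ inl))))
    ((λ_ (𝟙_ H)).inv ≫ (inr ⊗ₘ inr))

end Par

section Interpretation

variable (H : Type u) [Category.{v} H] [Limits.HasZeroMorphisms H] [Semiadditive H]
  [MonoidalCategory H]

/-- Interpretation of colours. -/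
def colorObj : Color → H
  | .zero => Semiadditive.zeroObj
  | .one => 𝟙_ H
  | .plus A B => colorObj A ⊕' colorObj B
  | .tensor A B => colorObj A ⊗ colorObj B

/-- The structural isomorphism of a derivation of structural equivalence. -/
def adapterTermIso : ∀ {A B : Color}, AdapterTerm A B → (colorObj H A ≅ colorObj H B)
  | _, _, .refl A => Iso.refl (colorObj H A)
  | _, _, .symm t => (adapterTermIso t).symm
  | _, _, .trans t t' => adapterTermIso t ≪≫ adapterTermIso t'
  | _, _, .plusCongr t t' => sumIso (adapterTermIso t) (adapterTermIso t')
  | _, _, .tensorCongr t t' => adapterTermIso t ⊗ᵢ adapterTermIso t'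
  | _, _, .plusZero A => sumRightUnitor (colorObj H A)
  | _, _, .zeroPlus A => sumLeftUnitor (colorObj H A)
  | _, _, .plusAssoc A B C => sumAssoc (colorObj H A) (colorObj H B) (colorObj H C)
  | _, _, .tensorOne A => ρ_ (colorObj H A)
  | _, _, .oneTensor A => λ_ (colorObj H A)
  | _, _, .tensorAssoc A B C => α_ (colorObj H A) (colorObj H B) (colorObj H C)

/-- The structural isomorphism between structurally equivalent colours. By coherence it does not
depend on the chosen derivation. -/
noncomputable def adapterIso {A B : Color} (h : Approx A B) : colorObj H A ≅ colorObj H B :=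
  adapterTermIso H (Classical.choice h)

/-- Interpretation of lists of colours: the empty list is the zero object, a single colour is its
interpretation, longer lists are left-nested parallel compositions. -/
def wiresObj : Wires → H
  | .nil => Semiadditive.zeroObj
  | .snoc .nil B => colorObj H B
  | .snoc (.snoc X A) B => parObj (wiresObj (.snoc X A)) (colorObj H B)

/-- Adding one wire on the right. -/
def snocHom : ∀ (X : Wires) (B : Color),
    parObj (wiresObj H X) (colorObj H B) ⟶ wiresObj H (.snoc X B)
  | .nil, B => parLeftHom (colorObj H B)
  | .snoc X A, B => 𝟙 (parObj (wiresObj H (.snoc X A)) (colorObj H B))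

/-- The inverse of `snocHom`. -/
def snocInv : ∀ (X : Wires) (B : Color),
    wiresObj H (.snoc X B) ⟶ parObj (wiresObj H X) (colorObj H B)
  | .nil, B => parLeftInv (colorObj H B)
  | .snoc X A, B => 𝟙 (parObj (wiresObj H (.snoc X A)) (colorObj H B))

/-- The structural isomorphism merging the interpretations of two lists. -/
def appendHom (X : Wires) : ∀ Y : Wires,
    parObj (wiresObj H X) (wiresObj H Y) ⟶ wiresObj H (X.append Y)
  | .nil => parRightHom (wiresObj H X)
  | .snoc Y B =>
      parMap (𝟙 (wiresObj H X)) (snocInv H Y B) ≫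
        parAssocInv (wiresObj H X) (wiresObj H Y) (colorObj H B) ≫
        parMap (appendHom X Y) (𝟙 (colorObj H B)) ≫ snocHom H (X.append Y) B

/-- The inverse of `appendHom`. -/
def appendInv (X : Wires) : ∀ Y : Wires,
    wiresObj H (X.append Y) ⟶ parObj (wiresObj H X) (wiresObj H Y)
  | .nil => parRightInv (wiresObj H X)
  | .snoc Y B =>
      snocInv H (X.append Y) B ≫ parMap (appendInv X Y) (𝟙 (colorObj H B)) ≫
        parAssocHom (wiresObj H X) (wiresObj H Y) (colorObj H B) ≫
        parMap (𝟙 (wiresObj H X)) (snocHom H Y B)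

end Interpretation

section Semantics

variable {R : Type w} [CommSemiring R] {H : Type u} [Category.{v} H] [Limits.HasZeroMorphisms H]
  [Semiadditive H] [MonoidalCategory H] [SymmetricCategory H]

/-- Multiplication of a morphism by a scalar. -/
def ScalarIso.smul (scal : ScalarIso R H) (s : R) {X Y : H} (f : X ⟶ Y) : X ⟶ Y :=
  (λ_ X).inv ≫ (scal.toEquiv s ⊗ₘ f) ≫ (λ_ Y).hom

/-- Semantics of the functional generators. -/
noncomputable def semGen (scal : ScalarIso R H) :
    ∀ {X Y : Wires}, FGen R X Y → (wiresObj H X ⟶ wiresObj H Y)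
  | _, _, .tensor A B => (fst : parObj (colorObj H A) (colorObj H B) ⟶ _)
  | _, _, .tensorM A B => (inl : _ ⟶ parObj (colorObj H A) (colorObj H B))
  | _, _, .plus A B => (snd : parObj (colorObj H A) (colorObj H B) ⟶ _)
  | _, _, .plusM A B => (inr : _ ⟶ parObj (colorObj H A) (colorObj H B))
  | _, _, .contr A =>
      (snd ≫ desc (𝟙 (colorObj H A)) (𝟙 (colorObj H A)) :
        parObj (colorObj H A) (colorObj H A) ⟶ _)
  | _, _, .contrM A =>
      (lift (𝟙 (colorObj H A)) (𝟙 (colorObj H A)) ≫ inr :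
        _ ⟶ parObj (colorObj H A) (colorObj H A))
  | _, _, .null _ => 0
  | _, _, .nullM _ => 0
  | _, _, .adapter h => (adapterIso H h).hom
  | _, _, .scalar s A => scal.smul s (𝟙 (colorObj H A))

/-- Semantics of functional diagrams. -/
noncomputable def sem (scal : ScalarIso R H) :
    ∀ {X Y : Wires}, FDiag R X Y → (wiresObj H X ⟶ wiresObj H Y)
  | _, _, .id X => 𝟙 (wiresObj H X)
  | _, _, .swap A B => parSwap (colorObj H A) (colorObj H B)
  | _, _, .gen g => semGen scal g
  | _, _, .comp d e => sem scal d ≫ sem scal e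
  | _, _, .par (X := X) (Y := Y) (X' := X') (Y' := Y') d e =>
      appendInv H X X' ≫ parMap (sem scal d) (sem scal e) ≫ appendHom H Y Y'

/-- Semantics of the generators of the full calculus. -/
noncomputable def semFullGen (scal : ScalarIso R H) :
    ∀ {X Y : Wires}, Gen R X Y → ((wiresObj H X ⊕' 𝟙_ H) ⟶ (wiresObj H Y ⊕' 𝟙_ H))
  | _, _, .fn g => sumMap (semGen scal g) (𝟙 (𝟙_ H))
  | _, _, .unit =>
      (snd ≫ lift (𝟙 (𝟙_ H)) (𝟙 (𝟙_ H)) :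
        ((Semiadditive.zeroObj : H) ⊕' 𝟙_ H) ⟶ (𝟙_ H ⊕' 𝟙_ H))
  | _, _, .unitM =>
      (desc (𝟙 (𝟙_ H)) (𝟙 (𝟙_ H)) ≫ inr :
        (𝟙_ H ⊕' 𝟙_ H) ⟶ ((Semiadditive.zeroObj : H) ⊕' 𝟙_ H))

/-- Semantics of the full calculus. -/
noncomputable def semFull (scal : ScalarIso R H) :
    ∀ {X Y : Wires}, FullDiag R X Y → ((wiresObj H X ⊕' 𝟙_ H) ⟶ (wiresObj H Y ⊕' 𝟙_ H))
  | _, _, .id X => 𝟙 (wiresObj H X ⊕' 𝟙_ H)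
  | _, _, .swap A B => sumMap (parSwap (colorObj H A) (colorObj H B)) (𝟙 (𝟙_ H))
  | _, _, .gen g => semFullGen scal g
  | _, _, .comp d e => semFull scal d ≫ semFull scal e
  | _, _, .par (X := X) (Y := Y) (X' := X') (Y' := Y') d e =>
      sumMap (appendInv H X X') (𝟙 (𝟙_ H)) ≫ expandInv (wiresObj H X) (wiresObj H X') ≫
        (semFull scal d ⊗ₘ semFull scal e) ≫
        expandHom (wiresObj H Y) (wiresObj H Y') ≫ sumMap (appendHom H Y Y') (𝟙 (𝟙_ H))

end Semantics

/-- Membership of a morphism in the category with a unit adjoined to every object: its component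
between the adjoined units is `1` plus some scalar. -/
def InPlusOne {H : Type u} [Category.{v} H] [Limits.HasZeroMorphisms H] [Semiadditive H]
    [MonoidalCategory H] {X Y : H} (f : (X ⊕' 𝟙_ H) ⟶ (Y ⊕' 𝟙_ H)) : Prop :=
  ∃ g : (X ⊕' 𝟙_ H) ⟶ (Y ⊕' 𝟙_ H), f = homAdd g (snd ≫ inr)

end TensorPlus

set_option linter.unusedSectionVars false

namespace TensorPlus

/-! ### Biproduct calculus and addition of morphisms -/

section Addition

variable {H : Type u} [Category.{v} H] [Limits.HasZeroMorphisms H] [Semiadditive H]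

/-! Adjoining a unit turns the parallel product into the tensor product. By distributivity, (X ⊕ 1)
⊗ (Y ⊕ 1) is isomorphic to (X ⊗ Y) ⊕ (X ⊕ Y) ⊕ 1, that is, to (X | Y) ⊕ 1, naturally and compatibly
with associativity, units and symmetries (`expand`, `expandHom_naturality`, `expandHom_parAssocInv`,
`expandHom_parSwap`). Moreover f ↦ f ⊕ id₁ is faithful. The laws of a PROP are therefore inherited
from the symmetric monoidal structure of ⊗, for both semantics at once: `UnitInterp` captures the
assignments in which ∥ is ⊗ conjugated by `unitAppend`, and both the full semantics and d ↦ `sem d`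
⊕ id₁ are of this kind. What is needed is coherence of `unitAppend` for lists of wires, obtained by
induction on the lists: associativity (`unitAppend_assoc`), the left unit (`nil_unitAppend`), and
the fact that block swaps denote braidings (`val_swapBlock`). Then `val_equiv` reduces soundness to
the axioms and their mirrors.

The axioms are equations between matrices. X | Y has three summands, X ⊗ Y, X and Y, and a triple
product has seven, one for each nonempty set of factors. Morphisms are compared on generic elements
`parT`, `parL`, `parR` of these summands. Every generator and structural isomorphism sends such
elements to such elements, to sums of them or to zero, up to a change of stage, so that each axiom
becomes a rewriting computation.

Adapters are interpreted through an arbitrarily chosen derivation of A ≈ A'. The choice is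
immaterial by a coherence theorem for two monoidal structures without any interaction between them:
colours have normal forms under strictly associative and unital joins, and a derivation, compared
with the canonical isomorphisms to normal forms, becomes a transport along an equality of colours
(`adapterTermIso_normalIso`).

For the full calculus, u and its mirror add or remove the adjoined unit. The diagram c_s denotes a 2
× 2 matrix on 1 ⊕ 1 in which s occurs only in the entry s + 1 (`can_eq`), whence the cancellation
axiom. Finally, e = ι_r ∘ π_r is idempotent under composition, and e ⊗ e is e after conjugation by
the expansion. So morphisms of the form g + e are closed under both compositions. -/

theorem comp_lift {V W X Y : H} (h : V ⟶ W) (f : W ⟶ X) (g : W ⟶ Y) :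
    h ≫ lift f g = lift (h ≫ f) (h ≫ g) := by
  apply sum_hom_ext <;> simp

theorem desc_comp {W W' X Y : H} (f : X ⟶ W) (g : Y ⟶ W) (h : W ⟶ W') :
    desc f g ≫ h = desc (f ≫ h) (g ≫ h) := by
  apply sum_hom_ext' <;> rw [← Category.assoc] <;> simp

theorem inl_sumMap {X X' Y Y' : H} (f : X ⟶ X') (g : Y ⟶ Y') :
    inl ≫ sumMap f g = f ≫ inl := inl_desc _ _

theorem inr_sumMap {X X' Y Y' : H} (f : X ⟶ X') (g : Y ⟶ Y') :
    inr ≫ sumMap f g = g ≫ inr := inr_desc _ _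

theorem sumMap_fst {X X' Y Y' : H} (f : X ⟶ X') (g : Y ⟶ Y') :
    sumMap f g ≫ fst = fst ≫ f := by
  apply sum_hom_ext' <;> simp only [← Category.assoc, inl_sumMap, inr_sumMap] <;> simp

theorem sumMap_snd {X X' Y Y' : H} (f : X ⟶ X') (g : Y ⟶ Y') :
    sumMap f g ≫ snd = snd ≫ g := by
  apply sum_hom_ext' <;> simp only [← Category.assoc, inl_sumMap, inr_sumMap] <;> simp

theorem lift_sumMap {W X X' Y Y' : H} (a : W ⟶ X) (b : W ⟶ Y) (f : X ⟶ X') (g : Y ⟶ Y') :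
    lift a b ≫ sumMap f g = lift (a ≫ f) (b ≫ g) := by
  apply sum_hom_ext <;> simp only [Category.assoc, sumMap_fst, sumMap_snd] <;>
    simp [← Category.assoc]

theorem sumMap_desc {W X X' Y Y' : H} (a : X' ⟶ W) (b : Y' ⟶ W) (f : X ⟶ X') (g : Y ⟶ Y') :
    sumMap f g ≫ desc a b = desc (f ≫ a) (g ≫ b) := by
  apply sum_hom_ext' <;> simp only [← Category.assoc, inl_sumMap, inr_sumMap] <;> simp

theorem sumMap_id (X Y : H) : sumMap (𝟙 X) (𝟙 Y) = 𝟙 (X ⊕' Y) := by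
  apply sum_hom_ext' <;> simp [sumMap]

theorem sumMap_comp {X X' X'' Y Y' Y'' : H} (f : X ⟶ X') (f' : X' ⟶ X'') (g : Y ⟶ Y')
    (g' : Y' ⟶ Y'') : sumMap (f ≫ f') (g ≫ g') = sumMap f g ≫ sumMap f' g' := by
  apply sum_hom_ext' <;> simp only [← Category.assoc, inl_sumMap, inr_sumMap] <;>
    simp only [Category.assoc, inl_sumMap, inr_sumMap]

/-- The first diagonal block is recovered by composing with the left injection and projection. This
brings soundness for objects with a unit adjoined back to the functional semantics. -/
theorem sumMap_id_faithful {X Y Z : H} {f g : X ⟶ Y}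
    (h : sumMap f (𝟙 Z) = sumMap g (𝟙 Z)) : f = g := by
  have := congrArg (fun k => inl ≫ k ≫ fst) h
  simpa [sumMap_fst, ← Category.assoc] using this

theorem homAdd_eq_lift {X Y : H} (f g : X ⟶ Y) : homAdd f g = lift f g ≫ desc (𝟙 Y) (𝟙 Y) := by
  rw [homAdd, ← Category.assoc, lift_sumMap]; simp

theorem homAdd_eq_desc {X Y : H} (f g : X ⟶ Y) : homAdd f g = lift (𝟙 X) (𝟙 X) ≫ desc f g := by
  rw [homAdd, sumMap_desc]; simp

/-- Matrix product of a column and a row: the two paths through the middle biproduct are added. -/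
theorem lift_desc {X Y W Z : H} (a : X ⟶ Y) (b : X ⟶ W) (c : Y ⟶ Z) (d : W ⟶ Z) :
    lift a b ≫ desc c d = homAdd (a ≫ c) (b ≫ d) := by
  rw [homAdd_eq_lift, ← lift_sumMap, Category.assoc, sumMap_desc]; simp

/-- The associator is defined by its restrictions to summands; the form by components is the one
that composes with pairings. -/
theorem sumAssoc_hom_eq (X Y Z : H) :
    (sumAssoc X Y Z).hom = lift (fst ≫ fst) (lift (fst ≫ snd) snd) := by
  refine sum_hom_ext' (sum_hom_ext' ?_ ?_) ?_ <;>
    simp only [sumAssoc, ← Category.assoc, inl_desc, inr_desc, comp_lift, inl_fst, inl_snd,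
      inr_fst, inr_snd, Category.id_comp, Limits.zero_comp] <;>
    refine sum_hom_ext ?_ (sum_hom_ext ?_ ?_) <;> simp

/-- Addition of morphisms in a semiadditive category. -/
instance homHasAdd (X Y : H) : Add (X ⟶ Y) := ⟨homAdd⟩

theorem homAdd_zero {X Y : H} (f : X ⟶ Y) : homAdd f 0 = f := by
  have : lift f (0 : X ⟶ Y) = f ≫ inl := by apply sum_hom_ext <;> simp
  rw [homAdd_eq_lift, this]; simp

theorem zero_homAdd {X Y : H} (f : X ⟶ Y) : homAdd 0 f = f := by
  have : lift (0 : X ⟶ Y) f = f ≫ inr := by apply sum_hom_ext <;> simp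
  rw [homAdd_eq_lift, this]; simp

/-- Exchanging the two components of a pairing is absorbed by the codiagonal, whose invariance needs
only the two zero laws. -/
theorem homAdd_comm {X Y : H} (f g : X ⟶ Y) : homAdd f g = homAdd g f := by
  have : lift g f = lift f g ≫ lift snd fst := by
    apply sum_hom_ext <;> simp
  have h : lift snd fst ≫ desc (𝟙 Y) (𝟙 Y) = desc (𝟙 Y) (𝟙 Y) := by
    apply sum_hom_ext' <;> simp only [← Category.assoc, comp_lift] <;>
      simp [lift_desc, homAdd_zero, zero_homAdd]
  rw [homAdd_eq_lift g f, this, Category.assoc, h, homAdd_eq_lift]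

/-- Either bracketing is a triple pairing followed by a triple codiagonal, and the associator of the
biproduct carries one to the other. -/
theorem homAdd_assoc {X Y : H} (f g h : X ⟶ Y) :
    homAdd (homAdd f g) h = homAdd f (homAdd g h) := by
  have h₁ : homAdd (homAdd f g) h = lift (lift f g) h ≫ desc (desc (𝟙 Y) (𝟙 Y)) (𝟙 Y) := by
    rw [lift_desc, ← homAdd_eq_lift]; simp
  have h₂ : homAdd f (homAdd g h) = lift f (lift g h) ≫ desc (𝟙 Y) (desc (𝟙 Y) (𝟙 Y)) := by
    rw [lift_desc, ← homAdd_eq_lift]; simp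
  have h₃ : desc (desc (𝟙 Y) (𝟙 Y)) (𝟙 Y)
      = (sumAssoc Y Y Y).hom ≫ desc (𝟙 Y) (desc (𝟙 Y) (𝟙 Y)) := by
    refine sum_hom_ext' (sum_hom_ext' ?_ ?_) ?_ <;>
      simp [sumAssoc, desc_comp]
  have h₄ : lift (lift f g) h ≫ (sumAssoc Y Y Y).hom = lift f (lift g h) := by
    rw [sumAssoc_hom_eq]
    simp only [comp_lift, ← Category.assoc, lift_fst, lift_snd]
  rw [h₁, h₂, h₃, ← Category.assoc, h₄]

/-- Morphisms of a semiadditive category form commutative monoids. -/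
instance homAddCommMonoid (X Y : H) : AddCommMonoid (X ⟶ Y) where
  nsmul := nsmulRec
  zero_add := zero_homAdd
  add_zero := homAdd_zero
  add_comm := homAdd_comm
  add_assoc := homAdd_assoc

theorem homAdd_eq_add {X Y : H} (f g : X ⟶ Y) : homAdd f g = f + g := rfl

theorem comp_add {W X Y : H} (h : W ⟶ X) (f g : X ⟶ Y) : h ≫ (f + g) = h ≫ f + h ≫ g := by
  simp only [← homAdd_eq_add, homAdd_eq_lift, ← Category.assoc, comp_lift]

theorem add_comp {W X Y : H} (f g : W ⟶ X) (h : X ⟶ Y) : (f + g) ≫ h = f ≫ h + g ≫ h := by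
  simp only [← homAdd_eq_add, homAdd_eq_desc, Category.assoc, desc_comp]

theorem lift_eq_add {W X Y : H} (f : W ⟶ X) (g : W ⟶ Y) : lift f g = f ≫ inl + g ≫ inr := by
  apply sum_hom_ext <;> simp [add_comp]

theorem desc_eq_add {W X Y : H} (f : X ⟶ W) (g : Y ⟶ W) : desc f g = fst ≫ f + snd ≫ g := by
  apply sum_hom_ext' <;> simp [comp_add, ← Category.assoc]

end Addition

/-! ### Additivity of the tensor product -/

section TensorAdditive

variable {H : Type u} [Category.{v} H] [Limits.HasZeroMorphisms H] [Semiadditive H]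
  [MonoidalCategory H] [SymmetricCategory H] [Distributive H]

/-- A zero morphism factors through the zero object, which tensoring on the left keeps zero. -/
theorem whiskerLeft_zero' (X Y Z : H) : X ◁ (0 : Y ⟶ Z) = 0 := by
  have h : (0 : Y ⟶ Z) = (0 : Y ⟶ (Semiadditive.zeroObj : H)) ≫ 0 := by simp
  rw [h, whiskerLeft_comp,
    (Distributive.isZero_tensor_zeroObj X).eq_of_tgt (X ◁ (0 : Y ⟶ (Semiadditive.zeroObj : H))) 0]
  simp

theorem zero_whiskerRight' (X Y Z : H) : (0 : Y ⟶ Z) ▷ X = 0 := by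
  have := BraidedCategory.braiding_naturality_right X (0 : Y ⟶ Z)
  rw [whiskerLeft_zero', Limits.zero_comp] at this
  simpa using (congrArg (fun k => (β_ X Y).inv ≫ k) this).symm

theorem inl_distL (X Y Z : H) : X ◁ inl ≫ distL X Y Z = inl := by
  apply sum_hom_ext <;> simp [distL, ← whiskerLeft_comp, whiskerLeft_zero']

theorem inr_distL (X Y Z : H) : X ◁ inr ≫ distL X Y Z = inr := by
  apply sum_hom_ext <;> simp [distL, ← whiskerLeft_comp, whiskerLeft_zero']

theorem inl_distR (X Y Z : H) : inl ▷ Z ≫ distR X Y Z = inl := by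
  apply sum_hom_ext <;> simp [distR, ← comp_whiskerRight, zero_whiskerRight']

theorem inr_distR (X Y Z : H) : inr ▷ Z ≫ distR X Y Z = inr := by
  apply sum_hom_ext <;> simp [distR, ← comp_whiskerRight, zero_whiskerRight']

/-- The comparison morphism is invertible by hypothesis, so the candidate inverse need only be
tested after composing with the comparison again. -/
theorem distL_desc (X Y Z : H) :
    distL X Y Z ≫ desc (X ◁ inl) (X ◁ inr) = 𝟙 _ := by
  have := Distributive.isIso_distL X Y Z
  rw [← cancel_mono (distL X Y Z), Category.assoc, desc_comp, inl_distL, inr_distL,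
    Category.id_comp]
  have : desc inl inr = 𝟙 ((X ⊗ Y) ⊕' (X ⊗ Z)) := by apply sum_hom_ext' <;> simp
  simp [this]

/-- The whiskered injections are jointly epic. Invertibility of the comparison morphism is used from
here on only in this form. -/
theorem whiskerLeft_sum_ext {X Y Z W : H} {f g : X ⊗ (Y ⊕' Z) ⟶ W}
    (h₁ : X ◁ inl ≫ f = X ◁ inl ≫ g) (h₂ : X ◁ inr ≫ f = X ◁ inr ≫ g) : f = g := by
  rw [← Category.id_comp f, ← Category.id_comp g, ← distL_desc, Category.assoc, Category.assoc,
    desc_comp, desc_comp, h₁, h₂]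

theorem whiskerRight_sum_ext {X Y Z W : H} {f g : (Y ⊕' Z) ⊗ X ⟶ W}
    (h₁ : inl ▷ X ≫ f = inl ▷ X ≫ g) (h₂ : inr ▷ X ≫ f = inr ▷ X ≫ g) : f = g := by
  rw [← cancel_epi (β_ X (Y ⊕' Z)).hom]
  apply whiskerLeft_sum_ext <;> simp only [← Category.assoc,
    BraidedCategory.braiding_naturality_right] <;>
    simp only [Category.assoc, h₁, h₂]

/-- A sum is a pairing followed by a codiagonal, and tensoring carries each of the two to its
counterpart through the comparison morphism. -/
theorem whiskerLeft_add' (X : H) {Y Z : H} (f g : Y ⟶ Z) : X ◁ (f + g) = X ◁ f + X ◁ g := by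
  have h₁ : X ◁ lift f g ≫ distL X Z Z = lift (X ◁ f) (X ◁ g) := by
    simp only [distL, comp_lift, ← whiskerLeft_comp, lift_fst, lift_snd]
  have h₂ : X ◁ desc (𝟙 Z) (𝟙 Z) = distL X Z Z ≫ desc (𝟙 _) (𝟙 _) := by
    apply whiskerLeft_sum_ext <;>
      simp only [← whiskerLeft_comp, ← Category.assoc, inl_distL, inr_distL] <;> simp
  rw [← homAdd_eq_add, homAdd_eq_lift, whiskerLeft_comp, h₂, ← Category.assoc, h₁,
    ← homAdd_eq_lift, homAdd_eq_add]

theorem add_whiskerRight' (X : H) {Y Z : H} (f g : Y ⟶ Z) : (f + g) ▷ X = f ▷ X + g ▷ X := by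
  have h := fun k : Y ⟶ Z => BraidedCategory.braiding_naturality_right X k
  rw [← cancel_epi (β_ X Y).hom, comp_add, ← h, ← h, ← h, whiskerLeft_add', add_comp]

end TensorAdditive

/-! ### Generalized elements of sums, tensors and parallel products -/

section Elements

variable {H : Type u} [Category.{v} H] [Limits.HasZeroMorphisms H] [Semiadditive H]
  [MonoidalCategory H]

/-- Precomposition, kept apart from composition so that it can be moved outwards. -/
def pre {S S' X : H} (s : S ⟶ S') (x : S' ⟶ X) : S ⟶ X := s ≫ x

/-- Tensor of generalized elements. -/
def tens {S T X Y : H} (x : S ⟶ X) (y : T ⟶ Y) : S ⊗ T ⟶ X ⊗ Y := x ⊗ₘ y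

/-- A generalized element of the left summand. -/
def sumL {S X : H} (Y : H) (x : S ⟶ X) : S ⟶ (X ⊕' Y) := x ≫ inl

/-- A generalized element of the right summand. -/
def sumR {S Y : H} (X : H) (y : S ⟶ Y) : S ⟶ (X ⊕' Y) := y ≫ inr

/-- A pair of generalized elements in a parallel composition. -/
def parT {S T X Y : H} (x : S ⟶ X) (y : T ⟶ Y) : S ⊗ T ⟶ parObj X Y := (x ⊗ₘ y) ≫ inl

/-- A generalized element of the left part of a parallel composition. -/
def parL {S X : H} (Y : H) (x : S ⟶ X) : S ⟶ parObj X Y := x ≫ inl ≫ inr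

/-- A generalized element of the right part of a parallel composition. -/
def parR {S Y : H} (X : H) (y : S ⟶ Y) : S ⟶ parObj X Y := y ≫ inr ≫ inr

theorem pre_comp {S S' X Y : H} (s : S ⟶ S') (x : S' ⟶ X) (f : X ⟶ Y) :
    pre s x ≫ f = pre s (x ≫ f) := Category.assoc _ _ _

theorem pre_pre {S S' S'' X : H} (s : S ⟶ S') (t : S' ⟶ S'') (x : S'' ⟶ X) :
    pre s (pre t x) = pre (s ≫ t) x := (Category.assoc _ _ _).symm

theorem pre_id {S X : H} (x : S ⟶ X) : pre (𝟙 S) x = x := Category.id_comp _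

theorem pre_add {S S' X : H} (s : S ⟶ S') (x y : S' ⟶ X) :
    pre s (x + y) = pre s x + pre s y := comp_add _ _ _

theorem pre_zero {S S' X : H} (s : S ⟶ S') : pre s (0 : S' ⟶ X) = 0 := Limits.comp_zero

theorem sumL_pre {S S' X Y : H} (s : S ⟶ S') (x : S' ⟶ X) :
    sumL Y (pre s x) = pre s (sumL Y x) := Category.assoc _ _ _

theorem parL_pre {S S' X Y : H} (s : S ⟶ S') (x : S' ⟶ X) :
    parL Y (pre s x) = pre s (parL Y x) := Category.assoc _ _ _

theorem parR_pre {S S' X Y : H} (s : S ⟶ S') (x : S' ⟶ X) :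
    parR Y (pre s x) = pre s (parR Y x) := Category.assoc _ _ _

theorem tens_pre_left {S S' T X Y : H} (s : S ⟶ S') (x : S' ⟶ X) (y : T ⟶ Y) :
    tens (pre s x) y = pre (s ▷ T) (tens x y) := by
  simp [tens, pre, MonoidalCategory.tensorHom_def]

theorem tens_pre_right {S T T' X Y : H} (t : T ⟶ T') (x : S ⟶ X) (y : T' ⟶ Y) :
    tens x (pre t y) = pre (S ◁ t) (tens x y) := by
  simp [tens, pre, MonoidalCategory.tensorHom_def']

theorem sumL_add {S X Y : H} (x x' : S ⟶ X) : sumL Y (x + x') = sumL Y x + sumL Y x' :=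
  add_comp _ _ _

theorem sumR_add {S X Y : H} (x x' : S ⟶ X) : sumR Y (x + x') = sumR Y x + sumR Y x' :=
  add_comp _ _ _

theorem parL_add {S X Y : H} (x x' : S ⟶ X) : parL Y (x + x') = parL Y x + parL Y x' :=
  add_comp _ _ _

theorem parR_add {S X Y : H} (x x' : S ⟶ X) : parR Y (x + x') = parR Y x + parR Y x' :=
  add_comp _ _ _

theorem sumL_zero {S X : H} (Y : H) : sumL Y (0 : S ⟶ X) = 0 := Limits.zero_comp

theorem parL_zero {S X : H} (Y : H) : parL Y (0 : S ⟶ X) = 0 := Limits.zero_comp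

theorem parR_zero {S X : H} (Y : H) : parR Y (0 : S ⟶ X) = 0 := Limits.zero_comp

/-- The tensor generator, as a projection. -/
def opT (X Y : H) : parObj X Y ⟶ X ⊗ Y := fst

/-- The reflected tensor generator, as an injection. -/
def opTm (X Y : H) : X ⊗ Y ⟶ parObj X Y := inl

/-- The plus generator, as a projection. -/
def opP (X Y : H) : parObj X Y ⟶ (X ⊕' Y) := snd

/-- The reflected plus generator, as an injection. -/
def opPm (X Y : H) : (X ⊕' Y) ⟶ parObj X Y := inr

/-- The contraction. -/
def opK (X : H) : parObj X X ⟶ X := snd ≫ desc (𝟙 X) (𝟙 X)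

/-- The reflected contraction. -/
def opKm (X : H) : X ⟶ parObj X X := lift (𝟙 X) (𝟙 X) ≫ inr

theorem parT_opT {S T X Y : H} (x : S ⟶ X) (y : T ⟶ Y) : parT x y ≫ opT X Y = tens x y := by
  unfold parT opT tens parObj; simp

theorem parL_opT {S X Y : H} (x : S ⟶ X) : parL Y x ≫ opT X Y = 0 := by
  unfold parL opT parObj; simp

theorem parR_opT {S X Y : H} (y : S ⟶ Y) : parR X y ≫ opT X Y = 0 := by
  unfold parR opT parObj; simp

theorem tens_opTm {S T X Y : H} (x : S ⟶ X) (y : T ⟶ Y) : tens x y ≫ opTm X Y = parT x y := rfl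

theorem parT_pre_left {S S' T X Y : H} (s : S ⟶ S') (x : S' ⟶ X) (y : T ⟶ Y) :
    parT (pre s x) y = pre (s ▷ T) (parT x y) := by
  rw [← tens_opTm, ← tens_opTm, ← pre_comp, tens_pre_left]

theorem parT_pre_right {S T T' X Y : H} (t : T ⟶ T') (x : S ⟶ X) (y : T' ⟶ Y) :
    parT x (pre t y) = pre (S ◁ t) (parT x y) := by
  rw [← tens_opTm, ← tens_opTm, ← pre_comp, tens_pre_right]

theorem parT_opP {S T X Y : H} (x : S ⟶ X) (y : T ⟶ Y) : parT x y ≫ opP X Y = 0 := by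
  unfold parT opP parObj; simp

theorem parL_opP {S X Y : H} (x : S ⟶ X) : parL Y x ≫ opP X Y = sumL Y x := by
  unfold parL opP sumL parObj; simp

theorem parR_opP {S X Y : H} (y : S ⟶ Y) : parR X y ≫ opP X Y = sumR X y := by
  unfold parR opP sumR parObj; simp

theorem sumL_opPm {S X Y : H} (x : S ⟶ X) : sumL Y x ≫ opPm X Y = parL Y x :=
  Category.assoc _ _ _

theorem sumR_opPm {S X Y : H} (y : S ⟶ Y) : sumR X y ≫ opPm X Y = parR X y :=
  Category.assoc _ _ _

theorem parT_opK {S T X : H} (x : S ⟶ X) (y : T ⟶ X) : parT x y ≫ opK X = 0 := by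
  unfold parT opK parObj; simp only [Category.assoc]; rw [← Category.assoc inl]; simp

theorem parL_opK {S X : H} (x : S ⟶ X) : parL X x ≫ opK X = x := by
  unfold parL opK parObj; simp only [Category.assoc]; rw [← Category.assoc inr]; simp

theorem parR_opK {S X : H} (x : S ⟶ X) : parR X x ≫ opK X = x := by
  unfold parR opK parObj
  simp only [Category.assoc]; rw [← Category.assoc inr snd, inr_snd, Category.id_comp]; simp

/-- The diagonal is the sum of the two injections; this is where sums of elements enter the
functional computations. -/
theorem comp_opKm {S X : H} (x : S ⟶ X) : x ≫ opKm X = parL X x + parR X x := by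
  unfold opKm parL parR parObj; simp [lift_eq_add, add_comp, comp_add]

theorem parT_parMap {S T X X' Y Y' : H} (x : S ⟶ X) (y : T ⟶ Y) (f : X ⟶ X') (g : Y ⟶ Y') :
    parT x y ≫ parMap f g = parT (x ≫ f) (y ≫ g) := by
  unfold parT parMap parObj; simp [inl_sumMap]

theorem parL_parMap {S X X' Y Y' : H} (x : S ⟶ X) (f : X ⟶ X') (g : Y ⟶ Y') :
    parL Y x ≫ parMap f g = parL Y' (x ≫ f) := by
  unfold parL parMap parObj
  simp only [Category.assoc, inr_sumMap]
  rw [← Category.assoc inl, inl_sumMap, Category.assoc]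

theorem parR_parMap {S X X' Y Y' : H} (y : S ⟶ Y) (f : X ⟶ X') (g : Y ⟶ Y') :
    parR X y ≫ parMap f g = parR X' (y ≫ g) := by
  unfold parR parMap parObj
  simp only [Category.assoc, inr_sumMap]
  rw [← Category.assoc inr (sumMap f g), inr_sumMap, Category.assoc]

/-- Equality is tested on the generic element of each of the three summands. -/
theorem par_ext {X Y W : H} {f g : parObj X Y ⟶ W} (hT : parT (𝟙 X) (𝟙 Y) ≫
    f = parT (𝟙 X) (𝟙 Y) ≫ g)
    (hL : parL Y (𝟙 X) ≫ f = parL Y (𝟙 X) ≫ g) (hR : parR X (𝟙 Y) ≫ f = parR X (𝟙 Y) ≫ g) :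
    f = g := by
  refine sum_hom_ext' ?_ (sum_hom_ext' ?_ ?_)
  · unfold parT parObj at hT; simpa using hT
  · unfold parL at hL; rw [Category.id_comp] at hL
    exact (Category.assoc _ _ _).symm.trans (hL.trans (Category.assoc _ _ _))
  · unfold parR at hR; rw [Category.id_comp] at hR
    exact (Category.assoc _ _ _).symm.trans (hR.trans (Category.assoc _ _ _))

theorem sum_ext {X Y W : H} {f g : (X ⊕' Y) ⟶ W} (hL : sumL Y (𝟙 X) ≫ f = sumL Y (𝟙 X) ≫ g)
    (hR : sumR X (𝟙 Y) ≫ f = sumR X (𝟙 Y) ≫ g) : f = g := by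
  refine sum_hom_ext' ?_ ?_
  · simpa [sumL] using hL
  · simpa [sumR] using hR

theorem tens_id (X Y : H) : tens (𝟙 X) (𝟙 Y) = 𝟙 (X ⊗ Y) := by simp [tens]

theorem tens_comp {S T X Y X' Y' : H} (x : S ⟶ X) (y : T ⟶ Y) (f : X ⟶ X') (g : Y ⟶ Y') :
    tens x y ≫ (f ⊗ₘ g) = tens (x ≫ f) (y ≫ g) := by simp [tens]

theorem tens_associator {S T U X Y Z : H} (x : S ⟶ X) (y : T ⟶ Y) (z : U ⟶ Z) :
    tens (tens x y) z ≫ (α_ X Y Z).hom = pre (α_ S T U).hom (tens x (tens y z)) := by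
  simp only [tens, pre, associator_naturality]

theorem tens_associator_inv {S T U X Y Z : H} (x : S ⟶ X) (y : T ⟶ Y) (z : U ⟶ Z) :
    tens x (tens y z) ≫ (α_ X Y Z).inv = pre (α_ S T U).inv (tens (tens x y) z) := by
  simp only [tens, pre, associator_inv_naturality]

theorem tens_rightUnitor {S X : H} (x : S ⟶ X) :
    tens x (𝟙 (𝟙_ H)) ≫ (ρ_ X).hom = pre (ρ_ S).hom x := by
  simp [tens, pre]

theorem tens_leftUnitor {S X : H} (x : S ⟶ X) :
    tens (𝟙 (𝟙_ H)) x ≫ (λ_ X).hom = pre (λ_ S).hom x := by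
  simp [tens, pre]

theorem comp_rightUnitor_inv {S X : H} (x : S ⟶ X) :
    x ≫ (ρ_ X).inv = pre (ρ_ S).inv (tens x (𝟙 (𝟙_ H))) := by
  simp [tens, pre]

theorem comp_leftUnitor_inv {S X : H} (x : S ⟶ X) :
    x ≫ (λ_ X).inv = pre (λ_ S).inv (tens (𝟙 (𝟙_ H)) x) := by
  simp [tens, pre]

end Elements

/-! ### Evaluation of the symmetry and the associator of the parallel product -/

section ElementsSymmetric

variable {H : Type u} [Category.{v} H] [Limits.HasZeroMorphisms H] [Semiadditive H]
  [MonoidalCategory H] [SymmetricCategory H]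

/-- Exchanging the factors also exchanges their stages; the braiding of the stages is kept outside
as a reparametrization. -/
theorem parT_parSwap {S T X Y : H} (x : S ⟶ X) (y : T ⟶ Y) :
    parT x y ≫ parSwap X Y = pre (β_ S T).hom (parT y x) := by
  unfold parT parSwap pre parObj; simp [inl_sumMap]

theorem parL_parSwap {S X Y : H} (x : S ⟶ X) : parL Y x ≫ parSwap X Y = parR Y x := by
  have : inl ≫ lift (snd : (X ⊕' Y) ⟶ Y) fst = inr := by
    rw [comp_lift]; apply sum_hom_ext <;> simp
  unfold parL parR parSwap parObj
  simp only [Category.assoc, inr_sumMap]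
  rw [← Category.assoc inl, this]

theorem parR_parSwap {S X Y : H} (y : S ⟶ Y) : parR X y ≫ parSwap X Y = parL X y := by
  have : inr ≫ lift (snd : (X ⊕' Y) ⟶ Y) fst = inl := by
    rw [comp_lift]; apply sum_hom_ext <;> simp
  unfold parL parR parSwap parObj
  simp only [Category.assoc, inr_sumMap]
  rw [← Category.assoc inr, this]

variable [Distributive H]

theorem tens_add_left {S T X Y : H} (x x' : S ⟶ X) (y : T ⟶ Y) :
    tens (x + x') y = tens x y + tens x' y := by
  simp only [tens, MonoidalCategory.tensorHom_def, add_whiskerRight', add_comp]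

theorem tens_add_right {S T X Y : H} (x : S ⟶ X) (y y' : T ⟶ Y) :
    tens x (y + y') = tens x y + tens x y' := by
  simp only [tens, MonoidalCategory.tensorHom_def, whiskerLeft_add', comp_add]

theorem tens_zero_left {S T X Y : H} (y : T ⟶ Y) : tens (0 : S ⟶ X) y = 0 := by
  simp only [tens, MonoidalCategory.tensorHom_def, zero_whiskerRight', Limits.zero_comp]

theorem tens_zero_right {S T X Y : H} (x : S ⟶ X) : tens x (0 : T ⟶ Y) = 0 := by
  simp only [tens, MonoidalCategory.tensorHom_def, whiskerLeft_zero', Limits.comp_zero]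

theorem parT_eq {S T X Y : H} (x : S ⟶ X) (y : T ⟶ Y) : parT x y = tens x y ≫ opTm X Y := rfl

theorem parT_add_left {S T X Y : H} (x x' : S ⟶ X) (y : T ⟶ Y) :
    parT (x + x') y = parT x y + parT x' y := by
  simp only [parT_eq, tens_add_left, add_comp]

theorem parT_add_right {S T X Y : H} (x : S ⟶ X) (y y' : T ⟶ Y) :
    parT x (y + y') = parT x y + parT x y' := by
  simp only [parT_eq, tens_add_right, add_comp]

theorem parT_zero_left {S T X Y : H} (y : T ⟶ Y) : parT (0 : S ⟶ X) y = 0 := by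
  simp only [parT_eq, tens_zero_left, Limits.zero_comp]

theorem parT_zero_right {S T X Y : H} (x : S ⟶ X) : parT x (0 : T ⟶ Y) = 0 := by
  simp only [parT_eq, tens_zero_right, Limits.zero_comp]

theorem parL_eq_sumR {S X Y : H} (x : S ⟶ X) : parL Y x = sumR (X ⊗ Y) (sumL Y x) :=
  (Category.assoc _ _ _).symm

theorem parR_eq_sumR {S X Y : H} (y : S ⟶ Y) : parR X y = sumR (X ⊗ Y) (sumR X y) :=
  (Category.assoc _ _ _).symm

theorem comp_inl {S X Y : H} (x : S ⟶ X) : x ≫ inl = sumL Y x := rfl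

theorem comp_inr {S X Y : H} (y : S ⟶ Y) : y ≫ inr = sumR X y := rfl

theorem sumL_desc {S X Y W : H} (x : S ⟶ X) (f : X ⟶ W) (g : Y ⟶ W) :
    sumL Y x ≫ desc f g = x ≫ f := by simp [sumL]

theorem sumR_desc {S X Y W : H} (y : S ⟶ Y) (f : X ⟶ W) (g : Y ⟶ W) :
    sumR X y ≫ desc f g = y ≫ g := by simp [sumR]

theorem sumL_sumMap {S X Y X' Y' : H} (x : S ⟶ X) (f : X ⟶ X') (g : Y ⟶ Y') :
    sumL Y x ≫ sumMap f g = sumL Y' (x ≫ f) := by simp [sumL, inl_sumMap]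

theorem sumR_sumMap {S X Y X' Y' : H} (y : S ⟶ Y) (f : X ⟶ X') (g : Y ⟶ Y') :
    sumR X y ≫ sumMap f g = sumR X' (y ≫ g) := by simp [sumR, inr_sumMap]

theorem sumL_fst {S X Y : H} (x : S ⟶ X) : sumL Y x ≫ fst = x := by simp [sumL]

theorem sumL_snd {S X Y : H} (x : S ⟶ X) : sumL Y x ≫ snd = 0 := by simp [sumL]

theorem sumR_fst {S X Y : H} (y : S ⟶ Y) : sumR X y ≫ fst = 0 := by simp [sumR]

theorem sumR_snd {S X Y : H} (y : S ⟶ Y) : sumR X y ≫ snd = y := by simp [sumR]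

theorem tens_whiskerLeft {S T X Y Y' : H} (x : S ⟶ X) (y : T ⟶ Y) (f : Y ⟶ Y') :
    tens x y ≫ X ◁ f = tens x (y ≫ f) := by rw [← id_tensorHom, tens_comp, Category.comp_id]

theorem tens_whiskerRight {S T X X' Y : H} (x : S ⟶ X) (y : T ⟶ Y) (f : X ⟶ X') :
    tens x y ≫ f ▷ Y = tens (x ≫ f) y := by rw [← tensorHom_id, tens_comp, Category.comp_id]

theorem tens_braiding {S T X Y : H} (x : S ⟶ X) (y : T ⟶ Y) :
    tens x y ≫ (β_ X Y).hom = pre (β_ S T).hom (tens y x) := by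
  simp [tens, pre]

theorem tens_sumL_distL {S T X Y Z : H} (x : S ⟶ X) (y : T ⟶ Y) :
    tens x (sumL Z y) ≫ distL X Y Z = sumL (X ⊗ Z) (tens x y) := by
  rw [← comp_inl, ← tens_whiskerLeft, Category.assoc, inl_distL, comp_inl]

theorem tens_sumR_distL {S T X Y Z : H} (x : S ⟶ X) (z : T ⟶ Z) :
    tens x (sumR Y z) ≫ distL X Y Z = sumR (X ⊗ Y) (tens x z) := by
  rw [← comp_inr, ← tens_whiskerLeft, Category.assoc, inr_distL, comp_inr]

theorem tens_sumL_distR {S T X Y Z : H} (x : S ⟶ X) (z : T ⟶ Z) :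
    tens (sumL Y x) z ≫ distR X Y Z = sumL (Y ⊗ Z) (tens x z) := by
  rw [← comp_inl, ← tens_whiskerRight, Category.assoc, inl_distR, comp_inl]

theorem tens_sumR_distR {S T X Y Z : H} (y : S ⟶ Y) (z : T ⟶ Z) :
    tens (sumR X y) z ≫ distR X Y Z = sumR (X ⊗ Z) (tens y z) := by
  rw [← comp_inr, ← tens_whiskerRight, Category.assoc, inr_distR, comp_inr]

/-- Left injection into a parallel composition. -/
def opL (X Y : H) : X ⟶ parObj X Y := inl ≫ inr

/-- Right injection into a parallel composition. -/
def opR (X Y : H) : Y ⟶ parObj X Y := inr ≫ inr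

theorem opL_opR (X Y Z : H) :
    opL Y Z ≫ opR X (parObj Y Z) = inl ≫ inr ≫ inr ≫ inr := Category.assoc _ _ _

theorem opR_opR (X Y Z : H) :
    opR Y Z ≫ opR X (parObj Y Z) = inr ≫ inr ≫ inr ≫ inr := Category.assoc _ _ _

theorem opL_opL (X Y Z : H) :
    opL X Y ≫ opL (parObj X Y) Z = inl ≫ inr ≫ inl ≫ inr := Category.assoc _ _ _

theorem opR_opL (X Y Z : H) :
    opR X Y ≫ opL (parObj X Y) Z = inr ≫ inr ≫ inl ≫ inr := Category.assoc _ _ _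

theorem parT_id (X Y : H) : parT (𝟙 X) (𝟙 Y) = opTm X Y := by
  rw [← tens_opTm, tens_id, Category.id_comp]

theorem parL_id (X Y : H) : parL Y (𝟙 X) = opL X Y := Category.id_comp _

theorem parR_id (X Y : H) : parR X (𝟙 Y) = opR X Y := Category.id_comp _

theorem comp_parL {S S' X Y : H} (s : S ⟶ S') (x : S' ⟶ X) : s ≫ parL Y x = parL Y (s ≫ x) :=
  (Category.assoc _ _ _).symm

theorem comp_parR {S S' X Y : H} (s : S ⟶ S') (x : S' ⟶ Y) : s ≫ parR X x = parR X (s ≫ x) :=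
  (Category.assoc _ _ _).symm

theorem comp_opL {S X Y : H} (x : S ⟶ X) : x ≫ opL X Y = parL Y x := rfl

theorem comp_opR {S X Y : H} (y : S ⟶ Y) : y ≫ opR X Y = parR X y := rfl

/-- Morphisms out of a parallel composition. -/
def parDesc {X Y W : H} (f : X ⊗ Y ⟶ W) (l : X ⟶ W) (r : Y ⟶ W) : parObj X Y ⟶ W :=
  desc f (desc l r)

theorem parT_parDesc {S T X Y W : H} (x : S ⟶ X) (y : T ⟶ Y) (f : X ⊗ Y ⟶ W) (l : X ⟶ W)
    (r : Y ⟶ W) : parT x y ≫ parDesc f l r = tens x y ≫ f := by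
  change sumL _ (tens x y) ≫ desc f (desc l r) = _
  rw [sumL_desc]

theorem parL_parDesc {S X Y W : H} (x : S ⟶ X) (f : X ⊗ Y ⟶ W) (l : X ⟶ W)
    (r : Y ⟶ W) : parL Y x ≫ parDesc f l r = x ≫ l := by
  rw [parL_eq_sumR]
  change sumR _ (sumL _ x) ≫ desc f (desc l r) = _
  rw [sumR_desc, sumL_desc]

theorem parR_parDesc {S X Y W : H} (x : S ⟶ Y) (f : X ⊗ Y ⟶ W) (l : X ⟶ W)
    (r : Y ⟶ W) : parR X x ≫ parDesc f l r = x ≫ r := by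
  rw [parR_eq_sumR]
  change sumR _ (sumR _ x) ≫ desc f (desc l r) = _
  rw [sumR_desc, sumR_desc]

/-- Morphisms out of the product of a parallel composition with an object. -/
def parTensorDesc {X Y Z W : H} (f : (X ⊗ Y) ⊗ Z ⟶ W) (l : X ⊗ Z ⟶ W) (r : Y ⊗ Z ⟶ W) :
    parObj X Y ⊗ Z ⟶ W :=
  distR (X ⊗ Y) (X ⊕' Y) Z ≫ desc f (distR X Y Z ≫ desc l r)

theorem parT_parTensorDesc {S T U X Y Z W : H} (x : S ⟶ X) (y : T ⟶ Y) (z : U ⟶ Z)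
    (f : (X ⊗ Y) ⊗ Z ⟶ W) (l : X ⊗ Z ⟶ W) (r : Y ⊗ Z ⟶ W) :
    tens (parT x y) z ≫ parTensorDesc f l r = tens (tens x y) z ≫ f := by
  change tens (sumL _ (tens x y)) z ≫ distR (X ⊗ Y) (X ⊕' Y) Z ≫
    desc f (distR X Y Z ≫ desc l r) = _
  rw [← Category.assoc, tens_sumL_distR, sumL_desc]

theorem parL_parTensorDesc {S U X Y Z W : H} (x : S ⟶ X) (z : U ⟶ Z)
    (f : (X ⊗ Y) ⊗ Z ⟶ W) (l : X ⊗ Z ⟶ W) (r : Y ⊗ Z ⟶ W) :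
    tens (parL Y x) z ≫ parTensorDesc f l r = tens x z ≫ l := by
  rw [parL_eq_sumR]
  change tens (sumR _ (sumL _ x)) z ≫ distR (X ⊗ Y) (X ⊕' Y) Z ≫
    desc f (distR X Y Z ≫ desc l r) = _
  rw [← Category.assoc, tens_sumR_distR, sumR_desc, ← Category.assoc, tens_sumL_distR, sumL_desc]

theorem parR_parTensorDesc {S U X Y Z W : H} (x : S ⟶ Y) (z : U ⟶ Z)
    (f : (X ⊗ Y) ⊗ Z ⟶ W) (l : X ⊗ Z ⟶ W) (r : Y ⊗ Z ⟶ W) :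
    tens (parR X x) z ≫ parTensorDesc f l r = tens x z ≫ r := by
  rw [parR_eq_sumR]
  change tens (sumR _ (sumR _ x)) z ≫ distR (X ⊗ Y) (X ⊕' Y) Z ≫
    desc f (distR X Y Z ≫ desc l r) = _
  rw [← Category.assoc, tens_sumR_distR, sumR_desc, ← Category.assoc, tens_sumR_distR, sumR_desc]

/-- Morphisms out of the product of an object with a parallel composition. -/
def tensorParDesc {X Y Z W : H} (f : X ⊗ (Y ⊗ Z) ⟶ W) (l : X ⊗ Y ⟶ W) (r : X ⊗ Z ⟶ W) :
    X ⊗ parObj Y Z ⟶ W :=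
  distL X (Y ⊗ Z) (Y ⊕' Z) ≫ desc f (distL X Y Z ≫ desc l r)

theorem parT_tensorParDesc {S T U X Y Z W : H} (x : S ⟶ X) (y : T ⟶ Y) (z : U ⟶ Z)
    (f : X ⊗ (Y ⊗ Z) ⟶ W) (l : X ⊗ Y ⟶ W) (r : X ⊗ Z ⟶ W) :
    tens x (parT y z) ≫ tensorParDesc f l r = tens x (tens y z) ≫ f := by
  change tens x (sumL _ (tens y z)) ≫ distL X (Y ⊗ Z) (Y ⊕' Z) ≫
    desc f (distL X Y Z ≫ desc l r) = _
  rw [← Category.assoc, tens_sumL_distL, sumL_desc]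

theorem parL_tensorParDesc {S T X Y Z W : H} (x : S ⟶ X) (y : T ⟶ Y)
    (f : X ⊗ (Y ⊗ Z) ⟶ W) (l : X ⊗ Y ⟶ W) (r : X ⊗ Z ⟶ W) :
    tens x (parL Z y) ≫ tensorParDesc f l r = tens x y ≫ l := by
  rw [parL_eq_sumR]
  change tens x (sumR _ (sumL _ y)) ≫ distL X (Y ⊗ Z) (Y ⊕' Z) ≫
    desc f (distL X Y Z ≫ desc l r) = _
  rw [← Category.assoc, tens_sumR_distL, sumR_desc, ← Category.assoc, tens_sumL_distL, sumL_desc]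

theorem parR_tensorParDesc {S T X Y Z W : H} (x : S ⟶ X) (z : T ⟶ Z)
    (f : X ⊗ (Y ⊗ Z) ⟶ W) (l : X ⊗ Y ⟶ W) (r : X ⊗ Z ⟶ W) :
    tens x (parR Y z) ≫ tensorParDesc f l r = tens x z ≫ r := by
  rw [parR_eq_sumR]
  change tens x (sumR _ (sumR _ z)) ≫ distL X (Y ⊗ Z) (Y ⊕' Z) ≫
    desc f (distL X Y Z ≫ desc l r) = _
  rw [← Category.assoc, tens_sumR_distL, sumR_desc, ← Category.assoc, tens_sumR_distL, sumR_desc]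

/-- Presents the associator as a nested case distinction on summands, so that the evaluation rules
of `parDesc` and `parTensorDesc` apply. The two forms agree by definition once two composites of
injections are rebracketed. -/
theorem parAssocHom_eq (X Y Z : H) : parAssocHom X Y Z =
    parDesc
      (parTensorDesc ((α_ X Y Z).hom ≫ X ◁ opTm Y Z ≫ opTm X (parObj Y Z))
        (X ◁ opR Y Z ≫ opTm X (parObj Y Z)) (opTm Y Z ≫ opR X (parObj Y Z)))
      (parDesc (X ◁ opL Y Z ≫ opTm X (parObj Y Z)) (opL X (parObj Y Z))
        (opL Y Z ≫ opR X (parObj Y Z)))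
      (opR Y Z ≫ opR X (parObj Y Z)) := by
  rw [opL_opR, opR_opR]; rfl

theorem parAssocInv_eq (X Y Z : H) : parAssocInv X Y Z =
    parDesc
      (tensorParDesc ((α_ X Y Z).inv ≫ opTm X Y ▷ Z ≫ opTm (parObj X Y) Z)
        (opTm X Y ≫ opL (parObj X Y) Z) (opL X Y ▷ Z ≫ opTm (parObj X Y) Z))
      (opL X Y ≫ opL (parObj X Y) Z)
      (parDesc (opR X Y ▷ Z ≫ opTm (parObj X Y) Z) (opR X Y ≫ opL (parObj X Y) Z)
        (opR (parObj X Y) Z)) := by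
  rw [opL_opL, opR_opL]; rfl

/-- This and the next six lemmas treat the seven summands of a triple product. Only the summand with
all three factors involves the associator of ⊗; the others are merely relabelled. -/
theorem parT_parT_parAssocHom {S T U X Y Z : H} (x : S ⟶ X) (y : T ⟶ Y) (z : U ⟶ Z) :
    parT (parT x y) z ≫ parAssocHom X Y Z = pre (α_ S T U).hom (parT x (parT y z)) := by
  simp only [parAssocHom_eq, ← Category.assoc, parT_parDesc, parT_parTensorDesc, tens_associator,
    pre_comp, tens_whiskerLeft, tens_opTm]

theorem parT_parL_parAssocHom {S U X Y Z : H} (x : S ⟶ X) (z : U ⟶ Z) :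
    parT (parL Y x) z ≫ parAssocHom X Y Z = parT x (parR Y z) := by
  simp only [parAssocHom_eq, ← Category.assoc, parT_parDesc, parL_parTensorDesc,
    tens_whiskerLeft, tens_opTm, comp_opR]

theorem parT_parR_parAssocHom {T U X Y Z : H} (y : T ⟶ Y) (z : U ⟶ Z) :
    parT (parR X y) z ≫ parAssocHom X Y Z = parR X (parT y z) := by
  simp only [parAssocHom_eq, ← Category.assoc, parT_parDesc, parR_parTensorDesc,
    tens_opTm, comp_opR, comp_parR]

theorem parL_parT_parAssocHom {S T X Y Z : H} (x : S ⟶ X) (y : T ⟶ Y) :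
    parL Z (parT x y) ≫ parAssocHom X Y Z = parT x (parL Z y) := by
  simp only [parAssocHom_eq, ← Category.assoc, parL_parDesc, parT_parDesc,
    tens_whiskerLeft, tens_opTm, comp_opL]

theorem parL_parL_parAssocHom {S X Y Z : H} (x : S ⟶ X) :
    parL Z (parL Y x) ≫ parAssocHom X Y Z = parL (parObj Y Z) x := by
  simp only [parAssocHom_eq, parL_parDesc, comp_opL]

theorem parL_parR_parAssocHom {S X Y Z : H} (y : S ⟶ Y) :
    parL Z (parR X y) ≫ parAssocHom X Y Z = parR X (parL Z y) := by
  simp only [parAssocHom_eq, ← Category.assoc, parL_parDesc, parR_parDesc, comp_opL, comp_opR,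
    comp_parR]

theorem parR_parAssocHom {S X Y Z : H} (z : S ⟶ Z) :
    parR (parObj X Y) z ≫ parAssocHom X Y Z = parR X (parR Y z) := by
  simp only [parAssocHom_eq, ← Category.assoc, parR_parDesc, comp_opR, comp_parR]

theorem parT_parT_parAssocInv {S T U X Y Z : H} (x : S ⟶ X) (y : T ⟶ Y) (z : U ⟶ Z) :
    parT x (parT y z) ≫ parAssocInv X Y Z = pre (α_ S T U).inv (parT (parT x y) z) := by
  simp only [parAssocInv_eq, ← Category.assoc, parT_parDesc, parT_tensorParDesc,
    tens_associator_inv, pre_comp, tens_whiskerRight, tens_opTm]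

theorem parT_parL_parAssocInv {S T X Y Z : H} (x : S ⟶ X) (y : T ⟶ Y) :
    parT x (parL Z y) ≫ parAssocInv X Y Z = parL Z (parT x y) := by
  simp only [parAssocInv_eq, ← Category.assoc, parT_parDesc, parL_tensorParDesc,
    tens_opTm, comp_opL, comp_parL]

theorem parT_parR_parAssocInv {S U X Y Z : H} (x : S ⟶ X) (z : U ⟶ Z) :
    parT x (parR Y z) ≫ parAssocInv X Y Z = parT (parL Y x) z := by
  simp only [parAssocInv_eq, ← Category.assoc, parT_parDesc, parR_tensorParDesc,
    tens_whiskerRight, tens_opTm, comp_opL]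

theorem parL_parAssocInv {S X Y Z : H} (x : S ⟶ X) :
    parL (parObj Y Z) x ≫ parAssocInv X Y Z = parL Z (parL Y x) := by
  simp only [parAssocInv_eq, ← Category.assoc, parL_parDesc, comp_opL, comp_parL]

theorem parR_parT_parAssocInv {T U X Y Z : H} (y : T ⟶ Y) (z : U ⟶ Z) :
    parR X (parT y z) ≫ parAssocInv X Y Z = parT (parR X y) z := by
  simp only [parAssocInv_eq, ← Category.assoc, parR_parDesc, parT_parDesc,
    tens_whiskerRight, tens_opTm, comp_opR]

theorem parR_parL_parAssocInv {S X Y Z : H} (y : S ⟶ Y) :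
    parR X (parL Z y) ≫ parAssocInv X Y Z = parL Z (parR X y) := by
  simp only [parAssocInv_eq, ← Category.assoc, parR_parDesc, parL_parDesc, comp_opL, comp_opR,
    comp_parL]

theorem parR_parR_parAssocInv {S X Y Z : H} (z : S ⟶ Z) :
    parR X (parR Y z) ≫ parAssocInv X Y Z = parR (parObj X Y) z := by
  simp only [parAssocInv_eq, parR_parDesc, comp_opR]

theorem tensor_par_ext {X Y Z W : H} {f g : X ⊗ parObj Y Z ⟶ W}
    (hT : tens (𝟙 X) (parT (𝟙 Y) (𝟙 Z)) ≫ f = tens (𝟙 X) (parT (𝟙 Y) (𝟙 Z)) ≫ g)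
    (hL : tens (𝟙 X) (parL Z (𝟙 Y)) ≫ f = tens (𝟙 X) (parL Z (𝟙 Y)) ≫ g)
    (hR : tens (𝟙 X) (parR Y (𝟙 Z)) ≫ f = tens (𝟙 X) (parR Y (𝟙 Z)) ≫ g) : f = g := by
  refine whiskerLeft_sum_ext ?_ (whiskerLeft_sum_ext ?_ ?_)
  · rw [parT_id, tens, id_tensorHom] at hT
    exact hT
  · rw [parL_id, tens, id_tensorHom] at hL
    exact (whiskerLeft_comp_assoc _ _ _ _).symm.trans (hL.trans (whiskerLeft_comp_assoc _ _ _ _))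
  · rw [parR_id, tens, id_tensorHom] at hR
    exact (whiskerLeft_comp_assoc _ _ _ _).symm.trans (hR.trans (whiskerLeft_comp_assoc _ _ _ _))

theorem par_tensor_ext {X Y Z W : H} {f g : parObj X Y ⊗ Z ⟶ W}
    (hT : tens (parT (𝟙 X) (𝟙 Y)) (𝟙 Z) ≫ f = tens (parT (𝟙 X) (𝟙 Y)) (𝟙 Z) ≫ g)
    (hL : tens (parL Y (𝟙 X)) (𝟙 Z) ≫ f = tens (parL Y (𝟙 X)) (𝟙 Z) ≫ g)
    (hR : tens (parR X (𝟙 Y)) (𝟙 Z) ≫ f = tens (parR X (𝟙 Y)) (𝟙 Z) ≫ g) : f = g := by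
  refine whiskerRight_sum_ext ?_ (whiskerRight_sum_ext ?_ ?_)
  · rw [parT_id, tens, tensorHom_id] at hT
    exact hT
  · rw [parL_id, tens, tensorHom_id] at hL
    exact (comp_whiskerRight_assoc _ _ _ _).symm.trans (hL.trans (comp_whiskerRight_assoc _ _ _ _))
  · rw [parR_id, tens, tensorHom_id] at hR
    exact (comp_whiskerRight_assoc _ _ _ _).symm.trans (hR.trans (comp_whiskerRight_assoc _ _ _ _))

/-- The summands of a triple product correspond to the seven nonempty sets of factors. -/
theorem par_ext_right {X Y Z W : H} {f g : parObj X (parObj Y Z) ⟶ W}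
    (hTT : parT (𝟙 X) (parT (𝟙 Y) (𝟙 Z)) ≫ f = parT (𝟙 X) (parT (𝟙 Y) (𝟙 Z)) ≫ g)
    (hTL : parT (𝟙 X) (parL Z (𝟙 Y)) ≫ f = parT (𝟙 X) (parL Z (𝟙 Y)) ≫ g)
    (hTR : parT (𝟙 X) (parR Y (𝟙 Z)) ≫ f = parT (𝟙 X) (parR Y (𝟙 Z)) ≫ g)
    (hL : parL (parObj Y Z) (𝟙 X) ≫ f = parL (parObj Y Z) (𝟙 X) ≫ g)
    (hRT : parR X (parT (𝟙 Y) (𝟙 Z)) ≫ f = parR X (parT (𝟙 Y) (𝟙 Z)) ≫ g)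
    (hRL : parR X (parL Z (𝟙 Y)) ≫ f = parR X (parL Z (𝟙 Y)) ≫ g)
    (hRR : parR X (parR Y (𝟙 Z)) ≫ f = parR X (parR Y (𝟙 Z)) ≫ g) : f = g := by
  refine par_ext ?_ hL ?_
  · rw [← tens_opTm, tens_id, Category.id_comp]
    apply tensor_par_ext <;> simpa only [← Category.assoc, tens_opTm]
  · rw [← comp_opR, Category.id_comp]
    apply par_ext <;> simpa only [← Category.assoc, comp_opR]

theorem par_ext_left {X Y Z W : H} {f g : parObj (parObj X Y) Z ⟶ W}
    (hTT : parT (parT (𝟙 X) (𝟙 Y)) (𝟙 Z) ≫ f = parT (parT (𝟙 X) (𝟙 Y)) (𝟙 Z) ≫ g)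
    (hTL : parT (parL Y (𝟙 X)) (𝟙 Z) ≫ f = parT (parL Y (𝟙 X)) (𝟙 Z) ≫ g)
    (hTR : parT (parR X (𝟙 Y)) (𝟙 Z) ≫ f = parT (parR X (𝟙 Y)) (𝟙 Z) ≫ g)
    (hLT : parL Z (parT (𝟙 X) (𝟙 Y)) ≫ f = parL Z (parT (𝟙 X) (𝟙 Y)) ≫ g)
    (hLL : parL Z (parL Y (𝟙 X)) ≫ f = parL Z (parL Y (𝟙 X)) ≫ g)
    (hLR : parL Z (parR X (𝟙 Y)) ≫ f = parL Z (parR X (𝟙 Y)) ≫ g)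
    (hR : parR (parObj X Y) (𝟙 Z) ≫ f = parR (parObj X Y) (𝟙 Z) ≫ g) : f = g := by
  refine par_ext ?_ ?_ hR
  · rw [← tens_opTm, tens_id, Category.id_comp]
    apply par_tensor_ext <;> simpa only [← Category.assoc, tens_opTm]
  · rw [← comp_opL, Category.id_comp]
    apply par_ext <;> simpa only [← Category.assoc, comp_opL]

end ElementsSymmetric

/-! ### The isomorphism between (X ⊕ 1) ⊗ (Y ⊕ 1) and (X | Y) ⊕ 1 -/

section Expand

variable {H : Type u} [Category.{v} H] [Limits.HasZeroMorphisms H] [Semiadditive H]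
  [MonoidalCategory H] [SymmetricCategory H] [Distributive H]

theorem expandInv_eq (X Y : H) : expandInv X Y =
    desc (parDesc (inl ⊗ₘ inl) ((ρ_ X).inv ≫ (inl ⊗ₘ inr)) ((λ_ Y).inv ≫ (inr ⊗ₘ inl)))
      ((λ_ (𝟙_ H)).inv ≫ (inr ⊗ₘ inr)) := rfl

theorem expandHom_eq (X Y : H) : expandHom X Y =
    distR X (𝟙_ H) (Y ⊕' 𝟙_ H) ≫
      desc
        (distL X Y (𝟙_ H) ≫ desc (opTm X Y ≫ inl) ((ρ_ X).hom ≫ opL X Y ≫ inl))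
        ((λ_ (Y ⊕' 𝟙_ H)).hom ≫ desc (opR X Y ≫ inl) inr) := by
  have hL : opL X Y ≫ (inl : _ ⟶ (parObj X Y ⊕' 𝟙_ H)) = inl ≫ inr ≫ inl := Category.assoc _ _ _
  have hR : opR X Y ≫ (inl : _ ⟶ (parObj X Y ⊕' 𝟙_ H)) = inr ≫ inr ≫ inl := Category.assoc _ _ _
  rw [hL, hR]; rfl

/-- A factor missing from a summand of the parallel product appears on the tensor side as the
adjoined unit. This and the next three lemmas record the four cases, with unitors as changes of
stage. -/
theorem parT_expandInv {S T X Y : H} (x : S ⟶ X) (y : T ⟶ Y) :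
    sumL (𝟙_ H) (parT x y) ≫ expandInv X Y = tens (sumL (𝟙_ H) x) (sumL (𝟙_ H) y) := by
  rw [expandInv_eq, sumL_desc, parT_parDesc, tens_comp]; rfl

theorem parL_expandInv {S X Y : H} (x : S ⟶ X) :
    sumL (𝟙_ H) (parL Y x) ≫ expandInv X Y
      = pre (ρ_ S).inv (tens (sumL (𝟙_ H) x) (sumR Y (𝟙 (𝟙_ H)))) := by
  rw [expandInv_eq, sumL_desc, parL_parDesc, ← Category.assoc, comp_rightUnitor_inv, pre_comp,
    tens_comp]; rfl

theorem parR_expandInv {S X Y : H} (y : S ⟶ Y) :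
    sumL (𝟙_ H) (parR X y) ≫ expandInv X Y
      = pre (λ_ S).inv (tens (sumR X (𝟙 (𝟙_ H))) (sumL (𝟙_ H) y)) := by
  rw [expandInv_eq, sumL_desc, parR_parDesc, ← Category.assoc, comp_leftUnitor_inv, pre_comp,
    tens_comp]; rfl

theorem sumR_expandInv (X Y : H) :
    sumR (parObj X Y) (𝟙 (𝟙_ H)) ≫ expandInv X Y
      = pre (λ_ (𝟙_ H)).inv (tens (sumR X (𝟙 (𝟙_ H))) (sumR Y (𝟙 (𝟙_ H)))) := by
  rw [expandInv_eq, sumR_desc, Category.id_comp]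
  simp [pre, tens, sumR]

theorem comp_sumL {S S' X Y : H} (s : S ⟶ S') (x : S' ⟶ X) : s ≫ sumL Y x = sumL Y (s ≫ x) :=
  (Category.assoc _ _ _).symm

theorem comp_sumR {S S' X Y : H} (s : S ⟶ S') (y : S' ⟶ Y) : s ≫ sumR X y = sumR X (s ≫ y) :=
  (Category.assoc _ _ _).symm

theorem sumL_sumL_expandHom {S T X Y : H} (x : S ⟶ X) (y : T ⟶ Y) :
    tens (sumL (𝟙_ H) x) (sumL (𝟙_ H) y) ≫ expandHom X Y = sumL (𝟙_ H) (parT x y) := by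
  simp only [expandHom_eq, ← Category.assoc, tens_sumL_distR, sumL_desc, tens_sumL_distL,
    tens_opTm, comp_inl, comp_sumL]

theorem sumL_sumR_expandHom {S X Y : H} (x : S ⟶ X) :
    tens (sumL (𝟙_ H) x) (sumR Y (𝟙 (𝟙_ H))) ≫ expandHom X Y
      = pre (ρ_ S).hom (sumL (𝟙_ H) (parL Y x)) := by
  simp only [expandHom_eq, ← Category.assoc, tens_sumL_distR, sumL_desc, tens_sumR_distL,
    sumR_desc, tens_rightUnitor, comp_opL, comp_inl, comp_sumL, comp_parL, parL_pre, sumL_pre]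

theorem sumR_sumL_expandHom {S X Y : H} (y : S ⟶ Y) :
    tens (sumR X (𝟙 (𝟙_ H))) (sumL (𝟙_ H) y) ≫ expandHom X Y
      = pre (λ_ S).hom (sumL (𝟙_ H) (parR X y)) := by
  simp only [expandHom_eq, ← Category.assoc, tens_sumR_distR, sumL_desc, tens_leftUnitor,
    sumR_desc, pre_comp, comp_opR, comp_inl, comp_sumL]

theorem sumR_sumR_expandHom (X Y : H) :
    tens (sumR X (𝟙 (𝟙_ H))) (sumR Y (𝟙 (𝟙_ H))) ≫ expandHom X Y
      = pre (λ_ (𝟙_ H)).hom (sumR (parObj X Y) (𝟙 (𝟙_ H))) := by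
  simp only [expandHom_eq, ← Category.assoc, tens_sumR_distR, tens_leftUnitor,
    sumR_desc, pre_comp, comp_inr]

theorem sumL_par_ext {X Y Z W : H} {f g : (parObj X Y ⊕' Z) ⟶ W}
    (hT : sumL Z (parT (𝟙 X) (𝟙 Y)) ≫ f = sumL Z (parT (𝟙 X) (𝟙 Y)) ≫ g)
    (hL : sumL Z (parL Y (𝟙 X)) ≫ f = sumL Z (parL Y (𝟙 X)) ≫ g)
    (hR : sumL Z (parR X (𝟙 Y)) ≫ f = sumL Z (parR X (𝟙 Y)) ≫ g)
    (hZ : sumR (parObj X Y) (𝟙 Z) ≫ f = sumR (parObj X Y) (𝟙 Z) ≫ g) : f = g := by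
  refine sum_ext ?_ hZ
  rw [← comp_inl, Category.id_comp]
  apply par_ext <;> simpa only [← Category.assoc, comp_inl, comp_sumL]

theorem sumL_par_ext_left {X Y Z V W : H} {f g : (parObj (parObj X Y) Z ⊕' V) ⟶ W}
    (hTT : sumL V (parT (parT (𝟙 X) (𝟙 Y)) (𝟙 Z)) ≫ f = sumL V (parT (parT (𝟙 X) (𝟙 Y)) (𝟙 Z)) ≫ g)
    (hTL : sumL V (parT (parL Y (𝟙 X)) (𝟙 Z)) ≫ f = sumL V (parT (parL Y (𝟙 X)) (𝟙 Z)) ≫ g)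
    (hTR : sumL V (parT (parR X (𝟙 Y)) (𝟙 Z)) ≫ f = sumL V (parT (parR X (𝟙 Y)) (𝟙 Z)) ≫ g)
    (hLT : sumL V (parL Z (parT (𝟙 X) (𝟙 Y))) ≫ f = sumL V (parL Z (parT (𝟙 X) (𝟙 Y))) ≫ g)
    (hLL : sumL V (parL Z (parL Y (𝟙 X))) ≫ f = sumL V (parL Z (parL Y (𝟙 X))) ≫ g)
    (hLR : sumL V (parL Z (parR X (𝟙 Y))) ≫ f = sumL V (parL Z (parR X (𝟙 Y))) ≫ g)
    (hR : sumL V (parR (parObj X Y) (𝟙 Z)) ≫ f = sumL V (parR (parObj X Y) (𝟙 Z)) ≫ g)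
    (hV : sumR _ (𝟙 V) ≫ f = sumR _ (𝟙 V) ≫ g) : f = g := by
  refine sum_ext ?_ hV
  rw [← comp_inl, Category.id_comp]
  apply par_ext_left <;> simpa only [← Category.assoc, comp_inl, comp_sumL]

theorem tensor_sum_ext {X X' Y Y' W : H} {f g : (X ⊕' X') ⊗ (Y ⊕' Y') ⟶ W}
    (hLL : tens (sumL X' (𝟙 X)) (sumL Y' (𝟙 Y)) ≫ f = tens (sumL X' (𝟙 X)) (sumL Y' (𝟙 Y)) ≫ g)
    (hLR : tens (sumL X' (𝟙 X)) (sumR Y (𝟙 Y')) ≫ f = tens (sumL X' (𝟙 X)) (sumR Y (𝟙 Y')) ≫ g)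
    (hRL : tens (sumR X (𝟙 X')) (sumL Y' (𝟙 Y)) ≫ f = tens (sumR X (𝟙 X')) (sumL Y' (𝟙 Y)) ≫ g)
    (hRR : tens (sumR X (𝟙 X')) (sumR Y (𝟙 Y')) ≫ f = tens (sumR X (𝟙 X')) (sumR Y (𝟙 Y')) ≫ g) :
    f = g := by
  simp only [tens, sumL, sumR, Category.id_comp, MonoidalCategory.tensorHom_def',
    Category.assoc] at hLL hLR hRL hRR
  exact whiskerRight_sum_ext
    (whiskerLeft_sum_ext hLL hLR) (whiskerLeft_sum_ext hRL hRR)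

theorem expandInv_expandHom (X Y : H) : expandInv X Y ≫ expandHom X Y = 𝟙 _ := by
  apply sumL_par_ext <;> simp only [← Category.assoc, parT_expandInv, parL_expandInv,
    parR_expandInv, sumR_expandInv, sumL_sumL_expandHom, sumL_sumR_expandHom, sumR_sumL_expandHom,
    sumR_sumR_expandHom, pre_comp, Category.comp_id, pre_pre, Iso.inv_hom_id, pre_id]

theorem expandHom_expandInv (X Y : H) : expandHom X Y ≫ expandInv X Y = 𝟙 _ := by
  apply tensor_sum_ext <;> simp only [← Category.assoc, parT_expandInv, parL_expandInv,
    parR_expandInv, sumR_expandInv, sumL_sumL_expandHom, sumL_sumR_expandHom, sumR_sumL_expandHom,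
    sumR_sumR_expandHom, pre_comp, Category.comp_id, pre_pre, Iso.hom_inv_id, pre_id]

/-- The product of two objects with a unit adjoined is their parallel composition with a unit
adjoined. -/
def expand (X Y : H) : (X ⊕' 𝟙_ H) ⊗ (Y ⊕' 𝟙_ H) ≅ (parObj X Y ⊕' 𝟙_ H) where
  hom := expandHom X Y
  inv := expandInv X Y
  hom_inv_id := expandHom_expandInv X Y
  inv_hom_id := expandInv_expandHom X Y

theorem expandHom_naturality {X X' Y Y' : H} (f : X ⟶ X') (g : Y ⟶ Y') :
    (sumMap f (𝟙 (𝟙_ H)) ⊗ₘ sumMap g (𝟙 (𝟙_ H))) ≫ expandHom X' Y'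
      = expandHom X Y ≫ sumMap (parMap f g) (𝟙 (𝟙_ H)) := by
  apply tensor_sum_ext <;> simp only [← Category.assoc, tens_comp, sumL_sumMap, sumR_sumMap,
    sumL_sumL_expandHom, sumL_sumR_expandHom, sumR_sumL_expandHom, parT_parMap, parL_parMap,
    parR_parMap, sumR_sumR_expandHom, pre_comp, Category.comp_id, Category.id_comp]

theorem expandHom_parSwap (X Y : H) :
    expandHom X Y ≫ sumMap (parSwap X Y) (𝟙 (𝟙_ H)) = (β_ _ _).hom ≫ expandHom Y X := by
  apply tensor_sum_ext <;> simp only [← Category.assoc, tens_braiding, sumL_sumMap, sumR_sumMap,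
    sumL_sumL_expandHom, sumL_sumR_expandHom, sumR_sumL_expandHom, parT_parSwap, parL_parSwap,
    parR_parSwap, sumR_sumR_expandHom, pre_comp, Category.comp_id, pre_pre, sumL_pre,
    braiding_leftUnitor, braiding_rightUnitor]
  -- Only the summand 1 ⊗ 1 is left, where the braiding has turned the left unitor into the right
  -- one.
  rw [unitors_equal]

/-- Through the expansion, associativity of `|` becomes associativity of ⊗. -/
theorem parAssocHom_expandInv (X Y Z : H) :
    sumMap (parAssocHom X Y Z) (𝟙 (𝟙_ H)) ≫ expandInv X (parObj Y Z) ≫ _ ◁ expandInv Y Z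
      = expandInv (parObj X Y) Z ≫ expandInv X Y ▷ _ ≫ (α_ _ _ _).hom := by
  -- On each of the eight summands both sides reach the same element; what differs is the change of
  -- stage, and the two changes of stage are parallel coherence morphisms.
  apply sumL_par_ext_left <;> simp only [← Category.assoc, sumL_sumMap, sumR_sumMap,
    parT_expandInv, parL_expandInv,
    parR_expandInv, sumR_expandInv, tens_whiskerLeft, tens_whiskerRight, tens_associator,
      pre_comp, pre_pre,
    parT_parT_parAssocHom, parT_parL_parAssocHom, parT_parR_parAssocHom, parL_parT_parAssocHom,
    parL_parL_parAssocHom, parL_parR_parAssocHom, parR_parAssocHom, sumL_pre, tens_pre_left,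
      tens_pre_right,
    Category.comp_id] <;> congr 1 <;> monoidal

theorem parL_parRightHom {S X : H} (x : S ⟶ X) :
    parL (Semiadditive.zeroObj : H) x ≫ parRightHom X = x := by
  change parL _ x ≫ opP _ _ ≫ fst = x
  rw [← Category.assoc, parL_opP, sumL_fst]

theorem parR_parLeftHom {S X : H} (x : S ⟶ X) :
    parR (Semiadditive.zeroObj : H) x ≫ parLeftHom X = x := by
  change parR _ x ≫ opP _ _ ≫ snd = x
  rw [← Category.assoc, parR_opP, sumR_snd]

theorem comp_parRightInv {S X : H} (x : S ⟶ X) :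
    x ≫ parRightInv X = parL (Semiadditive.zeroObj : H) x := rfl

theorem comp_parLeftInv {S X : H} (x : S ⟶ X) :
    x ≫ parLeftInv X = parR (Semiadditive.zeroObj : H) x := rfl

theorem isZero_zeroObj_tensor (X : H) : Limits.IsZero ((Semiadditive.zeroObj : H) ⊗ X) :=
  (Distributive.isZero_tensor_zeroObj X).of_iso (β_ _ _)

/-- X ⊗ 0 and 0 are zero objects, so X is the only summand to test. -/
theorem parRightHom_parRightInv (X : H) : parRightHom X ≫ parRightInv X = 𝟙 _ := by
  apply par_ext
  · exact (Distributive.isZero_tensor_zeroObj X).eq_of_src _ _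
  · rw [← Category.assoc, parL_parRightHom, comp_parRightInv, Category.comp_id]
  · exact Semiadditive.isZero_zeroObj.eq_of_src _ _

theorem parRightInv_parRightHom (X : H) : parRightInv X ≫ parRightHom X = 𝟙 _ := by
  rw [← Category.id_comp (parRightInv X), comp_parRightInv, parL_parRightHom]

theorem parLeftHom_parLeftInv (X : H) : parLeftHom X ≫ parLeftInv X = 𝟙 _ := by
  apply par_ext
  · exact (isZero_zeroObj_tensor X).eq_of_src _ _
  · exact Semiadditive.isZero_zeroObj.eq_of_src _ _
  · rw [← Category.assoc, parR_parLeftHom, comp_parLeftInv, Category.comp_id]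

theorem parLeftInv_parLeftHom (X : H) : parLeftInv X ≫ parLeftHom X = 𝟙 _ := by
  rw [← Category.id_comp (parLeftInv X), comp_parLeftInv, parR_parLeftHom]

theorem parAssocHom_parAssocInv (X Y Z : H) : parAssocHom X Y Z ≫ parAssocInv X Y Z = 𝟙 _ := by
  apply par_ext_left <;> simp only [← Category.assoc, pre_comp, parT_parT_parAssocHom,
    parT_parL_parAssocHom, parT_parR_parAssocHom, parL_parT_parAssocHom, parL_parL_parAssocHom,
    parL_parR_parAssocHom, parR_parAssocHom, parT_parT_parAssocInv, parT_parL_parAssocInv,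
    parT_parR_parAssocInv, parL_parAssocInv, parR_parT_parAssocInv, parR_parL_parAssocInv,
    parR_parR_parAssocInv, pre_pre, Iso.hom_inv_id, pre_id, Category.comp_id]

theorem parAssocInv_parAssocHom (X Y Z : H) : parAssocInv X Y Z ≫ parAssocHom X Y Z = 𝟙 _ := by
  apply par_ext_right <;> simp only [← Category.assoc, pre_comp, parT_parT_parAssocHom,
    parT_parL_parAssocHom, parT_parR_parAssocHom, parL_parT_parAssocHom, parL_parL_parAssocHom,
    parL_parR_parAssocHom, parR_parAssocHom, parT_parT_parAssocInv, parT_parL_parAssocInv,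
    parT_parR_parAssocInv, parL_parAssocInv, parR_parT_parAssocInv, parR_parL_parAssocInv,
    parR_parR_parAssocInv, pre_pre, Iso.inv_hom_id, pre_id, Category.comp_id]

theorem parMap_id (X Y : H) : parMap (𝟙 X) (𝟙 Y) = 𝟙 (parObj X Y) := by
  apply par_ext <;> simp only [parT_parMap, parL_parMap, parR_parMap, Category.comp_id]

theorem parMap_comp {X X' X'' Y Y' Y'' : H} (f : X ⟶ X') (f' : X' ⟶ X'') (g : Y ⟶ Y')
    (g' : Y' ⟶ Y'') : parMap (f ≫ f') (g ≫ g') = parMap f g ≫ parMap f' g' := by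
  apply par_ext <;> simp only [← Category.assoc, parT_parMap, parL_parMap, parR_parMap]

theorem parSwap_parSwap (X Y : H) : parSwap X Y ≫ parSwap Y X = 𝟙 _ := by
  apply par_ext <;> simp only [← Category.assoc, parT_parSwap, parL_parSwap, parR_parSwap,
    pre_comp, pre_pre, SymmetricCategory.symmetry, pre_id, Category.comp_id]

/-- Lets an empty list be inserted before a wire and removed again; this identifies `appendHom` with
`snocHom` on one wire. -/
theorem parTriangle (X Y : H) :
    parMap (𝟙 X) (parLeftInv Y) ≫ parAssocInv X Semiadditive.zeroObj Y ≫
      parMap (parRightHom X) (𝟙 Y) = 𝟙 _ := by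
  apply par_ext <;> simp only [← Category.assoc, parT_parMap, parL_parMap, parR_parMap,
    comp_parLeftInv, parT_parR_parAssocInv, parL_parAssocInv, parR_parR_parAssocInv,
    parL_parRightHom, Category.comp_id]

theorem expandHom_parRightHom (X : H) :
    expandHom X Semiadditive.zeroObj ≫ sumMap (parRightHom X) (𝟙 (𝟙_ H))
      = _ ◁ snd ≫ (ρ_ _).hom := by
  apply tensor_sum_ext
  -- A summand having the zero object as a factor carries no condition.
  · exact (Distributive.isZero_tensor_zeroObj X).eq_of_src _ _
  · simp only [← Category.assoc, sumL_sumR_expandHom, pre_comp, sumL_sumMap, parL_parRightHom,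
      tens_whiskerLeft, sumR_snd, tens_rightUnitor]
  · exact (Distributive.isZero_tensor_zeroObj _).eq_of_src _ _
  · simp only [← Category.assoc, sumR_sumR_expandHom, pre_comp, sumR_sumMap, Category.comp_id,
      tens_whiskerLeft, sumR_snd, tens_rightUnitor, unitors_equal]

/-- The square of `parAssocHom_expandInv` consists of isomorphisms; this is the square of their
inverses. -/
theorem expandHom_parAssocInv (X Y Z : H) :
    _ ◁ expandHom Y Z ≫ expandHom X (parObj Y Z) ≫ sumMap (parAssocInv X Y Z) (𝟙 (𝟙_ H))
      = (α_ _ _ _).inv ≫ expandHom X Y ▷ _ ≫ expandHom (parObj X Y) Z := by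
  let e₁ := whiskerLeftIso (X ⊕' 𝟙_ H) (expand Y Z) ≪≫ expand X (parObj Y Z)
  let e₂ := whiskerRightIso (expand X Y) (Z ⊕' 𝟙_ H) ≪≫ expand (parObj X Y) Z
  have h : sumMap (parAssocHom X Y Z) (𝟙 (𝟙_ H)) ≫ e₁.inv = e₂.inv ≫ (α_ _ _ _).hom := by
    simpa [e₁, e₂, expand] using parAssocHom_expandInv X Y Z
  have h' : sumMap (parAssocHom X Y Z) (𝟙 (𝟙_ H)) ≫
    sumMap (parAssocInv X Y Z) (𝟙 (𝟙_ H)) = 𝟙 _ := by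
    rw [← sumMap_comp, parAssocHom_parAssocInv, Category.comp_id, sumMap_id]
  have h'' : sumMap (parAssocInv X Y Z) (𝟙 (𝟙_ H)) ≫
    sumMap (parAssocHom X Y Z) (𝟙 (𝟙_ H)) = 𝟙 _ := by
    rw [← sumMap_comp, parAssocInv_parAssocHom, Category.comp_id, sumMap_id]
  let e₃ : _ ≅ _ := ⟨sumMap (parAssocHom X Y Z) (𝟙 (𝟙_ H)), sumMap (parAssocInv X Y Z) (𝟙 (𝟙_ H)),
    h', h''⟩
  have k : e₃ ≪≫ e₁.symm = e₂.symm ≪≫ α_ _ _ _ := Iso.ext h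
  have := congrArg Iso.inv k
  simpa [e₁, e₂, e₃, expand] using this

end Expand

/-! ### Merging lists of wires -/

section Wires

variable {H : Type u} [Category.{v} H] [Limits.HasZeroMorphisms H] [Semiadditive H]
  [MonoidalCategory H] [SymmetricCategory H] [Distributive H]

theorem snocHom_snocInv (X : Wires) (B : Color) : snocHom H X B ≫ snocInv H X B = 𝟙 _ := by
  cases X with
  | nil => exact parLeftHom_parLeftInv _
  | snoc X A => exact Category.id_comp _

theorem snocInv_snocHom (X : Wires) (B : Color) : snocInv H X B ≫ snocHom H X B = 𝟙 _ := by
  cases X with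
  | nil => exact parLeftInv_parLeftHom _
  | snoc X A => exact Category.id_comp _

/-- Parallel composition of isomorphisms. -/
def parMapIso {X X' Y Y' : H} (f : X ≅ X') (g : Y ≅ Y') : parObj X Y ≅ parObj X' Y' where
  hom := parMap f.hom g.hom
  inv := parMap f.inv g.inv
  hom_inv_id := by rw [← parMap_comp, f.hom_inv_id, g.hom_inv_id, parMap_id]
  inv_hom_id := by rw [← parMap_comp, f.inv_hom_id, g.inv_hom_id, parMap_id]

/-- The isomorphism adding one wire on the right. -/
def snocIso (X : Wires) (B : Color) :
    parObj (wiresObj H X) (colorObj H B) ≅ wiresObj H (.snoc X B) where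
  hom := snocHom H X B
  inv := snocInv H X B
  hom_inv_id := snocHom_snocInv X B
  inv_hom_id := snocInv_snocHom X B

/-- The associativity isomorphism of the parallel composition. -/
def parAssocIso (X Y Z : H) : parObj (parObj X Y) Z ≅ parObj X (parObj Y Z) where
  hom := parAssocHom X Y Z
  inv := parAssocInv X Y Z
  hom_inv_id := parAssocHom_parAssocInv X Y Z
  inv_hom_id := parAssocInv_parAssocHom X Y Z

/-- The recursive clauses compose isomorphisms, so both identities are carried along the same
induction. -/
theorem append_inverse (X Y : Wires) :
    appendHom H X Y ≫ appendInv H X Y = 𝟙 _ ∧ appendInv H X Y ≫ appendHom H X Y = 𝟙 _ := by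
  induction Y with
  | nil => exact ⟨parRightHom_parRightInv _, parRightInv_parRightHom _⟩
  | snoc Y B ih =>
    let e := parMapIso (Iso.refl (wiresObj H X)) (snocIso Y B).symm ≪≫ (parAssocIso _ _ _).symm ≪≫
      parMapIso ⟨_, _, ih.1, ih.2⟩ (Iso.refl (colorObj H B)) ≪≫ snocIso (X.append Y) B
    have h : e.hom = appendHom H X (.snoc Y B) := rfl
    -- The inverse of the composite differs from the recursive clause only in bracketing.
    have h' : e.inv = appendInv H X (.snoc Y B) := by
      simp only [e, Iso.trans_inv, Category.assoc]; rfl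
    rw [← h, ← h']
    exact ⟨e.hom_inv_id, e.inv_hom_id⟩

theorem appendHom_single (X : Wires) (B : Color) : appendHom H X (w₁ B) = snocHom H X B := by
  have h := parTriangle (wiresObj H X) (colorObj H B)
  have h' : appendHom H X (w₁ B) = (parMap (𝟙 _) (parLeftInv (colorObj H B)) ≫
      parAssocInv (wiresObj H X) Semiadditive.zeroObj (colorObj H B) ≫
      parMap (parRightHom _) (𝟙 _)) ≫ snocHom H X B := by
    simp only [Category.assoc]; rfl
  rw [h', h, Category.id_comp]

/-- Wires with a unit adjoined. -/
abbrev unitWires (H : Type u) [Category.{v} H] [Limits.HasZeroMorphisms H] [Semiadditive H]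
    [MonoidalCategory H] (X : Wires) : H := wiresObj H X ⊕' 𝟙_ H

/-- The structural isomorphism merging two lists with units adjoined. -/
def unitAppend (X Y : Wires) :
    unitWires H X ⊗ unitWires H Y ≅ unitWires H (X.append Y) :=
  expand _ _ ≪≫
    sumIso ⟨appendHom H X Y, appendInv H X Y, (append_inverse X Y).1, (append_inverse X Y).2⟩
      (Iso.refl _)

theorem unitAppend_hom (X Y : Wires) : (unitAppend X Y).hom
    = expandHom (wiresObj H X) (wiresObj H Y) ≫ sumMap (appendHom H X Y) (𝟙 (𝟙_ H)) := rfl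

theorem unitAppend_inv (X Y : Wires) : (unitAppend X Y).inv
    = sumMap (appendInv H X Y) (𝟙 (𝟙_ H)) ≫ expandInv (wiresObj H X) (wiresObj H Y) := rfl

/-- Naturality of the expansion moves `s` and `a` across it, `s` then cancels against `s'`, and
associativity remains. Keeping `s` and `t` abstract avoids a case distinction on whether the lists
are empty, where `snocHom` changes its form. -/
theorem expandHom_append {X Y B V W W' : H} (s : parObj Y B ⟶ W) (s' : W ⟶ parObj Y B)
    (h : s ≫ s' = 𝟙 _) (a : parObj X Y ⟶ V) (t : parObj V B ⟶ W') :
    (X ⊕' 𝟙_ H) ◁ (expandHom Y B ≫ sumMap s (𝟙 (𝟙_ H))) ≫ expandHom X W ≫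
        sumMap (parMap (𝟙 X) s' ≫ parAssocInv X Y B ≫ parMap a (𝟙 B) ≫ t) (𝟙 (𝟙_ H))
      = (α_ _ _ _).inv ≫ (expandHom X Y ≫ sumMap a (𝟙 (𝟙_ H))) ▷ (B ⊕' 𝟙_ H) ≫
        expandHom V B ≫ sumMap t (𝟙 (𝟙_ H)) := by
  have h₁ := expandHom_naturality (𝟙 X) s
  have h₂ := expandHom_naturality a (𝟙 B)
  rw [sumMap_id, id_tensorHom] at h₁
  rw [sumMap_id, tensorHom_id] at h₂
  have h₃ := expandHom_parAssocInv X Y B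
  have c {A B C : H} (f : A ⟶ B) (g : B ⟶ C) : sumMap (f ≫ g) (𝟙 (𝟙_ H))
      = sumMap f (𝟙 (𝟙_ H)) ≫ sumMap g (𝟙 (𝟙_ H)) := by
    rw [← sumMap_comp, Category.comp_id]
  have h₄ : sumMap (parMap (𝟙 X) s) (𝟙 (𝟙_ H)) ≫ sumMap (parMap (𝟙 X) s') (𝟙 (𝟙_ H)) = 𝟙 _ := by
    rw [← c, ← parMap_comp, h, Category.comp_id, parMap_id, sumMap_id]
  simp only [whiskerLeft_comp, comp_whiskerRight, c, Category.assoc, reassoc_of% h₁,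
    reassoc_of% h₄, reassoc_of% h₂, reassoc_of% h₃]

/-- Associativity of merging when the last block is a single wire. It is the fact on which all
inductions over lists rest. -/
theorem unitAppend_snoc (X Y : Wires) (B : Color) :
    unitWires H X ◁ (unitAppend Y (w₁ B)).hom ≫ (unitAppend X (Y.append (w₁ B))).hom
      = (α_ _ _ _).inv ≫ (unitAppend X Y).hom ▷ unitWires H (w₁ B) ≫
        (unitAppend (X.append Y) (w₁ B)).hom := by
  simp only [unitAppend_hom, appendHom_single]
  exact expandHom_append (snocHom H Y B) (snocInv H Y B) (snocHom_snocInv Y B) (appendHom H X Y)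
    (snocHom H (X.append Y) B)

theorem unitAppend_swap (A B : Color) :
    (unitAppend (w₁ A) (w₁ B)).hom ≫ sumMap (parSwap (colorObj H A) (colorObj H B)) (𝟙 (𝟙_ H))
      = (β_ _ _).hom ≫ (unitAppend (w₁ B) (w₁ A)).hom := by
  have h (A B : Color) : (unitAppend (w₁ A) (w₁ B)).hom =
    expandHom (colorObj H A) (colorObj H B) := by
    rw [unitAppend_hom, appendHom_single]
    change _ ≫ sumMap (𝟙 _) (𝟙 _) = _
    rw [sumMap_id, Category.comp_id]
    rfl
  rw [h, h]
  exact expandHom_parSwap (colorObj H A) (colorObj H B)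

end Wires

/-! ### Induction steps for coherence, in an arbitrary monoidal category -/

section Monoidal

variable {C : Type u} [Category.{v} C] [MonoidalCategory C]

/-- Extends associativity of merging from the blocks X, Y, Z to X, Y, ZB, where B is one more wire.
Composed with the isomorphism `b`, the claim splits into three instances of associativity with last
block B and the induction hypothesis. The morphisms `c` and `c'` stand for transports along
associativity of concatenation. -/
theorem assoc_step {X Y Z B YZ XY V V' ZB P Q Q' : C} (b : Z ⊗ B ⟶ ZB) [IsIso b]
    {yz : Y ⊗ Z ⟶ YZ} {y_zb : Y ⊗ ZB ⟶ P} {yz_b : YZ ⊗ B ⟶ P} {xy : X ⊗ Y ⟶ XY}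
    {x_yz : X ⊗ YZ ⟶ V} {xy_z : XY ⊗ Z ⟶ V'} {x_p : X ⊗ P ⟶ Q} {v_b : V ⊗ B ⟶ Q}
    {v'_b : V' ⊗ B ⟶ Q'} {xy_zb : XY ⊗ ZB ⟶ Q'} {c : V' ⟶ V} {c' : Q' ⟶ Q}
    (h₁ : Y ◁ b ≫ y_zb = (α_ _ _ _).inv ≫ yz ▷ B ≫ yz_b)
    (h₂ : X ◁ yz_b ≫ x_p = (α_ _ _ _).inv ≫ x_yz ▷ B ≫ v_b)
    (h₃ : XY ◁ b ≫ xy_zb = (α_ _ _ _).inv ≫ xy_z ▷ B ≫ v'_b)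
    (h₄ : c ▷ B ≫ v_b = v'_b ≫ c')
    (ih : X ◁ yz ≫ x_yz = (α_ _ _ _).inv ≫ xy ▷ Z ≫ xy_z ≫ c) :
    X ◁ y_zb ≫ x_p = (α_ _ _ _).inv ≫ xy ▷ ZB ≫ xy_zb ≫ c' := by
  rw [← cancel_epi (X ◁ Y ◁ b)]
  calc _ = X ◁ (Y ◁ b ≫ y_zb) ≫ x_p := by rw [whiskerLeft_comp, Category.assoc]
    _ = X ◁ (α_ _ _ _).inv ≫ (α_ _ _ _).inv ≫ (X ◁ yz ≫ x_yz) ▷ B ≫ v_b := by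
      rw [h₁]
      simp only [whiskerLeft_comp, comp_whiskerRight, Category.assoc]
      rw [h₂]
      simp
    _ = X ◁ (α_ _ _ _).inv ≫ (α_ _ _ _).inv ≫ (α_ _ _ _).inv ▷ B ≫ (xy ▷ Z) ▷ B ≫
          xy_z ▷ B ≫ v'_b ≫ c' := by
      rw [ih, ← h₄]
      simp only [comp_whiskerRight, Category.assoc]
    _ = (α_ _ _ _).inv ≫ xy ▷ _ ≫ (XY ◁ b ≫ xy_zb) ≫ c' := by
      rw [h₃]
      simp
    _ = _ := by
      rw [Category.assoc, ← whisker_exchange_assoc]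
      simp

/-- N is the interpretation of the empty list and `u` its comparison with the unit; one wire B is
appended to X, and `c`, `c'` are transports of wires. -/
theorem left_unit_step {N X B V XB Q : C} (u : N ⟶ 𝟙_ C) (b : X ⊗ B ⟶ XB) [IsIso b]
    {nx : N ⊗ X ⟶ V} {c : V ⟶ X} {vb : V ⊗ B ⟶ Q} {nxb : N ⊗ XB ⟶ Q} {c' : Q ⟶ XB}
    (h₁ : N ◁ b ≫ nxb = (α_ _ _ _).inv ≫ nx ▷ B ≫ vb) (h₂ : c ▷ B ≫ b = vb ≫ c')
    (ih : nx ≫ c = u ▷ X ≫ (λ_ X).hom) : nxb ≫ c' = u ▷ XB ≫ (λ_ XB).hom := by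
  rw [← cancel_epi (N ◁ b), ← Category.assoc, h₁]
  simp only [Category.assoc]
  rw [← h₂, ← comp_whiskerRight_assoc, ih, whisker_exchange_assoc, leftUnitor_naturality]
  simp

theorem right_unit_step {N X Y XY : C} (u : N ⟶ 𝟙_ C) {xy : X ⊗ Y ⟶ XY} :
    X ◁ (Y ◁ u ≫ (ρ_ Y).hom) ≫ xy
      = (α_ _ _ _).inv ≫ xy ▷ N ≫ (XY ◁ u ≫ (ρ_ XY).hom) ≫ 𝟙 _ := by
  rw [Category.comp_id, ← whisker_exchange_assoc, rightUnitor_naturality]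
  simp

/-- For two empty lists the left and right unit laws must agree. After composing with `u`, this is
equality of the two unitors at the unit object. -/
theorem left_unit_base {N : C} (u : N ⟶ 𝟙_ C) [IsIso u] :
    (N ◁ u ≫ (ρ_ N).hom) ≫ 𝟙 _ = u ▷ N ≫ (λ_ N).hom := by
  rw [Category.comp_id, ← cancel_mono u, Category.assoc, Category.assoc,
    ← rightUnitor_naturality, ← leftUnitor_naturality, whisker_exchange_assoc, unitors_equal]

variable [SymmetricCategory C]

theorem pass_base {N B NB : C} (u : N ⟶ 𝟙_ C) {nb : N ⊗ B ⟶ NB} {c : NB ⟶ B} {c' : B ⟶ NB}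
    (hc : c ≫ c' = 𝟙 _)
    (h : nb ≫ c = u ▷ B ≫ (λ_ B).hom) :
    nb = (β_ N B).hom ≫ (B ◁ u ≫ (ρ_ B).hom) ≫ c' := by
  have : nb = (nb ≫ c) ≫ c' := by rw [Category.assoc, hc, Category.comp_id]
  rw [this, h]
  simp [← BraidedCategory.braiding_naturality_left_assoc]

/-- If moving B past X denotes a braiding, then so does exchanging B with A and then moving it past
X: this is a hexagon identity. The isomorphism `xa` is cancelled to split the block XA. -/
theorem pass_step {X A B XA AB BA XB BX P Q R : C} (xa : X ⊗ A ⟶ XA) [IsIso xa]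
    {xa_b : XA ⊗ B ⟶ P} {ab : A ⊗ B ⟶ AB} {ba : B ⊗ A ⟶ BA} {sw : AB ⟶ BA} {x_ab : X ⊗ AB ⟶ P}
    {x_ba : X ⊗ BA ⟶ Q} {s : P ⟶ Q} {xb : X ⊗ B ⟶ XB} {xb_a : XB ⊗ A ⟶ Q} {p : XB ⟶ BX}
    {bx : B ⊗ X ⟶ BX} {bx_a : BX ⊗ A ⟶ R} {t : Q ⟶ R} {b_xa : B ⊗ XA ⟶ R}
    (h₁ : X ◁ ab ≫ x_ab = (α_ _ _ _).inv ≫ xa ▷ B ≫ xa_b)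
    (h₂ : X ◁ ba ≫ x_ba = (α_ _ _ _).inv ≫ xb ▷ A ≫ xb_a)
    (h₃ : B ◁ xa ≫ b_xa = (α_ _ _ _).inv ≫ bx ▷ A ≫ bx_a)
    (h₄ : ab ≫ sw = (β_ _ _).hom ≫ ba) (h₅ : x_ab ≫ s = X ◁ sw ≫ x_ba)
    (h₆ : xb_a ≫ t = p ▷ A ≫ bx_a) (ih : xb ≫ p = (β_ _ _).hom ≫ bx) :
    xa_b ≫ s ≫ t = (β_ _ _).hom ≫ b_xa := by
  rw [← cancel_epi (xa ▷ B), ← cancel_epi (α_ _ _ _).inv]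
  calc _ = (X ◁ ab ≫ x_ab) ≫ s ≫ t := by rw [h₁]; simp
    _ = X ◁ (ab ≫ sw) ≫ x_ba ≫ t := by
      rw [Category.assoc, reassoc_of% h₅, whiskerLeft_comp, Category.assoc]
    _ = X ◁ (β_ _ _).hom ≫ (X ◁ ba ≫ x_ba) ≫ t := by
      rw [h₄, whiskerLeft_comp, Category.assoc, Category.assoc]
    _ = X ◁ (β_ _ _).hom ≫ (α_ _ _ _).inv ≫ (xb ≫ p) ▷ A ≫ bx_a := by
      rw [h₂, comp_whiskerRight, Category.assoc, Category.assoc, Category.assoc, h₆]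
    _ = (α_ _ _ _).inv ≫ (β_ _ _).hom ≫ (α_ _ _ _).inv ≫ bx ▷ A ≫ bx_a := by
      rw [ih, comp_whiskerRight, BraidedCategory.braiding_tensor_left_hom]
      simp
    _ = _ := by
      rw [← h₃, BraidedCategory.braiding_naturality_left_assoc]

/-- The other hexagon. X is first exchanged with Y, by the induction hypothesis `ih`, and then with
the wire B, by `hp`; the transports `c` and `c'` absorb the rebracketing of lists. -/
theorem swap_step {X Y B YB XY YX XB BX P Q R R' : C} (yb : Y ⊗ B ⟶ YB) [IsIso yb]
    {x_yb : X ⊗ YB ⟶ P} {xy : X ⊗ Y ⟶ XY} {xy_b : XY ⊗ B ⟶ P} {w : XY ⟶ YX} {yx : Y ⊗ X ⟶ YX}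
    {s : P ⟶ Q} {yx_b : YX ⊗ B ⟶ Q} {xb : X ⊗ B ⟶ XB} {y_xb : Y ⊗ XB ⟶ Q} {p : XB ⟶ BX}
    {bx : B ⊗ X ⟶ BX} {y_bx : Y ⊗ BX ⟶ R} {t : Q ⟶ R} {yb_x : YB ⊗ X ⟶ R'} {c : R' ⟶ R}
    {c' : R ⟶ R'} (hc : c ≫ c' = 𝟙 _)
    (h₁ : X ◁ yb ≫ x_yb = (α_ _ _ _).inv ≫ xy ▷ B ≫ xy_b)
    (h₂ : Y ◁ xb ≫ y_xb = (α_ _ _ _).inv ≫ yx ▷ B ≫ yx_b)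
    (h₃ : Y ◁ bx ≫ y_bx = (α_ _ _ _).inv ≫ yb ▷ X ≫ yb_x ≫ c)
    (h₅ : xy_b ≫ s = w ▷ B ≫ yx_b) (h₆ : y_xb ≫ t = Y ◁ p ≫ y_bx)
    (hp : xb ≫ p = (β_ _ _).hom ≫ bx) (ih : xy ≫ w = (β_ _ _).hom ≫ yx) :
    x_yb ≫ (s ≫ t) ≫ c' = (β_ _ _).hom ≫ yb_x := by
  rw [← cancel_epi (X ◁ yb)]
  have h₂' : yx ▷ B ≫ yx_b = (α_ _ _ _).hom ≫ Y ◁ xb ≫ y_xb := by rw [h₂]; simp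
  calc _ = (X ◁ yb ≫ x_yb) ≫ (s ≫ t) ≫ c' := by simp
    _ = (α_ _ _ _).inv ≫ (xy ≫ w) ▷ B ≫ yx_b ≫ t ≫ c' := by
      rw [h₁]; simp only [Category.assoc, reassoc_of% h₅, comp_whiskerRight]
    _ = (α_ _ _ _).inv ≫ (β_ _ _).hom ▷ B ≫ (yx ▷ B ≫ yx_b) ≫ t ≫ c' := by
      rw [ih]; simp only [Category.assoc, comp_whiskerRight]
    _ = (α_ _ _ _).inv ≫ (β_ _ _).hom ▷ B ≫ (α_ _ _ _).hom ≫ Y ◁ (xb ≫ p) ≫ y_bx ≫ c' := by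
      rw [h₂']; simp only [Category.assoc, reassoc_of% h₆, whiskerLeft_comp]
    _ = (α_ _ _ _).inv ≫ (β_ _ _).hom ▷ B ≫ (α_ _ _ _).hom ≫ Y ◁ (β_ _ _).hom ≫
          (Y ◁ bx ≫ y_bx) ≫ c' := by
      rw [hp]; simp only [Category.assoc, whiskerLeft_comp]
    _ = (β_ _ _).hom ≫ yb ▷ X ≫ yb_x := by
      rw [h₃, BraidedCategory.braiding_tensor_right_hom]
      simp [hc]
    _ = _ := by
      rw [BraidedCategory.braiding_naturality_right_assoc]

end Monoidal

/-! ### The laws of a PROP -/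

section PropLaws

variable {H : Type u} [Category.{v} H] [Limits.HasZeroMorphisms H] [Semiadditive H]
  [MonoidalCategory H] [SymmetricCategory H] [Distributive H]

/-- The empty list with a unit adjoined is the unit. -/
def unitNil (H : Type u) [Category.{v} H] [Limits.HasZeroMorphisms H] [Semiadditive H]
    [MonoidalCategory H] : unitWires H .nil ⟶ 𝟙_ H := snd

instance isIso_unitNil : IsIso (unitNil H) := (sumLeftUnitor (𝟙_ H)).isIso_hom

theorem unitAppend_nil (X : Wires) :
    (unitAppend X .nil).hom = unitWires H X ◁ unitNil H ≫ (ρ_ _).hom :=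
  expandHom_parRightHom (wiresObj H X)

/-- Transport of wires along an equality. -/
def wireCast (H : Type u) [Category.{v} H] [Limits.HasZeroMorphisms H] [Semiadditive H]
    [MonoidalCategory H] {X Y : Wires} (h : X = Y) : unitWires H X ⟶ unitWires H Y :=
  eqToHom (congrArg (unitWires H) h)

theorem wireCast_rfl (X : Wires) : wireCast H (rfl : X = X) = 𝟙 _ := rfl

theorem wireCast_comp {X Y Z : Wires} (h : X = Y) (k : Y = Z) :
    wireCast H h ≫ wireCast H k = wireCast H (h.trans k) := by
  subst h k; simp [wireCast_rfl]

theorem wireCast_snoc {X Y : Wires} (h : X = Y) (B : Color) :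
    wireCast H h ▷ unitWires H (w₁ B) ≫ (unitAppend Y (w₁ B)).hom
      = (unitAppend X (w₁ B)).hom ≫ wireCast H (congrArg (fun X => Wires.snoc X B) h) := by
  subst h
  rw [wireCast_rfl, id_whiskerRight, Category.id_comp]
  exact (Category.comp_id _).symm

theorem unitAppend_assoc (X Y Z : Wires) :
    unitWires H X ◁ (unitAppend Y Z).hom ≫ (unitAppend X (Y.append Z)).hom
      = (α_ _ _ _).inv ≫ (unitAppend X Y).hom ▷ unitWires H Z ≫
        (unitAppend (X.append Y) Z).hom ≫ wireCast H (Wires.append_assoc X Y Z) := by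
  induction Z with
  | nil =>
    -- Concatenation with the empty list on the right is definitionally trivial, so the transport is
    -- an identity here.
    rw [unitAppend_nil, unitAppend_nil]
    exact right_unit_step _
  | snoc Z B ih =>
    exact assoc_step (unitAppend Z (w₁ B)).hom (unitAppend_snoc Y Z B)
      (unitAppend_snoc X (Y.append Z) B) (unitAppend_snoc (X.append Y) Z B)
      (wireCast_snoc (Wires.append_assoc X Y Z) B) ih

theorem nil_unitAppend (X : Wires) :
    (unitAppend .nil X).hom ≫ wireCast H (Wires.nil_append X)
      = unitNil H ▷ unitWires H X ≫ (λ_ _).hom := by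
  induction X with
  | nil =>
    rw [unitAppend_nil]
    exact left_unit_base (unitNil H)
  | snoc X B ih =>
    exact left_unit_step _ (unitAppend X (w₁ B)).hom (unitAppend_snoc .nil X B)
      (wireCast_snoc (Wires.nil_append X) B) ih

variable {G : Wires → Wires → Type w}

/-- Assignments of morphisms to diagrams that respect identities, swaps and both compositions. -/
structure UnitInterp (G : Wires → Wires → Type w) (H : Type u) [Category.{v} H]
    [Limits.HasZeroMorphisms H] [Semiadditive H] [MonoidalCategory H] [SymmetricCategory H]
    [Distributive H] where
  val : ∀ {X Y : Wires}, Diag G X Y → (unitWires H X ⟶ unitWires H Y)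
  val_id (X : Wires) : val (.id X) = 𝟙 _
  val_swap (A B : Color) :
    val (.swap A B) = sumMap (parSwap (colorObj H A) (colorObj H B)) (𝟙 (𝟙_ H))
  val_comp {X Y Z : Wires} (d : Diag G X Y) (e : Diag G Y Z) : val (d ⨾ e) = val d ≫ val e
  val_par {X Y X' Y' : Wires} (d : Diag G X Y) (e : Diag G X' Y') :
    (unitAppend X X').hom ≫ val (d ⫽ e) = (val d ⊗ₘ val e) ≫ (unitAppend Y Y').hom

namespace UnitInterp

variable (J : UnitInterp G H)

theorem val_cast {X X' Y Y' : Wires} (hX : X = X') (hY : Y = Y') (d : Diag G X Y) :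
    J.val (d.cast hX hY) = wireCast H hX.symm ≫ J.val d ≫ wireCast H hY := by
  subst hX hY
  rw [wireCast_rfl, wireCast_rfl, Category.comp_id, Category.id_comp]; rfl

/-- The wire is moved one neighbour at a time; each exchange denotes a braiding by
`unitAppend_swap`, and the hexagon of `pass_step` composes them. -/
theorem val_passLeft (X : Wires) (B : Color) :
    (unitAppend X (w₁ B)).hom ≫ J.val (Diag.passLeft X B)
      = (β_ _ _).hom ≫ (unitAppend (w₁ B) X).hom := by
  induction X with
  | nil =>
    change _ ≫ J.val (.id _) = _
    rw [J.val_id, unitAppend_nil (w₁ B)]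
    -- For a single wire the transport between `nil.append (w₁ B)` and `w₁ B` is an identity by
    -- definition, so the unit law of `nil_unitAppend` can be compared directly with the right unit
    -- law.
    exact (Category.comp_id _).trans ((pass_base _ (wireCast_comp _ rfl)
      (nil_unitAppend (w₁ B))).trans (congrArg (_ ≫ ·) (Category.comp_id _)))
  | snoc X A ih =>
    have h₅ := J.val_par (.id X) (.swap A B)
    have h₆ := J.val_par (Diag.passLeft X B) (.id (w₁ A))
    rw [J.val_id, id_tensorHom, J.val_swap] at h₅
    rw [J.val_id, tensorHom_id] at h₆
    refine (congrArg (_ ≫ ·) (J.val_comp _ _)).trans ?_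
    exact pass_step (unitAppend X (w₁ A)).hom (unitAppend_snoc X (w₁ A) B)
      (unitAppend_snoc X (w₁ B) A) (unitAppend_snoc (w₁ B) X A) (unitAppend_swap A B) h₅ h₆ ih

/-- The formal block swap denotes the braiding of the two blocks, so naturality of swaps becomes
naturality of the braiding. -/
theorem val_swapBlock (X Y : Wires) :
    (unitAppend X Y).hom ≫ J.val (Diag.swapBlock X Y) = (β_ _ _).hom ≫ (unitAppend Y X).hom := by
  induction Y with
  | nil =>
    have h₀ := J.val_cast rfl (Wires.nil_append X).symm (.id X)
    rw [J.val_id, wireCast_rfl, Category.id_comp, Category.id_comp] at h₀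
    refine (congrArg (_ ≫ ·) h₀).trans ?_
    rw [unitAppend_nil]
    have h := pass_base _ ((wireCast_comp (Wires.nil_append X) (Wires.nil_append X).symm).trans
      (wireCast_rfl _)) (nil_unitAppend (H := H) X)
    rw [h]
    refine Eq.trans ?_ (SymmetricCategory.symmetry_assoc _ _ _).symm
    rfl
  | snoc Y B ih =>
    have h₅ := J.val_par (Diag.swapBlock X Y) (.id (w₁ B))
    have h₆ := J.val_par (.id Y) (Diag.passLeft X B)
    rw [J.val_id, tensorHom_id] at h₅
    rw [J.val_id, id_tensorHom] at h₆
    have h₀ := J.val_cast rfl (Wires.append_assoc Y (w₁ B) X).symm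
      ((Diag.swapBlock X Y ⫽ Diag.id (w₁ B)) ⨾ (Diag.id Y ⫽ Diag.passLeft X B))
    refine (congrArg (_ ≫ ·) (h₀.trans ((Category.id_comp _).trans
      (congrArg (· ≫ _) (J.val_comp _ _))))).trans ?_
    exact swap_step (unitAppend Y (w₁ B)).hom ((wireCast_comp _ _).trans (wireCast_rfl _))
      (unitAppend_snoc X Y B) (unitAppend_snoc Y X B) (unitAppend_assoc Y (w₁ B) X) h₅ h₆
      (J.val_passLeft X B) ih

/-- Each structural law is checked after composing with the invertible merging morphism, which
replaces ∥ by ⊗; it is then a law of the symmetric monoidal category. Only the axioms and their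
mirrors stay as hypotheses. -/
theorem val_equiv (μ : ∀ {X Y : Wires}, G X Y → G Y X)
    (Ax : ∀ {X Y : Wires}, Diag G X Y → Diag G X Y → Prop)
    (hAx : ∀ {X Y : Wires} {d e : Diag G X Y}, Ax d e → J.val d = J.val e)
    (hAxM : ∀ {X Y : Wires} {d e : Diag G X Y}, Ax d e →
      J.val (d.mirror μ) = J.val (e.mirror μ))
    {X Y : Wires} {d e : Diag G X Y} (h : Diag.Equiv μ Ax d e) : J.val d = J.val e := by
  induction h with
  | refl d => rfl
  | symm _ ih => exact ih.symm
  | trans _ _ ih ih' => exact ih.trans ih'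
  | comp_congr _ _ ih ih' => rw [J.val_comp, J.val_comp, ih, ih']
  | par_congr _ _ ih ih' =>
    rw [← cancel_epi (unitAppend _ _).hom, J.val_par, J.val_par, ih, ih']
  | id_comp d => rw [J.val_comp, J.val_id, Category.id_comp]
  | comp_id d => rw [J.val_comp, J.val_id, Category.comp_id]
  | comp_assoc d e f => simp only [J.val_comp, Category.assoc]
  | id_par_id X Y =>
    rw [← cancel_epi (unitAppend _ _).hom, J.val_par, J.val_id, J.val_id, J.val_id]
    simp
  | interchange d e d' e' =>
    rw [← cancel_epi (unitAppend _ _).hom, J.val_par, J.val_comp, J.val_comp, J.val_comp,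
      ← Category.assoc, J.val_par, Category.assoc, J.val_par, tensorHom_comp_tensorHom_assoc]
  | @par_assoc X Y X' Y' X'' Y'' d e f =>
    -- The source is split into its three blocks. Coherence of merging at source and target leaves
    -- naturality of the associator of ⊗.
    rw [J.val_cast, ← cancel_epi (unitAppend X (X'.append X'')).hom, J.val_par,
      ← cancel_epi (unitWires H X ◁ (unitAppend X' X'').hom), ← Category.assoc,
      unitAppend_assoc X X' X'']
    have h₁ : wireCast H (Wires.append_assoc X X' X'') ≫
        wireCast H (Wires.append_assoc X X' X'').symm = 𝟙 _ :=
      (wireCast_comp _ _).trans (wireCast_rfl _)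
    have h₂ := J.val_par (d ⫽ e) f
    have h₃ := J.val_par d e
    have h₄ := J.val_par e f
    have h₅ := unitAppend_assoc (H := H) Y Y' Y''
    simp only [Category.assoc, reassoc_of% h₁, reassoc_of% h₂]
    rw [← id_tensorHom, ← tensorHom_id, tensorHom_comp_tensorHom_assoc,
      tensorHom_comp_tensorHom_assoc, h₃, h₄, Category.id_comp, Category.id_comp,
      ← Category.comp_id (J.val f), ← tensorHom_comp_tensorHom_assoc,
      ← Category.comp_id (J.val d), ← tensorHom_comp_tensorHom_assoc, Category.comp_id,
      id_tensorHom, h₅, tensorHom_id]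
    simp
  | @nil_par X Y d =>
    have h₁ := nil_unitAppend (H := H) X
    have h₂ := nil_unitAppend (H := H) Y
    have h₃ : wireCast H (Wires.nil_append X) ≫ wireCast H (Wires.nil_append X).symm = 𝟙 _ :=
      (wireCast_comp _ _).trans (wireCast_rfl _)
    have h₄ := J.val_par (.id .nil) d
    rw [J.val_id, id_tensorHom] at h₄
    rw [J.val_cast, ← cancel_epi (unitNil H ▷ unitWires H X ≫ (λ_ _).hom), ← h₁]
    simp only [Category.assoc, reassoc_of% h₃, reassoc_of% h₄]
    rw [h₂, reassoc_of% h₁, whisker_exchange_assoc, leftUnitor_naturality]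
  | @par_nil X Y d =>
    have h := J.val_par d (.id .nil)
    rw [J.val_id, tensorHom_id, unitAppend_nil, unitAppend_nil] at h
    have h' : (unitWires H X ◁ unitNil H ≫ (ρ_ _).hom) ≫ J.val d
        = J.val d ▷ _ ≫ unitWires H Y ◁ unitNil H ≫ (ρ_ _).hom := by
      rw [Category.assoc, ← whisker_exchange_assoc, rightUnitor_naturality]
    exact (cancel_epi (unitWires H X ◁ unitNil H ≫ (ρ_ _).hom)).1 (h.trans h'.symm)
  | swap_swap A B =>
    rw [J.val_comp, J.val_id, J.val_swap, J.val_swap]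
    refine (sumMap_comp _ _ _ _).symm.trans ?_
    rw [parSwap_parSwap, Category.comp_id, sumMap_id]; rfl
  | swap_natural d e =>
    rw [← cancel_epi (unitAppend _ _).hom, J.val_comp, J.val_comp, ← Category.assoc, J.val_par,
      Category.assoc, J.val_swapBlock, ← Category.assoc (unitAppend _ _).hom, J.val_swapBlock,
      Category.assoc, J.val_par, BraidedCategory.braiding_naturality_assoc]
  | ax h => exact hAx h
  | ax_mirror h => exact hAxM h

end UnitInterp

end PropLaws

/-! ### The two semantics, and membership in the category with a unit adjoined -/

section Semantics

variable {R : Type w} [CommSemiring R] {H : Type u} [Category.{v} H] [Limits.HasZeroMorphisms H]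
  [Semiadditive H] [MonoidalCategory H] [SymmetricCategory H] [Distributive H]
  (scal : ScalarIso R H)

theorem semFull_par {X Y X' Y' : Wires} (d : FullDiag R X Y) (e : FullDiag R X' Y') :
    (unitAppend X X').hom ≫ semFull scal (d ⫽ e)
      = (semFull scal d ⊗ₘ semFull scal e) ≫ (unitAppend Y Y').hom := by
  have h : semFull scal (d ⫽ e) = (unitAppend X X').inv ≫
      (semFull scal d ⊗ₘ semFull scal e) ≫ (unitAppend Y Y').hom := by
    rw [unitAppend_inv, unitAppend_hom, Category.assoc]; rfl
  rw [h, Iso.hom_inv_id_assoc]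

/-- The parallel product becomes a conjugated tensor by naturality of the expansion. -/
theorem sumMap_sem_par {X Y X' Y' : Wires} (d : FDiag R X Y) (e : FDiag R X' Y') :
    (unitAppend X X').hom ≫ sumMap (sem scal (d ⫽ e)) (𝟙 (𝟙_ H))
      = (sumMap (sem scal d) (𝟙 (𝟙_ H)) ⊗ₘ sumMap (sem scal e) (𝟙 (𝟙_ H))) ≫
        (unitAppend Y Y').hom := by
  have h : sem scal (d ⫽ e) = appendInv H X X' ≫ parMap (sem scal d) (sem scal e) ≫
      appendHom H Y Y' := rfl
  rw [unitAppend_hom, unitAppend_hom, ← Category.assoc, expandHom_naturality, Category.assoc,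
    Category.assoc, ← sumMap_comp, ← sumMap_comp, h, ← Category.assoc, (append_inverse X X').1,
    Category.id_comp]

/-- The semantics of the full calculus respects the operations on diagrams. -/
noncomputable def fullInterp : UnitInterp (Gen R) H where
  val := semFull scal
  val_id _ := rfl
  val_swap _ _ := rfl
  val_comp _ _ := rfl
  val_par := semFull_par scal

/-- The semantics of functional diagrams respects the operations on diagrams. -/
noncomputable def functionalInterp : UnitInterp (FGen R) H where
  val d := sumMap (sem scal d) (𝟙 (𝟙_ H))
  val_id _ := sumMap_id _ _
  val_swap _ _ := rfl
  val_comp d e := by rw [← sumMap_comp, Category.comp_id]; rfl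
  val_par := sumMap_sem_par scal

/-- Both sides respect all operations in the same way and agree on generators by definition. -/
theorem semFull_incl {X Y : Wires} (d : FDiag R X Y) :
    semFull scal d.incl = sumMap (sem scal d) (𝟙 (𝟙_ H)) := by
  induction d with
  | id X => exact (sumMap_id _ _).symm
  | swap A B => rfl
  | gen g => rfl
  | comp d e ih ih' =>
    rw [show sem scal (d ⨾ e) = sem scal d ≫ sem scal e from rfl,
      ← Category.comp_id (𝟙 (𝟙_ H)), sumMap_comp, ← ih, ← ih']
    rfl
  | par d e ih ih' =>
    rw [← cancel_epi (unitAppend _ _).hom, sumMap_sem_par, ← ih, ← ih']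
    exact semFull_par scal (FDiag.incl d) (FDiag.incl e)

theorem inPlusOne_iff {X Y : H} (f : (X ⊕' 𝟙_ H) ⟶ (Y ⊕' 𝟙_ H)) :
    InPlusOne f ↔ ∃ g : (X ⊕' 𝟙_ H) ⟶ (Y ⊕' 𝟙_ H), f = g + snd ≫ inr := Iff.rfl

theorem inPlusOne_sumMap {X Y : H} (f : X ⟶ Y) : InPlusOne (sumMap f (𝟙 (𝟙_ H))) := by
  refine (inPlusOne_iff _).2 ⟨fst ≫ f ≫ inl, ?_⟩
  rw [sumMap, desc_eq_add, Category.id_comp]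

theorem snd_inr_idem (X Y Z : H) :
    ((snd : (X ⊕' 𝟙_ H) ⟶ 𝟙_ H) ≫ (inr : 𝟙_ H ⟶ (Y ⊕' 𝟙_ H))) ≫ snd ≫ (inr : 𝟙_ H ⟶ (Z ⊕' 𝟙_ H))
      = snd ≫ inr := by
  rw [Category.assoc, ← Category.assoc inr, inr_snd, Category.id_comp]

theorem InPlusOne.comp {X Y Z : H} {f : (X ⊕' 𝟙_ H) ⟶ (Y ⊕' 𝟙_ H)}
    {f' : (Y ⊕' 𝟙_ H) ⟶ (Z ⊕' 𝟙_ H)} (h : InPlusOne f) (h' : InPlusOne f') :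
    InPlusOne (f ≫ f') := by
  obtain ⟨g, rfl⟩ := (inPlusOne_iff f).1 h
  obtain ⟨g', rfl⟩ := (inPlusOne_iff f').1 h'
  -- With e for the projection onto the adjoined unit, (g + e)(g' + e) = g(g' + e) + e g' + e e, and
  -- e e = e.
  refine (inPlusOne_iff _).2 ⟨g ≫ (g' + snd ≫ inr) + (snd ≫ inr) ≫ g', ?_⟩
  rw [add_comp, comp_add (snd ≫ inr), snd_inr_idem, add_assoc]

/-- The expansion matches the summand 1 of (X | X') ⊕ 1 with 1 ⊗ 1; every other summand involves a
factor that the projection kills. -/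
theorem expand_snd_inr (X Y X' Y' : H) :
    expandInv X X' ≫ ((snd ≫ (inr : 𝟙_ H ⟶ (Y ⊕' 𝟙_ H))) ⊗ₘ (snd ≫ (inr : 𝟙_ H ⟶ (Y' ⊕' 𝟙_ H)))) ≫
      expandHom Y Y' = snd ≫ inr := by
  apply sumL_par_ext
  · simp only [← Category.assoc, parT_expandInv, tens_comp, sumL_snd, Limits.zero_comp,
      tens_zero_left]
  · simp only [← Category.assoc, parL_expandInv, pre_comp, tens_comp, sumL_snd, Limits.zero_comp,
      tens_zero_left, pre_zero]
  · simp only [← Category.assoc, parR_expandInv, pre_comp, tens_comp, sumL_snd, Limits.zero_comp,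
      tens_zero_right, pre_zero]
  · simp only [← Category.assoc, sumR_expandInv, pre_comp, tens_comp, sumR_snd]
    simp only [comp_inr, sumR_sumR_expandHom, pre_pre, Iso.inv_hom_id, pre_id]

theorem InPlusOne.tensor {X Y X' Y' : H} {f : (X ⊕' 𝟙_ H) ⟶ (Y ⊕' 𝟙_ H)}
    {f' : (X' ⊕' 𝟙_ H) ⟶ (Y' ⊕' 𝟙_ H)} (h : InPlusOne f) (h' : InPlusOne f') :
    InPlusOne (expandInv X X' ≫ (f ⊗ₘ f') ≫ expandHom Y Y') := by
  obtain ⟨g, rfl⟩ := (inPlusOne_iff f).1 h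
  obtain ⟨g', rfl⟩ := (inPlusOne_iff f').1 h'
  -- The product is expanded so that the tensor of the two projections, which becomes the required
  -- projection, stands alone.
  have e : ((g + snd ≫ inr) ⊗ₘ (g' + snd ≫ inr))
      = ((g ⊗ₘ (g' + snd ≫ inr)) + ((snd ≫ inr) ⊗ₘ g')) + ((snd ≫ inr) ⊗ₘ (snd ≫ inr)) := by
    have := tens_add_left g (snd ≫ inr) (g' + snd ≫ inr)
    rw [tens_add_right (snd ≫ inr), ← add_assoc] at this
    exact this
  refine (inPlusOne_iff _).2
    ⟨expandInv X X' ≫ ((g ⊗ₘ (g' + snd ≫ inr)) + ((snd ≫ inr) ⊗ₘ g')) ≫ expandHom Y Y', ?_⟩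
  rw [e, add_comp _ _ (expandHom Y Y'), comp_add (expandInv X X'), expand_snd_inr]

theorem inPlusOne_snd_lift (X : H) :
    InPlusOne ((snd : (X ⊕' 𝟙_ H) ⟶ 𝟙_ H) ≫ lift (𝟙 (𝟙_ H)) (𝟙 (𝟙_ H))) := by
  -- The diagonal is ι_ℓ + ι_r; its second term is already the required one.
  refine (inPlusOne_iff _).2 ⟨snd ≫ inl, ?_⟩
  rw [lift_eq_add, comp_add, Category.id_comp, Category.id_comp]

theorem inPlusOne_desc_inr (Y : H) :
    InPlusOne (desc (𝟙 (𝟙_ H)) (𝟙 (𝟙_ H)) ≫ (inr : 𝟙_ H ⟶ (Y ⊕' 𝟙_ H))) := by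
  refine (inPlusOne_iff _).2 ⟨fst ≫ inr, ?_⟩
  rw [desc_eq_add, add_comp, Category.comp_id, Category.comp_id]

theorem inPlusOne_semFull {X Y : Wires} (d : FullDiag R X Y) : InPlusOne (semFull scal d) := by
  induction d with
  | id X =>
    have := inPlusOne_sumMap (𝟙 (wiresObj H X))
    rw [sumMap_id] at this
    exact this
  | swap A B => exact inPlusOne_sumMap _
  | gen g =>
    cases g with
    | fn g => exact inPlusOne_sumMap _
    | unit => exact inPlusOne_snd_lift _
    | unitM => exact inPlusOne_desc_inr _
  | comp d e ih ih' => exact ih.comp ih'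
  | @par X Y X' Y' d e ih ih' =>
    have h : semFull scal (d ⫽ e) = sumMap (appendInv H X X') (𝟙 (𝟙_ H)) ≫
        (expandInv (wiresObj H X) (wiresObj H X') ≫ (semFull scal d ⊗ₘ semFull scal e) ≫
        expandHom (wiresObj H Y) (wiresObj H Y')) ≫ sumMap (appendHom H Y Y') (𝟙 (𝟙_ H)) := by
      simp only [Category.assoc]; rfl
    rw [h]
    exact (inPlusOne_sumMap _).comp ((ih.tensor ih').comp (inPlusOne_sumMap _))

/-- Reduces the mirror of an included functional axiom to the inclusion of its mirror. -/
theorem incl_mirror {X Y : Wires} (d : FDiag R X Y) :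
    Diag.mirror (fun g => Gen.mirror g) d.incl
      = FDiag.incl (Diag.mirror (fun g => FGen.mirror g) d) := by
  induction d with
  | id X => rfl
  | swap A B => rfl
  | gen g => rfl
  | comp d e ih ih' => exact congrArg₂ Diag.comp ih' ih
  | par d e ih ih' => exact congrArg₂ Diag.par ih ih'

end Semantics

/-! ### Monoidal identities shared by ⊗ and ⊕ -/

section MonoidalCoherence

variable {C : Type u} [Category.{v} C] [MonoidalCategory C]

theorem leftUnitor_tensor_comp {b c d : C} (f : b ⊗ c ⟶ d) :
    ((λ_ b).hom ⊗ₘ 𝟙 c) ≫ f = (α_ (𝟙_ C) b c).hom ≫ (𝟙 (𝟙_ C) ⊗ₘ f) ≫ (λ_ d).hom := by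
  simp [id_tensorHom, tensorHom_id]

theorem tensor_leftUnitor_comp {a c d : C} (f : a ⊗ c ⟶ d) :
    ((ρ_ a).hom ⊗ₘ 𝟙 c) ≫ f = (α_ a (𝟙_ C) c).hom ≫ (𝟙 a ⊗ₘ (λ_ c).hom) ≫ f := by
  simp [id_tensorHom, tensorHom_id]

/-- Inductive step for associativity of joins: prefixing one more factor a to the first block costs
a pentagon. The morphism `e` is a transport of normal forms and `e'` is the same transport under the
prefix. -/
theorem associator_comp_of_comp {a a' b c x y y' z : C} {g : a' ⊗ b ⟶ x} {k : x ⊗ c ⟶ y}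
    {e : y ⟶ y'} {m : b ⊗ c ⟶ z} {n : a' ⊗ z ⟶ y'} {e' : a ⊗ y ⟶ a ⊗ y'}
    (h : (g ⊗ₘ 𝟙 c) ≫ k ≫ e = (α_ a' b c).hom ≫ (𝟙 a' ⊗ₘ m) ≫ n) (he : (𝟙 a ⊗ₘ e) = e') :
    (((α_ a a' b).hom ≫ (𝟙 a ⊗ₘ g)) ⊗ₘ 𝟙 c) ≫ ((α_ a x c).hom ≫ (𝟙 a ⊗ₘ k)) ≫ e'
      = (α_ (a ⊗ a') b c).hom ≫ (𝟙 (a ⊗ a') ⊗ₘ m) ≫ (α_ a a' z).hom ≫ (𝟙 a ⊗ₘ n) := by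
  subst he
  simp only [id_tensorHom, tensorHom_id, comp_whiskerRight, Category.assoc] at h ⊢
  rw [associator_naturality_middle_assoc, ← MonoidalCategory.whiskerLeft_comp,
    ← MonoidalCategory.whiskerLeft_comp, h]
  simp

theorem rightUnitor_tensor_of_eq {a b x : C} {f : b ⊗ 𝟙_ C ⟶ x} {e : x ⟶ b}
    (h : f ≫ e = (ρ_ b).hom) :
    ((α_ a b (𝟙_ C)).hom ≫ (𝟙 a ⊗ₘ f)) ≫ (𝟙 a ⊗ₘ e) = (ρ_ (a ⊗ b)).hom := by
  simp only [id_tensorHom, Category.assoc, ← MonoidalCategory.whiskerLeft_comp, h]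
  simp

theorem tensor_id_comp_assoc {a b c d e : C} (f : a ⊗ b ⟶ c) (g : c ⟶ d) (h : d ⟶ e) :
    (𝟙 a ⊗ₘ 𝟙 b) ≫ (f ≫ g) ≫ h = f ≫ g ≫ h := by
  simp

theorem unit_unitors : (λ_ (𝟙_ C)).hom = (ρ_ (𝟙_ C)).hom := unitors_equal

end MonoidalCoherence

/-! ### The biproduct as a second monoidal structure -/

section SumMonoidal

variable {H : Type u} [Category.{v} H] [Limits.HasZeroMorphisms H] [Semiadditive H]

theorem sumAssoc_naturality {X X' Y Y' Z Z' : H} (f : X ⟶ X') (g : Y ⟶ Y') (h : Z ⟶ Z') :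
    sumMap (sumMap f g) h ≫ (sumAssoc X' Y' Z').hom
      = (sumAssoc X Y Z).hom ≫ sumMap f (sumMap g h) := by
  refine sum_hom_ext' (sum_hom_ext' ?_ ?_) ?_ <;>
    simp only [sumAssoc, sumMap, ← Category.assoc, inl_desc, inr_desc] <;>
    simp only [Category.assoc, inl_desc, inr_desc] <;>
    simp only [← Category.assoc, inl_desc, inr_desc]

theorem sum_pentagon (W X Y Z : H) :
    sumMap (sumAssoc W X Y).hom (𝟙 Z) ≫ (sumAssoc W (X ⊕' Y) Z).hom ≫
        sumMap (𝟙 W) (sumAssoc X Y Z).hom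
      = (sumAssoc (W ⊕' X) Y Z).hom ≫ (sumAssoc W X (Y ⊕' Z)).hom := by
  refine sum_hom_ext' (sum_hom_ext' (sum_hom_ext' ?_ ?_) ?_) ?_ <;>
    simp only [sumAssoc, sumMap, ← Category.assoc, inl_desc, inr_desc, Category.id_comp] <;>
    repeat first
      | simp only [← Category.assoc, inl_desc, inr_desc]
      | simp only [Category.assoc, inl_desc, inr_desc]

theorem sum_triangle (X Y : H) :
    (sumAssoc X Semiadditive.zeroObj Y).hom ≫ sumMap (𝟙 X) (sumLeftUnitor Y).hom
      = sumMap (sumRightUnitor X).hom (𝟙 Y) := by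
  refine sum_hom_ext' (sum_hom_ext' ?_ ?_) ?_
  · simp [sumAssoc, sumLeftUnitor, sumRightUnitor, sumMap, ← Category.assoc]
  · exact Semiadditive.isZero_zeroObj.eq_of_src _ _
  · simp only [sumAssoc, sumLeftUnitor, sumRightUnitor, sumMap, ← Category.assoc, inr_desc,
      Category.id_comp]
    simp only [Category.assoc, inr_desc]
    simp only [← Category.assoc, inr_snd, Category.id_comp]

/-- Biproducts as a monoidal structure. -/
@[reducible]
def sumMonoidal (H : Type u) [Category.{v} H] [Limits.HasZeroMorphisms H] [Semiadditive H] :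
    MonoidalCategory H :=
  letI : MonoidalCategoryStruct H :=
    { tensorObj := sum
      tensorHom := sumMap
      whiskerLeft := fun X _ _ f => sumMap (𝟙 X) f
      whiskerRight := fun f Y => sumMap f (𝟙 Y)
      tensorUnit := Semiadditive.zeroObj
      associator := sumAssoc
      leftUnitor := sumLeftUnitor
      rightUnitor := sumRightUnitor }
  MonoidalCategory.ofTensorHom
    (id_tensorHom_id := fun X Y => sumMap_id X Y)
    (tensorHom_comp_tensorHom := fun f g f' g' => (sumMap_comp f f' g g').symm)
    (id_tensorHom := fun _ _ _ _ => rfl)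
    (tensorHom_id := fun _ _ => rfl)
    (associator_naturality := sumAssoc_naturality)
    (leftUnitor_naturality := fun _ => sumMap_snd _ _)
    (rightUnitor_naturality := fun _ => sumMap_fst _ _)
    (pentagon := sum_pentagon)
    (triangle := sum_triangle)

end SumMonoidal

/-! ### Strict joins and normal forms of colours -/

namespace Color

/-- Sum with an indecomposable colour on the left. -/
def plusAtom (A : Color) : Color → Color
  | .zero => A
  | .one => A ⊞ .one
  | .plus B C => A ⊞ (B ⊞ C)
  | .tensor B C => A ⊞ (B ⊠ C)

/-- Product with an indecomposable colour on the left. -/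
def tensorAtom (A : Color) : Color → Color
  | .one => A
  | .zero => A ⊠ .zero
  | .plus B C => A ⊠ (B ⊞ C)
  | .tensor B C => A ⊠ (B ⊠ C)

/-- A strictly associative and unital version of the sum of colours. -/
def plusJoin : Color → Color → Color
  | .zero, B => B
  | .plus A A', B => A ⊞ plusJoin A' B
  | .one, B => plusAtom .one B
  | .tensor A A', B => plusAtom (A ⊠ A') B

/-- A strictly associative and unital version of the product of colours. -/
def tensorJoin : Color → Color → Color
  | .one, B => B
  | .tensor A A', B => A ⊠ tensorJoin A' B
  | .zero, B => tensorAtom .zero B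
  | .plus A A', B => tensorAtom (A ⊞ A') B

/-- Representatives of structural equivalence. -/
def normal : Color → Color
  | .zero => .zero
  | .one => .one
  | .plus A B => plusJoin (normal A) (normal B)
  | .tensor A B => tensorJoin (normal A) (normal B)

theorem plusAtom_eq (A : Color) {B : Color} (h : B ≠ zero) : plusAtom A B = A ⊞ B := by
  cases B <;> first | rfl | exact (h rfl).elim

theorem tensorAtom_eq (A : Color) {B : Color} (h : B ≠ one) : tensorAtom A B = A ⊠ B := by
  cases B <;> first | rfl | exact (h rfl).elim

theorem plusAtom_ne (A B : Color) (h : A ≠ zero) : plusAtom A B ≠ zero := by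
  cases B <;> simp [plusAtom, h]

theorem tensorAtom_ne (A B : Color) (h : A ≠ one) : tensorAtom A B ≠ one := by
  cases B <;> simp [tensorAtom, h]

theorem plusJoin_ne (A B : Color) (h : A ≠ zero) : plusJoin A B ≠ zero := by
  cases A with
  | zero => exact absurd rfl h
  | one => exact plusAtom_ne _ _ h
  | plus A A' => simp [plusJoin]
  | tensor A A' => exact plusAtom_ne _ _ h

theorem tensorJoin_ne (A B : Color) (h : A ≠ one) : tensorJoin A B ≠ one := by
  cases A with
  | one => exact absurd rfl h
  | zero => exact tensorAtom_ne _ _ h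
  | tensor A A' => simp [tensorJoin]
  | plus A A' => exact tensorAtom_ne _ _ h

theorem plusJoin_zero (A : Color) : plusJoin A zero = A := by
  induction A with
  | zero => rfl
  | one => rfl
  | plus A A' _ ih => rw [plusJoin, ih]
  | tensor A A' => rfl

theorem tensorJoin_one (A : Color) : tensorJoin A one = A := by
  induction A with
  | zero => rfl
  | one => rfl
  | tensor A A' _ ih => rw [tensorJoin, ih]
  | plus A A' => rfl

/-- The hypothesis says that A is treated as a single summand. Apart from B = 0, where the unit is
absorbed, both sides are plain sums. -/
theorem plusJoin_plusAtom (A : Color) (hA : ∀ B, plusJoin A B = plusAtom A B) (B C : Color) :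
    plusJoin (plusAtom A B) C = plusAtom A (plusJoin B C) := by
  by_cases hB : B = zero
  · subst hB; exact hA C
  · rw [plusAtom_eq A hB, plusAtom_eq A (plusJoin_ne B C hB), plusJoin]

theorem tensorJoin_tensorAtom (A : Color) (hA : ∀ B, tensorJoin A B = tensorAtom A B)
    (B C : Color) : tensorJoin (tensorAtom A B) C = tensorAtom A (tensorJoin B C) := by
  by_cases hB : B = one
  · subst hB; exact hA C
  · rw [tensorAtom_eq A hB, tensorAtom_eq A (tensorJoin_ne B C hB), tensorJoin]

/-- The recursion descends only into the right summand, so the law holds for all colours, whether or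
not they are normal. -/
theorem plusJoin_assoc (A B C : Color) :
    plusJoin (plusJoin A B) C = plusJoin A (plusJoin B C) := by
  induction A with
  | zero => rfl
  | one => exact plusJoin_plusAtom _ (fun _ => rfl) B C
  | plus A A' _ ih => rw [plusJoin, plusJoin, plusJoin, ih]
  | tensor A A' => exact plusJoin_plusAtom _ (fun _ => rfl) B C

theorem tensorJoin_assoc (A B C : Color) :
    tensorJoin (tensorJoin A B) C = tensorJoin A (tensorJoin B C) := by
  induction A with
  | one => rfl
  | zero => exact tensorJoin_tensorAtom _ (fun _ => rfl) B C
  | tensor A A' _ ih => rw [tensorJoin, tensorJoin, tensorJoin, ih]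
  | plus A A' => exact tensorJoin_tensorAtom _ (fun _ => rfl) B C

end Color

open Color

/-! ### Coherence: adapters do not depend on the derivation -/

section Coherence

variable (H : Type u) [Category.{v} H] [Limits.HasZeroMorphisms H] [Semiadditive H]
  [MonoidalCategory H]

/-- Transport of interpretations along an equality of colours. -/
def colorCast {A B : Color} (h : A = B) : colorObj H A ≅ colorObj H B :=
  eqToIso (congrArg (colorObj H) h)

variable {H}

theorem colorCast_trans {A B C : Color} (h : A = B) (k : B = C) :
    colorCast H h ≪≫ colorCast H k = colorCast H (h.trans k) := by
  subst h k; exact Iso.refl_trans _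

theorem sumMap_colorCast (A : Color) {B C : Color} (h : B = C) :
    sumMap (𝟙 (colorObj H A)) (colorCast H h).hom
      = (colorCast H (congrArg (A ⊞ ·) h)).hom := by
  subst h; exact sumMap_id _ _

theorem tensorHom_colorCast (A : Color) {B C : Color} (h : B = C) :
    (𝟙 (colorObj H A) ⊗ₘ (colorCast H h).hom) = (colorCast H (congrArg (A ⊠ ·) h)).hom := by
  subst h; exact id_tensorHom_id _ _

variable (H)

/-- Comparison of `plusAtom` with the biproduct. -/
def plusAtomIso (A : Color) : ∀ B : Color,
    (colorObj H A ⊕' colorObj H B) ≅ colorObj H (plusAtom A B)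
  | .zero => sumRightUnitor (colorObj H A)
  | .one => Iso.refl (colorObj H A ⊕' colorObj H .one)
  | .plus B C => Iso.refl (colorObj H A ⊕' colorObj H (B ⊞ C))
  | .tensor B C => Iso.refl (colorObj H A ⊕' colorObj H (B ⊠ C))

/-- Comparison of `plusJoin` with the biproduct. -/
def plusJoinIso : ∀ A B : Color, (colorObj H A ⊕' colorObj H B) ≅ colorObj H (plusJoin A B)
  | .zero, B => sumLeftUnitor (colorObj H B)
  | .plus A A', B => sumAssoc (colorObj H A) (colorObj H A') (colorObj H B) ≪≫
      sumIso (Iso.refl (colorObj H A)) (plusJoinIso A' B)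
  | .one, B => plusAtomIso H .one B
  | .tensor A A', B => plusAtomIso H (A ⊠ A') B

/-- Comparison of `tensorAtom` with the monoidal product. -/
def tensorAtomIso (A : Color) : ∀ B : Color,
    (colorObj H A ⊗ colorObj H B) ≅ colorObj H (tensorAtom A B)
  | .one => ρ_ (colorObj H A)
  | .zero => Iso.refl (colorObj H A ⊗ colorObj H .zero)
  | .plus B C => Iso.refl (colorObj H A ⊗ colorObj H (B ⊞ C))
  | .tensor B C => Iso.refl (colorObj H A ⊗ colorObj H (B ⊠ C))

/-- Comparison of `tensorJoin` with the monoidal product. -/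
def tensorJoinIso : ∀ A B : Color, (colorObj H A ⊗ colorObj H B) ≅ colorObj H (tensorJoin A B)
  | .one, B => λ_ (colorObj H B)
  | .tensor A A', B => α_ (colorObj H A) (colorObj H A') (colorObj H B) ≪≫
      (Iso.refl (colorObj H A) ⊗ᵢ tensorJoinIso A' B)
  | .zero, B => tensorAtomIso H .zero B
  | .plus A A', B => tensorAtomIso H (A ⊞ A') B

variable {H}

/-- Outside the unit case the comparison is an identity, written as a transport because the colours
are equal only after a case distinction. -/
theorem plusAtomIso_hom (A : Color) {B : Color} (h : B ≠ zero) :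
    (plusAtomIso H A B).hom = (colorCast H (plusAtom_eq A h).symm).hom := by
  cases B <;> first | rfl | exact (h rfl).elim

theorem tensorAtomIso_hom (A : Color) {B : Color} (h : B ≠ one) :
    (tensorAtomIso H A B).hom = (colorCast H (tensorAtom_eq A h).symm).hom := by
  cases B <;> first | rfl | exact (h rfl).elim

theorem plusJoinIso_zero (A : Color) :
    (plusJoinIso H A zero).hom ≫ (colorCast H (plusJoin_zero A)).hom
      = (sumRightUnitor (colorObj H A)).hom := by
  induction A with
  | zero => exact (Category.comp_id _).trans (@unit_unitors H _ (sumMonoidal H))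
  | one => exact Category.comp_id _
  | plus A A' _ ih =>
    have := @rightUnitor_tensor_of_eq H _ (sumMonoidal H) (colorObj H A) _ _ _ _ ih
    exact (congrArg (_ ≫ ·) (sumMap_colorCast A _).symm).trans this
  | tensor A A' => exact Category.comp_id _

theorem tensorJoinIso_one (A : Color) :
    (tensorJoinIso H A one).hom ≫ (colorCast H (tensorJoin_one A)).hom
      = (ρ_ (colorObj H A)).hom := by
  induction A with
  | one => exact (Category.comp_id _).trans unit_unitors
  | zero => exact Category.comp_id _
  | tensor A A' _ ih =>
    have := rightUnitor_tensor_of_eq (a := colorObj H A) ih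
    exact (congrArg (_ ≫ ·) (tensorHom_colorCast A _).symm).trans this
  | plus A A' => exact Category.comp_id _

/-- The hypotheses treat together the two kinds of indecomposable summand, 1 and a product. For B =
0 the claim is the triangle identity; otherwise the comparison with B is an identity. -/
theorem plusAtomIso_assoc (A : Color) (hA : ∀ B, plusJoin A B = plusAtom A B)
    (hI : ∀ B, (plusJoinIso H A B).hom ≫ (colorCast H (hA B)).hom = (plusAtomIso H A B).hom)
    (B C : Color) :
    sumMap (plusAtomIso H A B).hom (𝟙 (colorObj H C)) ≫ (plusJoinIso H (plusAtom A B) C).hom ≫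
        (colorCast H (plusJoin_plusAtom A hA B C)).hom
      = (sumAssoc (colorObj H A) (colorObj H B) (colorObj H C)).hom ≫
        sumMap (𝟙 (colorObj H A)) (plusJoinIso H B C).hom ≫
        (plusAtomIso H A (plusJoin B C)).hom := by
  cases B with
  | zero =>
    have := @tensor_leftUnitor_comp H _ (sumMonoidal H) (colorObj H A) (colorObj H C) _
      (plusAtomIso H A C).hom
    exact (congrArg (_ ≫ ·) (hI C)).trans this
  | one =>
    rw [plusAtomIso_hom A (plusJoin_ne one C (by simp))]
    exact @tensor_id_comp_assoc H _ (sumMonoidal H) _ _ _ _ _ _ _ _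
  | plus B B' =>
    rw [plusAtomIso_hom A (plusJoin_ne (B ⊞ B') C (by simp))]
    exact @tensor_id_comp_assoc H _ (sumMonoidal H) _ _ _ _ _ _ _ _
  | tensor B B' =>
    rw [plusAtomIso_hom A (plusJoin_ne (B ⊠ B') C (by simp))]
    exact @tensor_id_comp_assoc H _ (sumMonoidal H) _ _ _ _ _ _ _ _

/-- The strict associativity of joins lies over the associator of ⊕. The inductive step is the
pentagon, applied in `sumMonoidal`. -/
theorem plusJoinIso_assoc (A B C : Color) :
    sumMap (plusJoinIso H A B).hom (𝟙 (colorObj H C)) ≫ (plusJoinIso H (plusJoin A B) C).hom ≫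
        (colorCast H (plusJoin_assoc A B C)).hom
      = (sumAssoc (colorObj H A) (colorObj H B) (colorObj H C)).hom ≫
        sumMap (𝟙 (colorObj H A)) (plusJoinIso H B C).hom ≫
        (plusJoinIso H A (plusJoin B C)).hom := by
  induction A with
  | zero =>
    have := @leftUnitor_tensor_comp H _ (sumMonoidal H) (colorObj H B) (colorObj H C) _
      (plusJoinIso H B C).hom
    exact (congrArg (_ ≫ ·) (Category.comp_id _)).trans this
  | one => exact plusAtomIso_assoc _ (fun _ => rfl) (fun _ => Category.comp_id _) B C
  | plus A A' _ ih =>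
    exact @associator_comp_of_comp H _ (sumMonoidal H) (colorObj H A) _ _ _ _ _ _ _ _ _ _ _ _ _
      ih (sumMap_colorCast A _)
  | tensor A A' => exact plusAtomIso_assoc _ (fun _ => rfl) (fun _ => Category.comp_id _) B C

theorem tensorAtomIso_assoc (A : Color) (hA : ∀ B, tensorJoin A B = tensorAtom A B)
    (hI : ∀ B, (tensorJoinIso H A B).hom ≫ (colorCast H (hA B)).hom = (tensorAtomIso H A B).hom)
    (B C : Color) :
    ((tensorAtomIso H A B).hom ⊗ₘ (𝟙 (colorObj H C))) ≫ (tensorJoinIso H (tensorAtom A B) C).hom ≫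
        (colorCast H (tensorJoin_tensorAtom A hA B C)).hom
      = (α_ (colorObj H A) (colorObj H B) (colorObj H C)).hom ≫
        ((𝟙 (colorObj H A)) ⊗ₘ (tensorJoinIso H B C).hom) ≫
        (tensorAtomIso H A (tensorJoin B C)).hom := by
  cases B with
  | one =>
    have := @tensor_leftUnitor_comp H _ _ (colorObj H A) (colorObj H C) _
      (tensorAtomIso H A C).hom
    exact (congrArg (_ ≫ ·) (hI C)).trans this
  | zero =>
    rw [tensorAtomIso_hom A (tensorJoin_ne zero C (by simp))]
    exact @tensor_id_comp_assoc H _ _ _ _ _ _ _ _ _ _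
  | plus B B' =>
    rw [tensorAtomIso_hom A (tensorJoin_ne (B ⊞ B') C (by simp))]
    exact @tensor_id_comp_assoc H _ _ _ _ _ _ _ _ _ _
  | tensor B B' =>
    rw [tensorAtomIso_hom A (tensorJoin_ne (B ⊠ B') C (by simp))]
    exact @tensor_id_comp_assoc H _ _ _ _ _ _ _ _ _ _

theorem tensorJoinIso_assoc (A B C : Color) :
    ((tensorJoinIso H A B).hom ⊗ₘ (𝟙 (colorObj H C))) ≫ (tensorJoinIso H (tensorJoin A B) C).hom ≫
        (colorCast H (tensorJoin_assoc A B C)).hom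
      = (α_ (colorObj H A) (colorObj H B) (colorObj H C)).hom ≫
        ((𝟙 (colorObj H A)) ⊗ₘ (tensorJoinIso H B C).hom) ≫
        (tensorJoinIso H A (tensorJoin B C)).hom := by
  induction A with
  | one =>
    have := @leftUnitor_tensor_comp H _ _ (colorObj H B) (colorObj H C) _
      (tensorJoinIso H B C).hom
    exact (congrArg (_ ≫ ·) (Category.comp_id _)).trans this
  | zero => exact tensorAtomIso_assoc _ (fun _ => rfl) (fun _ => Category.comp_id _) B C
  | tensor A A' _ ih =>
    exact @associator_comp_of_comp H _ _ (colorObj H A) _ _ _ _ _ _ _ _ _ _ _ _ _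
      ih (tensorHom_colorCast A _)
  | plus A A' => exact tensorAtomIso_assoc _ (fun _ => rfl) (fun _ => Category.comp_id _) B C

theorem plusJoinIso_naturality {A A' B B' : Color} (h : A = A') (k : B = B') :
    ∃ e : plusJoin A B = plusJoin A' B',
      sumMap (colorCast H h).hom (colorCast H k).hom ≫ (plusJoinIso H A' B').hom
        = (plusJoinIso H A B).hom ≫ (colorCast H e).hom := by
  subst h k
  exact ⟨rfl, (congrArg (· ≫ _) (sumMap_id _ _)).trans
    ((Category.id_comp _).trans (Category.comp_id _).symm)⟩

theorem tensorJoinIso_naturality {A A' B B' : Color} (h : A = A') (k : B = B') :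
    ∃ e : tensorJoin A B = tensorJoin A' B',
      ((colorCast H h).hom ⊗ₘ (colorCast H k).hom) ≫ (tensorJoinIso H A' B').hom
        = (tensorJoinIso H A B).hom ≫ (colorCast H e).hom := by
  subst h k
  exact ⟨rfl, (congrArg (· ≫ _) (id_tensorHom_id _ _)).trans
    ((Category.id_comp _).trans (Category.comp_id _).symm)⟩

variable (H)

/-- The structural isomorphism from a colour to its representative. -/
def normalIso : ∀ A : Color, colorObj H A ≅ colorObj H (normal A)
  | .zero => Iso.refl (colorObj H .zero)
  | .one => Iso.refl (colorObj H .one)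
  | .plus A B => sumIso (normalIso A) (normalIso B) ≪≫ plusJoinIso H (normal A) (normal B)
  | .tensor A B => (normalIso A ⊗ᵢ normalIso B) ≪≫ tensorJoinIso H (normal A) (normal B)

variable {H}

/-- This and the next three lemmas are the generating cases of coherence, stated in any monoidal
category so as to serve for ⊕ and for ⊗. Here `p` and `q` go to normal forms, `j` joins them, and
`r`, `s`, `e` are transports. -/
theorem normal_congr {C : Type u} [Category.{v} C] [MonoidalCategory C]
    {a a' b b' c c' d d' x x' : C}
    {f : a ⟶ a'} {g : b ⟶ b'} {p : a ⟶ c} {p' : a' ⟶ c'} {q : b ⟶ d} {q' : b' ⟶ d'}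
    {r : c ⟶ c'} {s : d ⟶ d'} {j : c ⊗ d ⟶ x} {j' : c' ⊗ d' ⟶ x'} {e : x ⟶ x'}
    (hf : f ≫ p' = p ≫ r) (hg : g ≫ q' = q ≫ s) (he : (r ⊗ₘ s) ≫ j' = j ≫ e) :
    (f ⊗ₘ g) ≫ (p' ⊗ₘ q') ≫ j' = ((p ⊗ₘ q) ≫ j) ≫ e := by
  rw [tensorHom_comp_tensorHom_assoc, hf, hg, ← tensorHom_comp_tensorHom_assoc, he,
    Category.assoc]

theorem normal_rightUnitor {C : Type u} [Category.{v} C] [MonoidalCategory C]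
    {a c x : C} {p : a ⟶ c} {j : c ⊗ 𝟙_ C ⟶ x} {e : x ⟶ c}
    (h : j ≫ e = (ρ_ c).hom) :
    (ρ_ a).hom ≫ p = ((p ⊗ₘ 𝟙 (𝟙_ C)) ≫ j) ≫ e := by
  rw [Category.assoc, h, tensorHom_id, rightUnitor_naturality]

theorem normal_leftUnitor {C : Type u} [Category.{v} C] [MonoidalCategory C]
    {a c : C} {p : a ⟶ c} :
    (λ_ a).hom ≫ p = ((𝟙 (𝟙_ C) ⊗ₘ p) ≫ (λ_ c).hom) ≫ 𝟙 c := by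
  rw [Category.comp_id, id_tensorHom, leftUnitor_naturality]

theorem normal_associator {C : Type u} [Category.{v} C] [MonoidalCategory C]
    {a a' b b' c c' x y z z' : C} {p : a ⟶ a'} {q : b ⟶ b'} {r : c ⟶ c'}
    {j : a' ⊗ b' ⟶ x} {j' : x ⊗ c' ⟶ y} {k : b' ⊗ c' ⟶ z} {k' : a' ⊗ z ⟶ z'} {e : y ⟶ z'}
    (h : (j ⊗ₘ 𝟙 c') ≫ j' ≫ e = (α_ a' b' c').hom ≫ (𝟙 a' ⊗ₘ k) ≫ k') :
    (α_ a b c).hom ≫ (p ⊗ₘ ((q ⊗ₘ r) ≫ k)) ≫ k'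
      = (((((p ⊗ₘ q) ≫ j) ⊗ₘ r)) ≫ j') ≫ e := by
  have h₁ : (((p ⊗ₘ q) ≫ j) ⊗ₘ r) = ((p ⊗ₘ q) ⊗ₘ r) ≫ (j ⊗ₘ 𝟙 c') := by
    rw [tensorHom_comp_tensorHom, Category.comp_id]
  have h₂ : (p ⊗ₘ ((q ⊗ₘ r) ≫ k)) = (p ⊗ₘ (q ⊗ₘ r)) ≫ (𝟙 a' ⊗ₘ k) := by
    rw [tensorHom_comp_tensorHom, Category.comp_id]
  rw [h₁, h₂, Category.assoc, Category.assoc, Category.assoc, h, ← Category.assoc,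
    ← associator_naturality,
    Category.assoc]

/-- Equivalent colours have equal normal forms, and a derivation acts on normal forms by mere
transport. Congruence uses naturality of the join comparisons, and the unit and associativity laws
use their compatibility with the strict laws. -/
theorem adapterTermIso_normalIso {A B : Color} (t : AdapterTerm A B) :
    ∃ h : normal A = normal B,
      (adapterTermIso H t).hom ≫ (normalIso H B).hom
        = (normalIso H A).hom ≫ (colorCast H h).hom := by
  induction t with
  | refl A => exact ⟨rfl, (Category.id_comp _).trans (Category.comp_id _).symm⟩
  | symm t ih =>
    obtain ⟨h, e⟩ := ih
    refine ⟨h.symm, ?_⟩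
    -- Transport along the reversed equality is the inverse transport by definition.
    change (adapterTermIso H t).inv ≫ _ = _ ≫ (colorCast H h).inv
    rw [Iso.inv_comp_eq, ← Category.assoc, Iso.eq_comp_inv, e]
  | trans t t' ih ih' =>
    obtain ⟨h, e⟩ := ih
    obtain ⟨h', e'⟩ := ih'
    refine ⟨h.trans h', ?_⟩
    change ((adapterTermIso H t).hom ≫ (adapterTermIso H t').hom) ≫ _ = _
    rw [Category.assoc, e', ← Category.assoc, e, Category.assoc, ← colorCast_trans h h']
    rfl
  | plusCongr t t' ih ih' =>
    obtain ⟨h, e⟩ := ih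
    obtain ⟨h', e'⟩ := ih'
    obtain ⟨k, f⟩ := plusJoinIso_naturality (H := H) h h'
    exact ⟨k, @normal_congr H _ (sumMonoidal H) _ _ _ _ _ _ _ _ _ _ _ _ _ _ _ _ _ _ _ _ _ e e' f⟩
  | tensorCongr t t' ih ih' =>
    obtain ⟨h, e⟩ := ih
    obtain ⟨h', e'⟩ := ih'
    obtain ⟨k, f⟩ := tensorJoinIso_naturality (H := H) h h'
    exact ⟨k, normal_congr e e' f⟩
  | plusZero A =>
    exact ⟨plusJoin_zero _, @normal_rightUnitor H _ (sumMonoidal H) _ _ _ _ _ _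
      (plusJoinIso_zero (normal A))⟩
  | zeroPlus A => exact ⟨rfl, @normal_leftUnitor H _ (sumMonoidal H) _ _ (normalIso H A).hom⟩
  | plusAssoc A B C =>
    exact ⟨plusJoin_assoc _ _ _, @normal_associator H _ (sumMonoidal H) _ _ _ _ _ _ _ _ _ _ _ _ _
      _ _ _ _ _ (plusJoinIso_assoc (normal A) (normal B) (normal C))⟩
  | tensorOne A => exact ⟨tensorJoin_one _, normal_rightUnitor (tensorJoinIso_one (normal A))⟩
  | oneTensor A => exact ⟨rfl, normal_leftUnitor⟩
  | tensorAssoc A B C => exact ⟨tensorJoin_assoc _ _ _, normal_associator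
      (tensorJoinIso_assoc (normal A) (normal B) (normal C))⟩

/-- All derivations of a structural equivalence have the same interpretation. -/
theorem adapterTermIso_eq {A B : Color} (t t' : AdapterTerm A B) :
    adapterTermIso H t = adapterTermIso H t' := by
  obtain ⟨_, e⟩ := adapterTermIso_normalIso (H := H) t
  obtain ⟨_, e'⟩ := adapterTermIso_normalIso (H := H) t'
  apply Iso.ext
  -- The two transports coincide because a proposition has only one proof.
  rw [← cancel_mono (normalIso H B).hom, e, e']

/-- Replaces the arbitrary choice in `adapterIso` by whichever derivation suits the computation. -/
theorem adapterIso_eq {A B : Color} (h : Approx A B) (t : AdapterTerm A B) :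
    adapterIso H h = adapterTermIso H t := adapterTermIso_eq _ _

end Coherence

/-! ### The action of scalars -/

section Scalars

variable {R : Type w} [CommSemiring R] {H : Type u} [Category.{v} H] [Limits.HasZeroMorphisms H]
  [Semiadditive H] [MonoidalCategory H] [SymmetricCategory H] [Distributive H]
  (scal : ScalarIso R H)

/-- Scalars are central: naturality of the left unitor together with the exchange law for
whiskering. -/
theorem smul_id_comp (s : R) {X Y : H} (f : X ⟶ Y) :
    scal.smul s (𝟙 X) ≫ f = f ≫ scal.smul s (𝟙 Y) := by
  simp only [ScalarIso.smul, Category.assoc, tensorHom_id]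
  rw [← leftUnitor_naturality, ← whisker_exchange_assoc, ← leftUnitor_inv_naturality_assoc]

theorem smul_zero_id (X : H) : scal.smul 0 (𝟙 X) = 0 := by
  rw [ScalarIso.smul, scal.map_zero, tensorHom_id, zero_whiskerRight', Limits.zero_comp,
    Limits.comp_zero]

theorem smul_one_id (X : H) : scal.smul 1 (𝟙 X) = 𝟙 X := by
  rw [ScalarIso.smul, scal.map_one, id_tensorHom_id, Category.id_comp, Iso.inv_hom_id]

theorem smul_add_id (s t : R) (X : H) :
    scal.smul (s + t) (𝟙 X) = scal.smul s (𝟙 X) + scal.smul t (𝟙 X) := by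
  simp only [ScalarIso.smul, scal.map_add, homAdd_eq_add, tensorHom_id, add_whiskerRight',
    add_comp, comp_add]

theorem smul_comp_smul (s t : R) (X : H) :
    scal.smul s (𝟙 X) ≫ scal.smul t (𝟙 X) = scal.smul (s * t) (𝟙 X) := by
  simp only [ScalarIso.smul, tensorHom_id, scal.map_mul, comp_whiskerRight, Category.assoc,
    Iso.hom_inv_id_assoc]

theorem smul_whiskerRight (s : R) (X Y : H) :
    scal.smul s (𝟙 X) ▷ Y = scal.smul s (𝟙 (X ⊗ Y)) := by
  simp only [ScalarIso.smul, tensorHom_id, comp_whiskerRight]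
  simp

/-- The scalar crosses the other factor through the braiding, since it commutes with every morphism.
-/
theorem whiskerLeft_smul (s : R) (X Y : H) :
    X ◁ scal.smul s (𝟙 Y) = scal.smul s (𝟙 (X ⊗ Y)) := by
  rw [← cancel_epi (β_ Y X).hom, ← BraidedCategory.braiding_naturality_left, smul_whiskerRight,
    smul_id_comp]

theorem smul_tensor_smul (s t : R) (X Y : H) :
    (scal.smul s (𝟙 X) ⊗ₘ scal.smul t (𝟙 Y)) = scal.smul (s * t) (𝟙 (X ⊗ Y)) := by
  rw [MonoidalCategory.tensorHom_def, smul_whiskerRight, whiskerLeft_smul, smul_comp_smul]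

/-- On the unit object the action is multiplication itself, because the two unitors coincide there.
-/
theorem smul_unit (s : R) : scal.smul s (𝟙 (𝟙_ H)) = scal.toEquiv s := by
  rw [ScalarIso.smul, tensorHom_id, unitors_equal, rightUnitor_naturality, ← unitors_equal,
    Iso.inv_hom_id_assoc]

end Scalars

/-! ### Evaluation of composite operations -/

section Operations

variable {H : Type u} [Category.{v} H] [Limits.HasZeroMorphisms H] [Semiadditive H]
  [MonoidalCategory H] [SymmetricCategory H] [Distributive H]

/-- The projection away from the monoidal part. -/
def opX (X Y : H) : parObj X Y ⟶ parObj X Y := opP X Y ≫ opPm X Y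

/-- Splitting a unit off on the right. -/
def opSplitR (X : H) : X ⟶ parObj X (𝟙_ H) := (ρ_ X).inv ≫ opTm X (𝟙_ H)

/-- Splitting a unit off on the left. -/
def opSplitL (X : H) : X ⟶ parObj (𝟙_ H) X := (λ_ X).inv ≫ opTm (𝟙_ H) X

/-- Absorbing a unit on the right. -/
def opMergeR (X : H) : parObj X (𝟙_ H) ⟶ X := opT X (𝟙_ H) ≫ (ρ_ X).hom

/-- Absorbing a unit on the left. -/
def opMergeL (X : H) : parObj (𝟙_ H) X ⟶ X := opT (𝟙_ H) X ≫ (λ_ X).hom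

/-- A morphism applied to the second and third of three factors. -/
def opMid (X : H) {Y Z Y' Z' : H} (f : parObj Y Z ⟶ parObj Y' Z') :
    parObj (parObj X Y) Z ⟶ parObj (parObj X Y') Z' :=
  parAssocHom X Y Z ≫ parMap (𝟙 X) f ≫ parAssocInv X Y' Z'

theorem parT_opX {S T X Y : H} (x : S ⟶ X) (y : T ⟶ Y) : parT x y ≫ opX X Y = 0 := by
  rw [opX, ← Category.assoc, parT_opP, Limits.zero_comp]

theorem parL_opX {S X Y : H} (x : S ⟶ X) : parL Y x ≫ opX X Y = parL Y x := by
  rw [opX, ← Category.assoc, parL_opP, sumL_opPm]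

theorem parR_opX {S X Y : H} (y : S ⟶ Y) : parR X y ≫ opX X Y = parR X y := by
  rw [opX, ← Category.assoc, parR_opP, sumR_opPm]

theorem comp_opSplitR {S X : H} (x : S ⟶ X) :
    x ≫ opSplitR X = pre (ρ_ S).inv (parT x (𝟙 (𝟙_ H))) := by
  rw [opSplitR, ← Category.assoc, comp_rightUnitor_inv, pre_comp, tens_opTm]

theorem comp_opSplitL {S X : H} (x : S ⟶ X) :
    x ≫ opSplitL X = pre (λ_ S).inv (parT (𝟙 (𝟙_ H)) x) := by
  rw [opSplitL, ← Category.assoc, comp_leftUnitor_inv, pre_comp, tens_opTm]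

theorem parT_opMergeR {S X : H} (x : S ⟶ X) :
    parT x (𝟙 (𝟙_ H)) ≫ opMergeR X = pre (ρ_ S).hom x := by
  rw [opMergeR, ← Category.assoc, parT_opT, tens_rightUnitor]

theorem parL_opMergeR {S X : H} (x : S ⟶ X) : parL (𝟙_ H) x ≫ opMergeR X = 0 := by
  rw [opMergeR, ← Category.assoc, parL_opT, Limits.zero_comp]

theorem parR_opMergeR {S X : H} (x : S ⟶ 𝟙_ H) : parR X x ≫ opMergeR X = 0 := by
  rw [opMergeR, ← Category.assoc, parR_opT, Limits.zero_comp]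

theorem parT_opMergeL {S X : H} (x : S ⟶ X) :
    parT (𝟙 (𝟙_ H)) x ≫ opMergeL X = pre (λ_ S).hom x := by
  rw [opMergeL, ← Category.assoc, parT_opT, tens_leftUnitor]

/-- Provides a generic element to evaluate on, so that the rewriting rules have something to act on.
-/
theorem eq_of_id_comp {X Y : H} {f g : X ⟶ Y} (h : 𝟙 X ≫ f = 𝟙 X ≫ g) : f = g := by
  rwa [Category.id_comp, Category.id_comp] at h

theorem sum_ext_right {X Y Z W : H} {f g : (X ⊕' (Y ⊕' Z)) ⟶ W}
    (h₁ : sumL (Y ⊕' Z) (𝟙 X) ≫ f = sumL (Y ⊕' Z) (𝟙 X) ≫ g)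
    (h₂ : sumR X (sumL Z (𝟙 Y)) ≫ f = sumR X (sumL Z (𝟙 Y)) ≫ g)
    (h₃ : sumR X (sumR Y (𝟙 Z)) ≫ f = sumR X (sumR Y (𝟙 Z)) ≫ g) : f = g := by
  refine sum_ext h₁ (sum_ext ?_ ?_)
  · simpa only [← Category.assoc, comp_sumR, Category.comp_id] using h₂
  · simpa only [← Category.assoc, comp_sumR, Category.comp_id] using h₃

/-- The tensor summand is not split further: in the axiom this serves, both sides vanish on it as a
whole. -/
theorem par_sum_ext {X Y W : H} {f g : parObj (X ⊕' Y) (X ⊕' Y) ⟶ W}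
    (hT : parT (𝟙 (X ⊕' Y)) (𝟙 (X ⊕' Y)) ≫ f = parT (𝟙 (X ⊕' Y)) (𝟙 (X ⊕' Y)) ≫ g)
    (hLL : parL (X ⊕' Y) (sumL Y (𝟙 X)) ≫ f = parL (X ⊕' Y) (sumL Y (𝟙 X)) ≫ g)
    (hLR : parL (X ⊕' Y) (sumR X (𝟙 Y)) ≫ f = parL (X ⊕' Y) (sumR X (𝟙 Y)) ≫ g)
    (hRL : parR (X ⊕' Y) (sumL Y (𝟙 X)) ≫ f = parR (X ⊕' Y) (sumL Y (𝟙 X)) ≫ g)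
    (hRR : parR (X ⊕' Y) (sumR X (𝟙 Y)) ≫ f = parR (X ⊕' Y) (sumR X (𝟙 Y)) ≫ g) : f = g := by
  refine par_ext hT (sum_ext ?_ ?_) (sum_ext ?_ ?_)
  · simpa only [← Category.assoc, comp_parL, Category.comp_id] using hLL
  · simpa only [← Category.assoc, comp_parL, Category.comp_id] using hLR
  · simpa only [← Category.assoc, comp_parR, Category.comp_id] using hRL
  · simpa only [← Category.assoc, comp_parR, Category.comp_id] using hRR

theorem sumL_sumAssoc_inv {S X Y Z : H} (x : S ⟶ X) :
    sumL (Y ⊕' Z) x ≫ (sumAssoc X Y Z).inv = sumL Z (sumL Y x) := by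
  simp only [sumAssoc, sumL_desc, comp_inl, comp_sumL]

theorem sumR_sumL_sumAssoc_inv {S X Y Z : H} (y : S ⟶ Y) :
    sumR X (sumL Z y) ≫ (sumAssoc X Y Z).inv = sumL Z (sumR X y) := by
  simp only [sumAssoc, sumL_desc, sumR_desc, comp_inl, comp_inr,
    comp_sumL]

theorem sumR_sumR_sumAssoc_inv {S X Y Z : H} (z : S ⟶ Z) :
    sumR X (sumR Y z) ≫ (sumAssoc X Y Z).inv = sumR (X ⊕' Y) z := by
  simp only [sumAssoc, sumR_desc, comp_inr]

theorem sumL_sumL_sumAssoc_hom {S X Y Z : H} (x : S ⟶ X) :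
    sumL Z (sumL Y x) ≫ (sumAssoc X Y Z).hom = sumL (Y ⊕' Z) x := by
  simp only [sumAssoc, sumL_desc, comp_inl]

theorem sumL_sumR_sumAssoc_hom {S X Y Z : H} (y : S ⟶ Y) :
    sumL Z (sumR X y) ≫ (sumAssoc X Y Z).hom = sumR X (sumL Z y) := by
  simp only [sumAssoc, sumL_desc, sumR_desc, comp_inl, comp_inr,
    comp_sumR]

theorem sumR_sumAssoc_hom {S X Y Z : H} (z : S ⟶ Z) :
    sumR (X ⊕' Y) z ≫ (sumAssoc X Y Z).hom = sumR X (sumR Y z) := by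
  simp only [sumAssoc, sumR_desc, comp_inr, comp_sumR]

end Operations

/-! ### Parallel composition of short lists in terms of operations -/

section SemanticsOfParallel

variable {R : Type w} [CommSemiring R] {H : Type u} [Category.{v} H] [Limits.HasZeroMorphisms H]
  [Semiadditive H] [MonoidalCategory H] [SymmetricCategory H] [Distributive H]
  {scal : ScalarIso R H}

theorem inverse_unique {C : Type u} [Category.{v} C] {P W : C} {s : P ⟶ W} {t a : W ⟶ P}
    (ht : t ≫ s = 𝟙 W) (ha : s ≫ a = 𝟙 P) : a = t := by
  rw [← Category.id_comp a, ← ht, Category.assoc, ha, Category.comp_id]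

theorem appendInv_single (X : Wires) (B : Color) :
    appendInv H X (w₁ B) = snocInv H X B := by
  have h := (append_inverse (H := H) X (w₁ B)).1
  rw [appendHom_single] at h
  exact inverse_unique (snocInv_snocHom (H := H) X B) h

theorem double_aux {X Y Z : H} {f : parObj X (parObj Y Z) ⟶ parObj (parObj X Y) Z} :
    parMap (𝟙 X) (𝟙 (parObj Y Z)) ≫ f ≫ parMap (𝟙 (parObj X Y)) (𝟙 Z) ≫
      𝟙 (parObj (parObj X Y) Z) = f := by
  rw [parMap_id, parMap_id, Category.id_comp, Category.comp_id, Category.comp_id]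

theorem double_aux' {X Y Z : H} {f : parObj (parObj X Y) Z ⟶ parObj X (parObj Y Z)} :
    𝟙 (parObj (parObj X Y) Z) ≫ parMap (𝟙 (parObj X Y)) (𝟙 Z) ≫ f ≫
      parMap (𝟙 X) (𝟙 (parObj Y Z)) = f := by
  rw [parMap_id, parMap_id, Category.id_comp, Category.id_comp, Category.comp_id]

/-- For two wires after a nonempty list, the structural isomorphism is the associator alone. The
lemmas `sem_par_...` below combine this with the cases of one wire and of the empty list. -/
theorem appendHom_double (X : Wires) (A B C : Color) :
    appendHom H (X.snoc A) (w₂ B C)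
      = parAssocInv (wiresObj H (X.snoc A)) (colorObj H B) (colorObj H C) := by
  have h : appendHom H (X.snoc A) (w₁ B) = 𝟙 (parObj (wiresObj H (X.snoc A)) (colorObj H B)) :=
    appendHom_single _ _
  rw [appendHom, h]
  exact double_aux

theorem appendInv_double (X : Wires) (A B C : Color) :
    appendInv H (X.snoc A) (w₂ B C)
      = parAssocHom (wiresObj H (X.snoc A)) (colorObj H B) (colorObj H C) := by
  have h : appendInv H (X.snoc A) (w₁ B) = 𝟙 (parObj (wiresObj H (X.snoc A)) (colorObj H B)) :=
    appendInv_single _ _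
  rw [appendInv, h]
  exact double_aux'

theorem sem_comp_eq {X Y Z : Wires} {d : FDiag R X Y} {e : FDiag R Y Z}
    {f : wiresObj H X ⟶ wiresObj H Y} {g : wiresObj H Y ⟶ wiresObj H Z}
    (hd : sem scal d = f) (he : sem scal e = g) : sem scal (d ⨾ e) = f ≫ g := by
  subst hd he; rfl

theorem sem_par_eq {X Y X' Y' : Wires} {d : FDiag R X Y} {e : FDiag R X' Y'}
    {f : wiresObj H X ⟶ wiresObj H Y} {g : wiresObj H X' ⟶ wiresObj H Y'}
    {p : wiresObj H (X.append X') ⟶ parObj (wiresObj H X) (wiresObj H X')}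
    {q : parObj (wiresObj H Y) (wiresObj H Y') ⟶ wiresObj H (Y.append Y')}
    (hp : appendInv H X X' = p) (hq : appendHom H Y Y' = q)
    (hd : sem scal d = f) (he : sem scal e = g) :
    sem scal (d ⫽ e) = p ≫ parMap f g ≫ q := by
  subst hd he hp hq; rfl

theorem sem_par_single_single {X Y : Wires} {A B A' B' : Color}
    {d : FDiag R (X.snoc A) (Y.snoc B)} {e : FDiag R (w₁ A') (w₁ B')}
    {f : wiresObj H (X.snoc A) ⟶ wiresObj H (Y.snoc B)} {g : colorObj H A' ⟶ colorObj H B'}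
    (hd : sem scal d = f) (he : sem scal e = g) : sem scal (d ⫽ e) = parMap f g :=
  (sem_par_eq (appendInv_single _ _) (appendHom_single _ _) hd he).trans
    ((Category.id_comp _).trans (Category.comp_id _))

theorem sem_par_single_double {X Y : Wires} {A B A' B' C' : Color}
    {d : FDiag R (X.snoc A) (Y.snoc B)} {e : FDiag R (w₁ A') (w₂ B' C')}
    {f : wiresObj H (X.snoc A) ⟶ wiresObj H (Y.snoc B)}
    {g : colorObj H A' ⟶ parObj (colorObj H B') (colorObj H C')}
    (hd : sem scal d = f) (he : sem scal e = g) :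
    sem scal (d ⫽ e) = parMap f g ≫ parAssocInv (wiresObj H (Y.snoc B)) _ _ :=
  (sem_par_eq (appendInv_single _ _) (appendHom_double _ _ _ _) hd he).trans
    (Category.id_comp _)

theorem sem_par_double_single {X Y : Wires} {A B A' B' C' : Color}
    {d : FDiag R (X.snoc A) (Y.snoc B)} {e : FDiag R (w₂ B' C') (w₁ A')}
    {f : wiresObj H (X.snoc A) ⟶ wiresObj H (Y.snoc B)}
    {g : parObj (colorObj H B') (colorObj H C') ⟶ colorObj H A'}
    (hd : sem scal d = f) (he : sem scal e = g) :
    sem scal (d ⫽ e) = parAssocHom (wiresObj H (X.snoc A)) _ _ ≫ parMap f g :=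
  (sem_par_eq (appendInv_double _ _ _ _) (appendHom_single _ _) hd he).trans
    (congrArg (_ ≫ ·) (Category.comp_id _))

theorem sem_par_double_double {X Y : Wires} {A B A' D' B' C' : Color}
    {d : FDiag R (X.snoc A) (Y.snoc B)} {e : FDiag R (w₂ A' D') (w₂ B' C')}
    {f : wiresObj H (X.snoc A) ⟶ wiresObj H (Y.snoc B)}
    {g : parObj (colorObj H A') (colorObj H D') ⟶ parObj (colorObj H B') (colorObj H C')}
    (hd : sem scal d = f) (he : sem scal e = g) :
    sem scal (d ⫽ e) = parAssocHom (wiresObj H (X.snoc A)) _ _ ≫ parMap f g ≫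
      parAssocInv (wiresObj H (Y.snoc B)) _ _ :=
  sem_par_eq (appendInv_double _ _ _ _) (appendHom_double _ _ _ _) hd he

theorem sem_par_nil_single {X Y : Wires} {A B B' : Color}
    {d : FDiag R (X.snoc A) (Y.snoc B)} {e : FDiag R .nil (w₁ B')}
    {f : wiresObj H (X.snoc A) ⟶ wiresObj H (Y.snoc B)}
    {g : Semiadditive.zeroObj ⟶ colorObj H B'}
    (hd : sem scal d = f) (he : sem scal e = g) :
    sem scal (d ⫽ e) = parRightInv (wiresObj H (X.snoc A)) ≫ parMap f g :=
  (sem_par_eq rfl (appendHom_single _ _) hd he).trans (congrArg (_ ≫ ·) (Category.comp_id _))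

theorem sem_par_single_nil {X Y : Wires} {A B B' : Color}
    {d : FDiag R (X.snoc A) (Y.snoc B)} {e : FDiag R (w₁ B') .nil}
    {f : wiresObj H (X.snoc A) ⟶ wiresObj H (Y.snoc B)}
    {g : colorObj H B' ⟶ Semiadditive.zeroObj}
    (hd : sem scal d = f) (he : sem scal e = g) :
    sem scal (d ⫽ e) = parMap f g ≫ parRightHom (wiresObj H (Y.snoc B)) :=
  (sem_par_eq (appendInv_single _ _) rfl hd he).trans (Category.id_comp _)

theorem sem_nil_par_single {Y : Wires} {B A' B' : Color}
    {d : FDiag R .nil (Y.snoc B)} {e : FDiag R (w₁ A') (w₁ B')}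
    {f : Semiadditive.zeroObj ⟶ wiresObj H (Y.snoc B)} {g : colorObj H A' ⟶ colorObj H B'}
    (hd : sem scal d = f) (he : sem scal e = g) :
    sem scal (d ⫽ e) = parLeftInv (colorObj H A') ≫ parMap f g :=
  (sem_par_eq (appendInv_single _ _) (appendHom_single _ _) hd he).trans
    (congrArg (_ ≫ ·) (Category.comp_id _))

theorem sem_single_par_nil {Y : Wires} {B A' B' : Color}
    {d : FDiag R (Y.snoc B) .nil} {e : FDiag R (w₁ A') (w₁ B')}
    {f : wiresObj H (Y.snoc B) ⟶ Semiadditive.zeroObj} {g : colorObj H A' ⟶ colorObj H B'}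
    (hd : sem scal d = f) (he : sem scal e = g) :
    sem scal (d ⫽ e) = parMap f g ≫ parLeftHom (colorObj H B') :=
  (sem_par_eq (appendInv_single _ _) (appendHom_single _ _) hd he).trans (Category.id_comp _)

end SemanticsOfParallel

/-! ### The functional axioms and their mirrors as identities between operations -/

section AxiomsOnOperations

variable {H : Type u} [Category.{v} H] [Limits.HasZeroMorphisms H] [Semiadditive H]
  [MonoidalCategory H] [SymmetricCategory H] [Distributive H]

theorem op_swap_contr (a : H) :
    parSwap a a ≫ opK a
      = opK a := by
  apply par_ext <;> simp only [← Category.assoc, pre_comp, pre_zero, parT_opK, parL_opK, parR_opK,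
    parT_parSwap, parL_parSwap, parR_parSwap]

theorem op_contrM_swap (a : H) :
    opKm a ≫ parSwap a a
      = opKm a := by
  apply eq_of_id_comp
  simp only [← Category.assoc, add_comp, comp_opKm, parL_parSwap, parR_parSwap]
  rw [add_comm]

theorem op_zigzag (a b c : H) :
    parMap (opTm a b) (𝟙 c) ≫ parAssocHom a b c ≫ parMap (𝟙 a) (opT b c)
      = (opT (a ⊗ b) c ≫ (α_ a b c).hom) ≫ opTm a (b ⊗ c) := by
  apply par_ext <;> (try simp only [← tens_id]) <;> simp only [← Category.assoc, Category.comp_id,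
    Limits.zero_comp, pre_comp, parR_zero, parT_zero_right, parT_opT, parL_opT, parR_opT,
    tens_opTm, parT_parMap, parL_parMap, parR_parMap, tens_associator, parT_parT_parAssocHom,
    parL_parT_parAssocHom, parR_parAssocHom]

theorem op_zigzagM (a b c : H) :
    (parMap (𝟙 a) (opTm b c) ≫ parAssocInv a b c) ≫ parMap (opT a b) (𝟙 c)
      = opT a (b ⊗ c) ≫ (α_ a b c).inv ≫ opTm (a ⊗ b) c := by
  apply par_ext <;> (try simp only [← tens_id]) <;> simp only [← Category.assoc, Category.comp_id,
    Limits.zero_comp, pre_comp, parL_zero, parT_zero_left, parT_opT, parL_opT, parR_opT,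
    tens_opTm, parT_parMap, parL_parMap, parR_parMap, tens_associator_inv, parT_parT_parAssocInv,
    parL_parAssocInv, parR_parT_parAssocInv]

/-- Splitting marks every wire that is present by a unit. On the summand a ⊗ b both units are
present and the middle operation kills their tensor; on the other summands only one unit is present,
and it passes. -/
theorem op_plus_unit (a b : H) :
    opX a b
      = ((parMap (opSplitR a) (opSplitL b) ≫ parAssocInv (parObj a (𝟙_ H)) (𝟙_ H) b) ≫
        parMap (opMid a (opX (𝟙_ H) (𝟙_ H))) (𝟙 b)) ≫ (parAssocHom (parObj a (𝟙_ H)) (𝟙_ H) b ≫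
        parMap (opMergeR a) (opMergeL b)) := by
  apply par_ext <;> simp only [← Category.assoc, Category.comp_id, Limits.zero_comp, pre_comp,
    pre_pre, pre_zero, parL_pre, parR_pre, parT_pre_left, parT_pre_right, parT_zero_left,
    parT_zero_right, parT_opX, parL_opX, parR_opX, comp_opSplitR, comp_opSplitL, parT_opMergeR,
    parT_opMergeL, parT_parMap, parL_parMap, parR_parMap, parT_parT_parAssocHom,
    parT_parR_parAssocHom, parL_parT_parAssocHom, parL_parL_parAssocHom, parR_parAssocHom,
    parT_parT_parAssocInv, parT_parL_parAssocInv, parL_parAssocInv, parR_parT_parAssocInv,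
    parR_parR_parAssocInv, opMid, pre_id, Iso.inv_hom_id]

/-- The axiom is its own mirror except for the bracketing of composites, which is the only
difference from `op_plus_unit`. -/
theorem op_plus_unitM (a b : H) :
    opX a b
      = (parMap (opSplitR a) (opSplitL b) ≫ parAssocInv (parObj a (𝟙_ H)) (𝟙_ H) b) ≫
        parMap (opMid a (opX (𝟙_ H) (𝟙_ H))) (𝟙 b) ≫ (parAssocHom (parObj a (𝟙_ H)) (𝟙_ H) b ≫
        parMap (opMergeR a) (opMergeL b)) := by
  apply par_ext <;> simp only [← Category.assoc, Category.comp_id, Limits.zero_comp, pre_comp,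
    pre_pre, pre_zero, parL_pre, parR_pre, parT_pre_left, parT_pre_right, parT_zero_left,
    parT_zero_right, parT_opX, parL_opX, parR_opX, comp_opSplitR, comp_opSplitL, parT_opMergeR,
    parT_opMergeL, parT_parMap, parL_parMap, parR_parMap, parT_parT_parAssocHom,
    parT_parR_parAssocHom, parL_parT_parAssocHom, parL_parL_parAssocHom, parR_parAssocHom,
    parT_parT_parAssocInv, parT_parL_parAssocInv, parL_parAssocInv, parR_parT_parAssocInv,
    parR_parR_parAssocInv, opMid, pre_id, Iso.inv_hom_id]

/-- Each wire present brings a unit along. One unit survives the contraction and is absorbed again;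
both together are killed, as is their tensor a ⊗ b. -/
theorem op_plus_contr (a b : H) :
    opP a b
      = (((parMap (opSplitR a) (opSplitR b) ≫ parAssocInv (parObj a (𝟙_ H)) b (𝟙_ H)) ≫
        parMap (opMid a (parSwap (𝟙_ H) b)) (𝟙 (𝟙_ H))) ≫
        (parAssocHom (parObj a b) (𝟙_ H) (𝟙_ H) ≫ parMap (opP a b) (opK (𝟙_ H)))) ≫
        opMergeR (a ⊕' b) := by
  apply par_ext <;> simp only [← Category.assoc, Category.comp_id, Limits.zero_comp, pre_comp,
    pre_pre, pre_zero, parL_pre, parR_pre, parT_pre_left, parT_pre_right, parT_zero_right,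
    parT_opP, parL_opP, parR_opP, parT_opK, parL_opK, parR_opK, comp_opSplitR, parT_opMergeR,
    parT_parMap, parL_parMap, parR_parMap, parT_parSwap, parL_parSwap, parR_parSwap,
    parT_parT_parAssocHom, parT_parL_parAssocHom, parL_parT_parAssocHom, parR_parAssocHom,
    parT_parT_parAssocInv, parT_parR_parAssocInv, parL_parAssocInv, parR_parT_parAssocInv,
    parR_parL_parAssocInv, opMid, pre_id, Iso.inv_hom_id]

theorem op_plus_contrM (a b : H) :
    opPm a b
      = opSplitR (a ⊕' b) ≫ (parMap (opPm a b) (opKm (𝟙_ H)) ≫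
        parAssocInv (parObj a b) (𝟙_ H) (𝟙_ H)) ≫
        parMap (opMid a (parSwap b (𝟙_ H))) (𝟙 (𝟙_ H)) ≫
        (parAssocHom (parObj a (𝟙_ H)) b (𝟙_ H) ≫ parMap (opMergeR a) (opMergeR b)) := by
  apply sum_ext <;> simp only [← Category.assoc, Category.comp_id, pre_comp, pre_pre, pre_add,
    pre_zero, parL_pre, parR_pre, parT_add_right, parT_zero_right, add_comp, add_zero, zero_add,
    sumL_opPm, sumR_opPm, comp_opKm, comp_opSplitR, parT_opMergeR, parL_opMergeR, parR_opMergeR,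
    parT_parMap, parL_parMap, parR_parMap, parT_parSwap, parL_parSwap, parR_parSwap,
    parT_parL_parAssocHom, parT_parR_parAssocHom, parL_parT_parAssocHom, parL_parL_parAssocHom,
    parL_parR_parAssocHom, parT_parL_parAssocInv, parT_parR_parAssocInv, parL_parAssocInv,
    parR_parT_parAssocInv, parR_parR_parAssocInv, opMid, pre_id, Iso.inv_hom_id]

/-- Both wires are copied. The first copies pass only as a tensor, the second copies only one at a
time. On a ⊗ b, of the four choices of copies, only the two first copies survive; on a or b alone,
only the second copy survives. -/
theorem op_mix (a b : H) :
    parMap (𝟙 a) (𝟙 b)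
      = ((((parMap (opKm a) (opKm b) ≫ parAssocInv (parObj a a) b b) ≫
        parMap (opMid a (parSwap a b)) (𝟙 b)) ≫ (parAssocHom (parObj a b) a b ≫ parMap (opT a b ≫
        opTm a b) (opX a b) ≫ parAssocInv (parObj a b) a b)) ≫
        parMap (opMid a (parSwap b a)) (𝟙 b)) ≫ (parAssocHom (parObj a a) b b ≫
        parMap (opK a) (opK b)) := by
  apply par_ext <;> simp only [← Category.assoc, Category.comp_id, Limits.zero_comp, pre_comp,
    pre_zero, parL_pre, parR_pre, parL_add, parR_add, parL_zero, parR_zero, parT_add_left,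
    parT_add_right, parT_zero_left, add_comp, add_zero, zero_add, parT_opT, parL_opT, parR_opT,
    tens_opTm, parL_opK, parR_opK, comp_opKm, parT_opX, parL_opX, parR_opX, parT_parMap,
    parL_parMap, parR_parMap, parT_parSwap, parL_parSwap, parR_parSwap, parT_parL_parAssocHom,
    parT_parR_parAssocHom, parL_parT_parAssocHom, parL_parL_parAssocHom, parL_parR_parAssocHom,
    parR_parAssocHom, parT_parL_parAssocInv, parT_parR_parAssocInv, parL_parAssocInv,
    parR_parT_parAssocInv, parR_parL_parAssocInv, parR_parR_parAssocInv, opMid]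

theorem op_mixM (a b : H) :
    parMap (𝟙 a) (𝟙 b)
      = (parMap (opKm a) (opKm b) ≫ parAssocInv (parObj a a) b b) ≫
        parMap (opMid a (parSwap a b)) (𝟙 b) ≫ (parAssocHom (parObj a b) a b ≫ parMap (opT a b ≫
        opTm a b) (opX a b) ≫ parAssocInv (parObj a b) a b) ≫
        parMap (opMid a (parSwap b a)) (𝟙 b) ≫ (parAssocHom (parObj a a) b b ≫
        parMap (opK a) (opK b)) := by
  apply par_ext <;> simp only [← Category.assoc, Category.comp_id, Limits.zero_comp, pre_comp,
    pre_zero, parL_pre, parR_pre, parL_add, parR_add, parL_zero, parR_zero, parT_add_left,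
    parT_add_right, parT_zero_left, add_comp, add_zero, zero_add, parT_opT, parL_opT, parR_opT,
    tens_opTm, parL_opK, parR_opK, comp_opKm, parT_opX, parL_opX, parR_opX, parT_parMap,
    parL_parMap, parR_parMap, parT_parSwap, parL_parSwap, parR_parSwap, parT_parL_parAssocHom,
    parT_parR_parAssocHom, parL_parT_parAssocHom, parL_parL_parAssocHom, parL_parR_parAssocHom,
    parR_parAssocHom, parT_parL_parAssocInv, parT_parR_parAssocInv, parL_parAssocInv,
    parR_parT_parAssocInv, parR_parL_parAssocInv, parR_parR_parAssocInv, opMid]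

theorem op_contr_null (a : H) :
    (parRightInv a ≫ parMap (𝟙 a) (0 : (Semiadditive.zeroObj : H) ⟶ a)) ≫ opK a
      = 𝟙 a := by
  apply eq_of_id_comp
  simp only [← Category.assoc, Category.comp_id, comp_parRightInv, parL_opK, parL_parMap]

theorem op_contr_nullM (a : H) :
    opKm a ≫ parMap (𝟙 a) (0 : a ⟶ (Semiadditive.zeroObj : H)) ≫ parRightHom a
      = 𝟙 a := by
  apply eq_of_id_comp
  simp only [← Category.assoc, Category.comp_id, Limits.comp_zero, parR_zero, add_comp, add_zero,
    parL_parRightHom, comp_opKm, parL_parMap, parR_parMap]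

theorem op_contr_tensorM (a b : H) :
    opK (a ⊗ b) ≫ opTm a b
      = ((parMap (opTm a b) (opTm a b) ≫ parAssocInv (parObj a b) a b) ≫
        parMap (opMid a (parSwap b a)) (𝟙 b)) ≫ (parAssocHom (parObj a a) b b ≫
        parMap (opK a) (opK b)) := by
  apply par_ext <;> (try simp only [← tens_id]) <;> simp only [← Category.assoc, Category.comp_id,
    Limits.zero_comp, pre_comp, pre_pre, pre_zero, parT_pre_left, parT_pre_right, parT_zero_right,
    tens_opTm, parT_opK, parL_opK, parR_opK, parT_parMap, parL_parMap, parR_parMap, parT_parSwap,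
    parL_parSwap, parR_parSwap, parT_parT_parAssocHom, parT_parL_parAssocHom,
    parL_parT_parAssocHom, parR_parAssocHom, parT_parT_parAssocInv, parT_parR_parAssocInv,
    parL_parAssocInv, parR_parT_parAssocInv, parR_parL_parAssocInv, opMid]

theorem op_contr_tensorMM (a b : H) :
    opT a b ≫ opKm (a ⊗ b)
      = (parMap (opKm a) (opKm b) ≫ parAssocInv (parObj a a) b b) ≫
        parMap (opMid a (parSwap a b)) (𝟙 b) ≫ parAssocHom (parObj a b) a b ≫
        parMap (opT a b) (opT a b) := by
  apply par_ext <;> simp only [← Category.assoc, Category.comp_id,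
    pre_comp, pre_zero, parL_pre, parR_pre, parL_add, parR_add, parL_zero, parR_zero,
    parT_add_left, parT_add_right, parT_zero_right, add_comp, comp_add, add_zero, zero_add,
    comp_parL, comp_parR, parT_opT, parL_opT, parR_opT, comp_opKm, parT_parMap, parL_parMap,
    parR_parMap, parT_parSwap, parL_parSwap, parR_parSwap, parT_parL_parAssocHom,
    parT_parR_parAssocHom, parL_parT_parAssocHom, parL_parL_parAssocHom, parL_parR_parAssocHom,
    parR_parAssocHom, parT_parL_parAssocInv, parT_parR_parAssocInv, parL_parAssocInv,
    parR_parT_parAssocInv, parR_parL_parAssocInv, parR_parR_parAssocInv, opMid]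

theorem op_contr_tensor (a b : H) :
    parMap (opK a) (𝟙 b) ≫ opT a b
      = (((parMap (parMap (𝟙 a) (𝟙 a)) (opKm b) ≫ parAssocInv (parObj a a) b b) ≫
        parMap (opMid a (parSwap a b)) (𝟙 b)) ≫ parAssocHom (parObj a b) a b ≫
        parMap (opT a b) (opT a b)) ≫ opK (a ⊗ b) := by
  apply par_ext_left <;> simp only [← Category.assoc, Category.comp_id, Limits.zero_comp,
    pre_comp, pre_pre, pre_zero, parL_pre, parR_pre, parT_pre_right, parR_add, parL_zero,
    parR_zero, parT_add_right, parT_zero_left, parT_zero_right, add_comp, add_zero, zero_add,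
    parT_opT, parL_opT, parR_opT, parT_opK, parL_opK, parR_opK, comp_opKm, parT_parMap,
    parL_parMap, parR_parMap, parT_parSwap, parL_parSwap, parR_parSwap, parT_parT_parAssocHom,
    parT_parL_parAssocHom, parT_parR_parAssocHom, parL_parT_parAssocHom, parL_parL_parAssocHom,
    parL_parR_parAssocHom, parR_parAssocHom, parT_parT_parAssocInv, parT_parL_parAssocInv,
    parT_parR_parAssocInv, parL_parAssocInv, parR_parT_parAssocInv, parR_parL_parAssocInv,
    parR_parR_parAssocInv, opMid]

theorem op_contr_tensorT (a b : H) :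
    opTm a b ≫ parMap (opKm a) (𝟙 b)
      = opKm (a ⊗ b) ≫ (parMap (opTm a b) (opTm a b) ≫ parAssocInv (parObj a b) a b) ≫
        parMap (opMid a (parSwap b a)) (𝟙 b) ≫ parAssocHom (parObj a a) b b ≫
        parMap (parMap (𝟙 a) (𝟙 a)) (opK b) := by
  apply eq_of_id_comp
  simp only [← tens_id]
  simp only [← Category.assoc, Category.comp_id, parT_add_left, add_comp, tens_opTm, parL_opK,
    parR_opK, comp_opKm, parT_parMap, parL_parMap, parR_parMap, parL_parSwap, parR_parSwap,
    parT_parL_parAssocHom, parL_parT_parAssocHom, parR_parAssocHom, parT_parR_parAssocInv,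
    parL_parAssocInv, parR_parT_parAssocInv, parR_parL_parAssocInv, opMid]

/-- Contraction and the removal of the tensor part both vanish where two elements of a ⊕ b are
present; on a single one, the claim is a relabelling of injections. -/
theorem op_contr_plusM (a b : H) :
    opK (a ⊕' b) ≫ opPm a b
      = ((opX (a ⊕' b) (a ⊕' b) ≫ (parMap (opPm a b) (opPm a b) ≫
        parAssocInv (parObj a b) a b)) ≫ parMap (opMid a (parSwap b a)) (𝟙 b)) ≫
        (parAssocHom (parObj a a) b b ≫ parMap (opK a) (opK b)) := by
  apply par_sum_ext <;> simp only [← Category.assoc, Category.comp_id, Limits.zero_comp,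
    sumL_opPm, sumR_opPm, parT_opK, parL_opK, parR_opK, parT_opX, parL_opX, parR_opX, parL_parMap,
    parR_parMap, parL_parSwap, parR_parSwap, parL_parL_parAssocHom, parL_parR_parAssocHom,
    parR_parAssocHom, parL_parAssocInv, parR_parL_parAssocInv, parR_parR_parAssocInv, opMid]

theorem op_contr_plusMM (a b : H) :
    opP a b ≫ opKm (a ⊕' b)
      = (parMap (opKm a) (opKm b) ≫ parAssocInv (parObj a a) b b) ≫
        parMap (opMid a (parSwap a b)) (𝟙 b) ≫ (parAssocHom (parObj a b) a b ≫
        parMap (opP a b) (opP a b)) ≫ opX (a ⊕' b) (a ⊕' b) := by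
  apply par_ext <;> simp only [← Category.assoc, Category.comp_id, pre_comp, pre_zero, parL_pre,
    parR_pre, parL_add, parR_add, parL_zero, parR_zero, parT_add_left, parT_add_right, add_comp,
    comp_add, add_zero, zero_add, comp_parL, comp_parR, parT_opP, parL_opP, parR_opP, comp_opKm,
    parT_opX, parL_opX, parR_opX, parT_parMap, parL_parMap, parR_parMap, parT_parSwap,
    parL_parSwap, parR_parSwap, parT_parL_parAssocHom, parT_parR_parAssocHom,
    parL_parT_parAssocHom, parL_parL_parAssocHom, parL_parR_parAssocHom, parR_parAssocHom,
    parT_parL_parAssocInv, parT_parR_parAssocInv, parL_parAssocInv, parR_parT_parAssocInv,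
    parR_parL_parAssocInv, parR_parR_parAssocInv, opMid]

/-- Contraction already kills the summands in which both copies of a occur, so the tensors still to
be removed are those of one copy with b. The right-hand side removes them one copy at a time. -/
theorem op_contr_opX (a b : H) :
    parMap (opK a) (𝟙 b) ≫ opX a b
      = (((opMid a (opX a b) ≫ opMid a (parSwap a b)) ≫ parMap (opX a b) (𝟙 a)) ≫
        opMid a (parSwap b a)) ≫ parMap (opK a) (𝟙 b) := by
  apply par_ext_left <;> simp only [← Category.assoc, Category.comp_id, Limits.zero_comp,
    pre_comp, pre_zero, parL_zero, parR_zero, parT_zero_left, parT_zero_right, parT_opK, parL_opK,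
    parR_opK, parT_opX, parL_opX, parR_opX, parT_parMap, parL_parMap, parR_parMap, parL_parSwap,
    parR_parSwap, parT_parT_parAssocHom, parT_parL_parAssocHom, parT_parR_parAssocHom,
    parL_parT_parAssocHom, parL_parL_parAssocHom, parL_parR_parAssocHom, parR_parAssocHom,
    parT_parL_parAssocInv, parT_parR_parAssocInv, parL_parAssocInv, parR_parL_parAssocInv,
    parR_parR_parAssocInv, opMid]

theorem op_opX_contrM (a b : H) :
    opX a b ≫ parMap (opKm a) (𝟙 b)
      = parMap (opKm a) (𝟙 b) ≫ opMid a (parSwap a b) ≫ parMap (opX a b) (𝟙 a) ≫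
        opMid a (parSwap b a) ≫ opMid a (opX a b) := by
  apply par_ext <;> simp only [← Category.assoc, Category.comp_id, Limits.zero_comp, pre_comp,
    pre_pre, pre_zero, parR_pre, parL_add, parL_zero, parR_zero, parT_add_left, add_comp,
    zero_add, comp_opKm, parT_opX, parL_opX, parR_opX, parT_parMap, parL_parMap, parR_parMap,
    parT_parSwap, parL_parSwap, parR_parSwap, parT_parL_parAssocHom, parT_parR_parAssocHom,
    parL_parL_parAssocHom, parL_parR_parAssocHom, parR_parAssocHom, parT_parL_parAssocInv,
    parL_parAssocInv, parR_parT_parAssocInv, parR_parL_parAssocInv, parR_parR_parAssocInv, opMid]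

theorem op_contr_contrM (a : H) :
    opK a ≫ opKm a
      = ((opX a a ≫ (parMap (opKm a) (opKm a) ≫ parAssocInv (parObj a a) a a)) ≫
        parMap (opMid a (parSwap a a)) (𝟙 a)) ≫ (parAssocHom (parObj a a) a a ≫
        parMap (opK a) (opK a)) := by
  apply par_ext <;> simp only [← Category.assoc, Category.comp_id, Limits.zero_comp, parL_add,
    parR_add, parL_zero, parR_zero, add_comp, comp_add, add_zero, comp_parL, comp_parR, parT_opK,
    parL_opK, parR_opK, comp_opKm, parT_opX, parL_opX, parR_opX, parL_parMap, parR_parMap,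
    parL_parSwap, parR_parSwap, parL_parL_parAssocHom, parL_parR_parAssocHom, parR_parAssocHom,
    parL_parAssocInv, parR_parL_parAssocInv, parR_parR_parAssocInv, opMid]

theorem op_contr_contrMM (a : H) :
    opK a ≫ opKm a
      = (parMap (opKm a) (opKm a) ≫ parAssocInv (parObj a a) a a) ≫
        parMap (opMid a (parSwap a a)) (𝟙 a) ≫ (parAssocHom (parObj a a) a a ≫
        parMap (opK a) (opK a)) ≫ opX a a := by
  apply par_ext <;> simp only [← Category.assoc, Category.comp_id, pre_comp, pre_zero, parL_pre,
    parR_pre, parL_add, parR_add, parL_zero, parR_zero, parT_add_left, parT_add_right, add_comp,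
    comp_add, add_zero, zero_add, comp_parL, comp_parR, parT_opK, parL_opK, parR_opK, comp_opKm,
    parT_opX, parL_opX, parR_opX, parT_parMap, parL_parMap, parR_parMap, parT_parSwap,
    parL_parSwap, parR_parSwap, parT_parL_parAssocHom, parT_parR_parAssocHom,
    parL_parT_parAssocHom, parL_parL_parAssocHom, parL_parR_parAssocHom, parR_parAssocHom,
    parT_parL_parAssocInv, parT_parR_parAssocInv, parL_parAssocInv, parR_parT_parAssocInv,
    parR_parL_parAssocInv, parR_parR_parAssocInv, opMid]

theorem op_contr_assoc (a : H) :
    parMap (opK a) (𝟙 a) ≫ opK a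
      = (parAssocHom a a a ≫ parMap (𝟙 a) (opK a)) ≫ opK a := by
  apply par_ext_left <;> simp only [← Category.assoc, Category.comp_id, Limits.zero_comp,
    pre_comp, pre_zero, parL_zero, parR_zero, parT_zero_left, parT_zero_right, parT_opK, parL_opK,
    parR_opK, parT_parMap, parL_parMap, parR_parMap, parT_parT_parAssocHom, parT_parL_parAssocHom,
    parT_parR_parAssocHom, parL_parT_parAssocHom, parL_parL_parAssocHom, parL_parR_parAssocHom,
    parR_parAssocHom]

theorem op_contr_assocM (a : H) :
    opKm a ≫ parMap (opKm a) (𝟙 a)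
      = opKm a ≫ parMap (𝟙 a) (opKm a) ≫ parAssocInv a a a := by
  apply eq_of_id_comp
  simp only [← Category.assoc, Category.comp_id, parL_add, parR_add, add_comp, comp_opKm,
    parL_parMap, parR_parMap, parL_parAssocInv, parR_parL_parAssocInv, parR_parR_parAssocInv]
  simp only [add_assoc]

/-- Contraction is natural in every morphism, which covers the axioms for scalars and for adapters
alike. -/
theorem op_contr_natural {a b : H} (f : a ⟶ b) :
    parMap f f ≫ opK b
      = opK a ≫ f := by
  apply par_ext <;> simp only [← Category.assoc, Category.id_comp, Limits.zero_comp, parT_opK,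
    parL_opK, parR_opK, parT_parMap, parL_parMap, parR_parMap]

theorem op_contrM_natural {a b : H} (f : a ⟶ b) :
    opKm a ≫ parMap f f
      = f ≫ opKm b := by
  apply eq_of_id_comp
  simp only [← Category.assoc, Category.id_comp, add_comp, comp_add, comp_parL, comp_parR,
    comp_opKm, parL_parMap, parR_parMap]

theorem op_tensor_assocM (a b c : H) :
    opTm a (b ⊗ c) ≫ parMap (𝟙 a) (opTm b c) ≫ parAssocInv a b c
      = ((α_ a b c).inv ≫ opTm (a ⊗ b) c) ≫ parMap (opTm a b) (𝟙 c) := by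
  apply eq_of_id_comp
  simp only [← tens_id]
  simp only [← Category.assoc, Category.comp_id, pre_comp, tens_opTm, parT_parMap,
    tens_associator_inv, parT_parT_parAssocInv]

theorem op_tensor_assoc (a b c : H) :
    (parAssocHom a b c ≫ parMap (𝟙 a) (opT b c)) ≫ opT a (b ⊗ c)
      = parMap (opT a b) (𝟙 c) ≫ opT (a ⊗ b) c ≫ (α_ a b c).hom := by
  apply par_ext_left <;> simp only [← Category.assoc, Category.comp_id, Limits.zero_comp,
    pre_comp, parL_zero, parR_zero, parT_zero_left, parT_zero_right, parT_opT, parL_opT, parR_opT,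
    parT_parMap, parL_parMap, parR_parMap, tens_associator, parT_parT_parAssocHom,
    parT_parL_parAssocHom, parT_parR_parAssocHom, parL_parT_parAssocHom, parL_parL_parAssocHom,
    parL_parR_parAssocHom, parR_parAssocHom]

theorem op_plus_assocM (a b c : H) :
    opPm a (b ⊕' c) ≫ parMap (𝟙 a) (opPm b c) ≫ parAssocInv a b c
      = ((sumAssoc a b c).inv ≫ opPm (a ⊕' b) c) ≫ parMap (opPm a b) (𝟙 c) := by
  apply sum_ext_right <;> simp only [← Category.assoc, Category.comp_id, sumL_opPm, sumR_opPm,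
    parL_parMap, parR_parMap, parL_parAssocInv, parR_parL_parAssocInv, parR_parR_parAssocInv,
    sumL_sumAssoc_inv, sumR_sumL_sumAssoc_inv, sumR_sumR_sumAssoc_inv]

theorem op_plus_assoc (a b c : H) :
    (parAssocHom a b c ≫ parMap (𝟙 a) (opP b c)) ≫ opP a (b ⊕' c)
      = parMap (opP a b) (𝟙 c) ≫ opP (a ⊕' b) c ≫ (sumAssoc a b c).hom := by
  apply par_ext_left <;> simp only [← Category.assoc, Category.comp_id, Limits.zero_comp,
    pre_comp, pre_zero, parL_zero, parR_zero, parT_zero_left, parT_zero_right, parT_opP, parL_opP,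
    parR_opP, parT_parMap, parL_parMap, parR_parMap, parT_parT_parAssocHom, parT_parL_parAssocHom,
    parT_parR_parAssocHom, parL_parT_parAssocHom, parL_parL_parAssocHom, parL_parR_parAssocHom,
    parR_parAssocHom, sumL_sumL_sumAssoc_hom, sumL_sumR_sumAssoc_hom, sumR_sumAssoc_hom]

theorem op_tensor_natural {a a' b b' : H} (f : a ⟶ a') (g : b ⟶ b') :
    parMap f g ≫ opT a' b'
      = opT a b ≫ (f ⊗ₘ g) := by
  apply par_ext <;> simp only [← Category.assoc, Category.id_comp, Limits.zero_comp, parT_opT,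
    parL_opT, parR_opT, parT_parMap, parL_parMap, parR_parMap, tens_comp]

theorem op_tensorM_natural {a a' b b' : H} (f : a ⟶ a') (g : b ⟶ b') :
    opTm a b ≫ parMap f g
      = (f ⊗ₘ g) ≫ opTm a' b' := by
  apply eq_of_id_comp
  simp only [← tens_id]
  simp only [← Category.assoc, Category.id_comp, tens_opTm, parT_parMap, tens_comp]

theorem op_plus_natural {a a' b b' : H} (f : a ⟶ a') (g : b ⟶ b') :
    parMap f g ≫ opP a' b'
      = opP a b ≫ sumMap f g := by
  apply par_ext <;> simp only [← Category.assoc, Category.id_comp, Limits.zero_comp, parT_opP,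
    parL_opP, parR_opP, parT_parMap, parL_parMap, parR_parMap, sumL_sumMap, sumR_sumMap]

theorem op_plusM_natural {a a' b b' : H} (f : a ⟶ a') (g : b ⟶ b') :
    opPm a b ≫ parMap f g
      = sumMap f g ≫ opPm a' b' := by
  apply sum_ext <;> simp only [← Category.assoc, Category.id_comp, sumL_opPm, sumR_opPm,
    parL_parMap, parR_parMap, sumL_sumMap, sumR_sumMap]

theorem op_tensor_one (a : H) :
    parSwap a (𝟙_ H) ≫ opT (𝟙_ H) a
      = opT a (𝟙_ H) ≫ (ρ_ a).hom ≫ (λ_ a).inv := by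
  apply par_ext <;> simp only [← Category.assoc, Limits.zero_comp, pre_comp, parT_opT, parL_opT,
    parR_opT, parT_parSwap, parL_parSwap, parR_parSwap]
  simp only [tens_id, pre, Category.comp_id, Category.id_comp, braiding_tensorUnit_right]

theorem op_tensorM_one (a : H) :
    opTm (𝟙_ H) a ≫ parSwap (𝟙_ H) a
      = ((λ_ a).hom ≫ (ρ_ a).inv) ≫ opTm a (𝟙_ H) := by
  apply eq_of_id_comp
  simp only [← tens_id]
  simp only [← Category.assoc, tens_opTm, parT_parSwap]
  simp only [tens_leftUnitor, pre_comp, comp_rightUnitor_inv, tens_opTm, braiding_tensorUnit_left]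
  simp only [pre_pre, parT_pre_left]
  simp only [pre, tens, tensorHom_id]

theorem op_plus_zero (a : H) :
    (parRightInv a ≫ parMap (𝟙 a) (0 : (Semiadditive.zeroObj : H) ⟶ (Semiadditive.zeroObj :
      H))) ≫ opP a (Semiadditive.zeroObj : H)
      = inl := by
  apply eq_of_id_comp
  simp only [← Category.assoc, Category.id_comp, Category.comp_id, comp_parRightInv, parL_opP,
    parL_parMap]
  exact Category.id_comp _

theorem op_plusM_zero (a : H) :
    opPm a (Semiadditive.zeroObj : H) ≫
      parMap (𝟙 a) (0 : (Semiadditive.zeroObj : H) ⟶ (Semiadditive.zeroObj : H)) ≫ parRightHom a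
      = fst := by
  apply sum_ext <;> simp only [← Category.assoc, Category.comp_id, Limits.zero_comp,
    Limits.comp_zero, parR_zero, parL_parRightHom, sumL_fst, sumR_fst, sumL_opPm, sumR_opPm,
    parL_parMap, parR_parMap]

theorem op_zero_plus (a : H) :
    (parLeftInv a ≫ parMap (0 : (Semiadditive.zeroObj : H) ⟶ (Semiadditive.zeroObj : H)) (𝟙 a)) ≫
      opP (Semiadditive.zeroObj : H) a
      = inr := by
  apply eq_of_id_comp
  simp only [← Category.assoc, Category.id_comp, Category.comp_id, comp_parLeftInv, parR_opP,
    parR_parMap]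
  exact Category.id_comp _

theorem op_zero_plusM (a : H) :
    opPm (Semiadditive.zeroObj : H) a ≫
      parMap (0 : (Semiadditive.zeroObj : H) ⟶ (Semiadditive.zeroObj : H)) (𝟙 a) ≫ parLeftHom a
      = snd := by
  apply sum_ext <;> simp only [← Category.assoc, Category.comp_id, Limits.zero_comp,
    Limits.comp_zero, parL_zero, parR_parLeftHom, sumL_snd, sumR_snd, sumL_opPm, sumR_opPm,
    parL_parMap, parR_parMap]

theorem op_scalar_add {a : H} (f g : a ⟶ a) :
    (opKm a ≫ parMap f g) ≫ opK a
      = f + g := by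
  apply eq_of_id_comp
  simp only [← Category.assoc, Category.id_comp, add_comp, comp_add, parL_opK, parR_opK,
    comp_opKm, parL_parMap, parR_parMap]

theorem op_scalar_addM {a : H} (f g : a ⟶ a) :
    opKm a ≫ parMap f g ≫ opK a
      = f + g := by
  apply eq_of_id_comp
  simp only [← Category.assoc, Category.id_comp, add_comp, comp_add, parL_opK, parR_opK,
    comp_opKm, parL_parMap, parR_parMap]

end AxiomsOnOperations

/-! ### Soundness of the functional axioms -/

section FunctionalAxioms

variable {R : Type w} [CommSemiring R] {H : Type u} [Category.{v} H] [Limits.HasZeroMorphisms H]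
  [Semiadditive H] [MonoidalCategory H] [SymmetricCategory H] [Distributive H]
  (scal : ScalarIso R H)

theorem sem_adapter {A B : Color} (h : Color.Approx A B) (t : Color.AdapterTerm A B) :
    sem scal (M h) = (adapterTermIso H t).hom :=
  congrArg Iso.hom (adapterIso_eq h t)

theorem sem_splitR (A : Color) : sem scal (splitR A) = opSplitR (colorObj H A) :=
  sem_comp_eq (sem_adapter scal _ (.symm (.tensorOne A))) rfl

theorem sem_splitL (A : Color) : sem scal (splitL A) = opSplitL (colorObj H A) :=
  sem_comp_eq (sem_adapter scal _ (.symm (.oneTensor A))) rfl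

theorem sem_mergeR (A : Color) : sem scal (mergeR A) = opMergeR (colorObj H A) :=
  sem_comp_eq rfl (sem_adapter scal _ (.tensorOne A))

theorem sem_mergeL (A : Color) : sem scal (mergeL A) = opMergeL (colorObj H A) :=
  sem_comp_eq rfl (sem_adapter scal _ (.oneTensor A))

theorem sem_id_par_par_id {A B C B' C' D : Color} {d : FDiag R (w₂ B C) (w₂ B' C')}
    {f : parObj (colorObj H B) (colorObj H C) ⟶ parObj (colorObj H B') (colorObj H C')}
    (h : sem scal d = f) :
    sem scal (I A ⫽ d ⫽ I D) = parMap (opMid (colorObj H A) f) (𝟙 (colorObj H D)) :=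
  sem_par_single_single (sem_par_double_double rfl h) rfl

/-- The chosen derivation of the composite need not be the composite of the chosen derivations;
coherence makes them agree. -/
theorem adapterIso_trans {A B C : Color} (h : Color.Approx A B) (k : Color.Approx B C) :
    (adapterIso H h).hom ≫ (adapterIso H k).hom = (adapterIso H (h.trans k)).hom := by
  rw [adapterIso_eq h h.some, adapterIso_eq k k.some, adapterIso_eq _ (.trans h.some k.some)]
  rfl

theorem sem_tensorCongr {A A' B B' : Color} (h : Color.Approx A A') (k : Color.Approx B B') :
    sem scal (M (h.tensorCongr k)) = ((adapterIso H h).hom ⊗ₘ (adapterIso H k).hom) := by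
  rw [adapterIso_eq h h.some, adapterIso_eq k k.some,
    sem_adapter scal _ (.tensorCongr h.some k.some)]
  rfl

theorem sem_plusCongr {A A' B B' : Color} (h : Color.Approx A A') (k : Color.Approx B B') :
    sem scal (M (h.plusCongr k)) = sumMap (adapterIso H h).hom (adapterIso H k).hom := by
  rw [adapterIso_eq h h.some, adapterIso_eq k k.some, sem_adapter scal _ (.plusCongr h.some k.some)]
  rfl

-- Each axiom is reduced to an identity between operations. The remaining work is to translate the
-- two diagrams into operations, which is directed by the shapes of their interfaces.
set_option maxHeartbeats 4000000 in
theorem sem_FAx {X Y : Wires} {d e : FDiag R X Y} (h : FAx R d e) :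
    sem scal d = sem scal e := by
  cases h
  case tensor_split A B => exact inl_fst
  case plus_split A B => exact inr_snd
  case tensor_plus A B => exact inl_snd.trans Limits.zero_comp.symm
  case zero_wire => exact Semiadditive.isZero_zeroObj.eq_of_src _ _
  -- The diagrams beginning with a null start at the zero object.
  case null_tensor A B => exact Semiadditive.isZero_zeroObj.eq_of_src _ _
  case null_plus A B => exact Semiadditive.isZero_zeroObj.eq_of_src _ _
  case null_contr A => exact Semiadditive.isZero_zeroObj.eq_of_src _ _
  case null_null A => exact Semiadditive.isZero_zeroObj.eq_of_src _ _
  case null_adapter A h => exact Semiadditive.isZero_zeroObj.eq_of_src _ _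
  case null_scalar s A => exact Semiadditive.isZero_zeroObj.eq_of_src _ _
  case adapter_adapter A B C h k => exact adapterIso_trans h k
  case adapter_refl A => exact sem_adapter scal _ (.refl A)
  case scalar_one A => exact smul_one_id scal _
  case scalar_zero A => exact (smul_zero_id scal _).trans Limits.zero_comp.symm
  case scalar_adapter s A B h => exact smul_id_comp scal s (adapterIso H h).hom
  -- The identity between operations is inserted in the middle, leaving one translation goal for
  -- each side.
  case' contr_scalar s A =>
    refine Eq.trans ?_ ((op_contr_natural (scal.smul s (𝟙 (colorObj H A)))).trans (Eq.symm ?_))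
  case' contr_adapter A B h =>
    refine Eq.trans ?_ ((op_contr_natural (adapterIso H h).hom).trans (Eq.symm ?_))
  case' tensor_adapter A A' B B' h k =>
    refine Eq.trans ?_ ((op_tensor_natural (adapterIso H h).hom (adapterIso H k).hom).trans
      (Eq.symm ?_))
  case' plus_adapter A A' B B' h k =>
    refine Eq.trans ?_ ((op_plus_natural (adapterIso H h).hom (adapterIso H k).hom).trans
      (Eq.symm ?_))
  case' scalar_add s t A =>
    refine Eq.trans ?_ ((op_scalar_add (scal.smul s (𝟙 (colorObj H A)))
      (scal.smul t (𝟙 (colorObj H A)))).trans (smul_add_id scal s t (colorObj H A)).symm)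
  case' tensor_scalar s t A B =>
    refine Eq.trans ?_ ((op_tensor_natural (scal.smul s (𝟙 (colorObj H A)))
      (scal.smul t (𝟙 (colorObj H B)))).trans (Eq.symm ?_))
  case' swap_contr A => refine Eq.trans ?_ ((op_swap_contr (colorObj H A)).trans (Eq.symm ?_))
  case' tensor_zigzag A B C => refine Eq.trans ?_ ((op_zigzag (colorObj H A) (colorObj H B)
    (colorObj H C)).trans (Eq.symm ?_))
  case' plus_unit A B => refine Eq.trans ?_ ((op_plus_unit (colorObj H A) (colorObj H B)).trans
    (Eq.symm ?_))
  case' plus_contr A B => refine Eq.trans ?_ ((op_plus_contr (colorObj H A) (colorObj H B)).trans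
    (Eq.symm ?_))
  case' mix A B => refine Eq.trans ?_ ((op_mix (colorObj H A) (colorObj H B)).trans (Eq.symm ?_))
  case' contr_null A => refine Eq.trans ?_ ((op_contr_null (colorObj H A)).trans (Eq.symm ?_))
  case' contr_tensorM A B => refine Eq.trans ?_ ((op_contr_tensorM (colorObj H A) (colorObj H
    B)).trans (Eq.symm ?_))
  case' contr_tensor A B => refine Eq.trans ?_ ((op_contr_tensor (colorObj H A) (colorObj H
    B)).trans (Eq.symm ?_))
  case' contr_plusM A B => refine Eq.trans ?_ ((op_contr_plusM (colorObj H A) (colorObj H B)).trans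
    (Eq.symm ?_))
  case' contr_XP A B => refine Eq.trans ?_ ((op_contr_opX (colorObj H A) (colorObj H B)).trans
    (Eq.symm ?_))
  case' contr_contrM A => refine Eq.trans ?_ ((op_contr_contrM (colorObj H A)).trans (Eq.symm ?_))
  case' contr_assoc A => refine Eq.trans ?_ ((op_contr_assoc (colorObj H A)).trans (Eq.symm ?_))
  case' tensor_assoc A B C => refine Eq.trans ?_ ((op_tensor_assocM (colorObj H A) (colorObj H B)
    (colorObj H C)).trans (Eq.symm ?_))
  case' plus_assoc A B C => refine Eq.trans ?_ ((op_plus_assocM (colorObj H A) (colorObj H B)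
    (colorObj H C)).trans (Eq.symm ?_))
  case' tensor_one A => refine Eq.trans ?_ ((op_tensor_one (colorObj H A)).trans (Eq.symm ?_))
  case' plus_zero A => refine Eq.trans ?_ ((op_plus_zero (colorObj H A)).trans (Eq.symm ?_))
  case' zero_plus A => refine Eq.trans ?_ ((op_zero_plus (colorObj H A)).trans (Eq.symm ?_))
  -- Specific composites such as unit splittings come first, since the general rule for composition
  -- would break them up. Adapters are given the derivation whose interpretation the identity
  -- mentions.
  all_goals
    repeat' first
      | exact sem_splitR scal _
      | exact sem_splitL scal _
      | exact sem_mergeR scal _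
      | exact sem_mergeL scal _
      | exact sem_tensorCongr scal _ _
      | exact sem_plusCongr scal _ _
      | exact (smul_tensor_smul scal _ _ _ _).symm
      | exact sem_adapter scal _ (.tensorAssoc _ _ _)
      | exact sem_adapter scal _ (.symm (.tensorAssoc _ _ _))
      | exact sem_adapter scal _ (.plusAssoc _ _ _)
      | exact sem_adapter scal _ (.symm (.plusAssoc _ _ _))
      | exact sem_adapter scal _ (.plusZero _)
      | exact sem_adapter scal _ (.symm (.plusZero _))
      | exact sem_adapter scal _ (.zeroPlus _)
      | exact sem_adapter scal _ (.symm (.zeroPlus _))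
      | exact sem_adapter scal _ (.trans (.tensorOne _) (.symm (.oneTensor _)))
      | exact sem_adapter scal _ (.trans (.oneTensor _) (.symm (.tensorOne _)))
      | refine sem_id_par_par_id scal ?_
      | refine sem_comp_eq ?_ ?_
      | refine sem_par_single_single ?_ ?_
      | refine sem_par_single_double ?_ ?_
      | refine sem_par_double_single ?_ ?_
      | refine sem_par_double_double ?_ ?_
      | refine sem_par_nil_single ?_ ?_
      | refine sem_par_single_nil ?_ ?_
      | refine sem_nil_par_single ?_ ?_
      | refine sem_single_par_nil ?_ ?_
      | exact rfl

set_option maxHeartbeats 4000000 in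
theorem sem_FAx_mirror {X Y : Wires} {d e : FDiag R X Y} (h : FAx R d e) :
    sem scal (d.mirror (fun g => FGen.mirror g)) =
      sem scal (e.mirror (fun g => FGen.mirror g)) := by
  cases h
  case tensor_split A B => exact inl_fst
  case plus_split A B => exact inr_snd
  case tensor_plus A B => exact inr_fst.trans Limits.zero_comp.symm
  case zero_wire => exact Semiadditive.isZero_zeroObj.eq_of_src _ _
  -- In the mirrored axioms the diagrams end at the zero object instead.
  case null_tensor A B => exact Semiadditive.isZero_zeroObj.eq_of_tgt _ _
  case null_plus A B => exact Semiadditive.isZero_zeroObj.eq_of_tgt _ _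
  case null_contr A => exact Semiadditive.isZero_zeroObj.eq_of_tgt _ _
  case null_null A => exact Semiadditive.isZero_zeroObj.eq_of_tgt _ _
  case null_adapter A h => exact Semiadditive.isZero_zeroObj.eq_of_tgt _ _
  case null_scalar s A => exact Semiadditive.isZero_zeroObj.eq_of_tgt _ _
  case adapter_adapter A B C h k => exact adapterIso_trans k.symm h.symm
  case adapter_refl A => exact sem_adapter scal _ (.refl A)
  case scalar_one A => exact smul_one_id scal _
  case scalar_zero A => exact (smul_zero_id scal _).trans Limits.zero_comp.symm
  case scalar_adapter s A B h => exact (smul_id_comp scal s (adapterIso H h.symm).hom).symm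
  case' contr_scalar s A =>
    refine Eq.trans ?_ ((op_contrM_natural (scal.smul s (𝟙 (colorObj H A)))).trans
      (Eq.symm ?_))
  case' contr_adapter A B h =>
    refine Eq.trans ?_ ((op_contrM_natural (adapterIso H h.symm).hom).trans (Eq.symm ?_))
  case' tensor_adapter A A' B B' h k =>
    refine Eq.trans ?_ ((op_tensorM_natural (adapterIso H h.symm).hom
      (adapterIso H k.symm).hom).trans (Eq.symm ?_))
  case' plus_adapter A A' B B' h k =>
    refine Eq.trans ?_ ((op_plusM_natural (adapterIso H h.symm).hom
      (adapterIso H k.symm).hom).trans (Eq.symm ?_))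
  case' scalar_add s t A =>
    refine Eq.trans ?_ ((op_scalar_addM (scal.smul s (𝟙 (colorObj H A)))
      (scal.smul t (𝟙 (colorObj H A)))).trans (smul_add_id scal s t (colorObj H A)).symm)
  case' tensor_scalar s t A B =>
    refine Eq.trans ?_ ((op_tensorM_natural (scal.smul s (𝟙 (colorObj H A)))
      (scal.smul t (𝟙 (colorObj H B)))).trans (Eq.symm ?_))
  case' swap_contr A => refine Eq.trans ?_ ((op_contrM_swap (colorObj H A)).trans (Eq.symm ?_))
  case' tensor_zigzag A B C => refine Eq.trans ?_ ((op_zigzagM (colorObj H A) (colorObj H B)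
    (colorObj H C)).trans (Eq.symm ?_))
  case' plus_unit A B => refine Eq.trans ?_ ((op_plus_unitM (colorObj H A) (colorObj H B)).trans
    (Eq.symm ?_))
  case' plus_contr A B => refine Eq.trans ?_ ((op_plus_contrM (colorObj H A) (colorObj H B)).trans
    (Eq.symm ?_))
  case' mix A B => refine Eq.trans ?_ ((op_mixM (colorObj H A) (colorObj H B)).trans (Eq.symm ?_))
  case' contr_null A => refine Eq.trans ?_ ((op_contr_nullM (colorObj H A)).trans (Eq.symm ?_))
  case' contr_tensorM A B => refine Eq.trans ?_ ((op_contr_tensorMM (colorObj H A) (colorObj H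
    B)).trans (Eq.symm ?_))
  case' contr_tensor A B => refine Eq.trans ?_ ((op_contr_tensorT (colorObj H A) (colorObj H
    B)).trans (Eq.symm ?_))
  case' contr_plusM A B => refine Eq.trans ?_ ((op_contr_plusMM (colorObj H A) (colorObj H
    B)).trans (Eq.symm ?_))
  case' contr_XP A B => refine Eq.trans ?_ ((op_opX_contrM (colorObj H A) (colorObj H B)).trans
    (Eq.symm ?_))
  case' contr_contrM A => refine Eq.trans ?_ ((op_contr_contrMM (colorObj H A)).trans (Eq.symm ?_))
  case' contr_assoc A => refine Eq.trans ?_ ((op_contr_assocM (colorObj H A)).trans (Eq.symm ?_))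
  case' tensor_assoc A B C => refine Eq.trans ?_ ((op_tensor_assoc (colorObj H A) (colorObj H B)
    (colorObj H C)).trans (Eq.symm ?_))
  case' plus_assoc A B C => refine Eq.trans ?_ ((op_plus_assoc (colorObj H A) (colorObj H B)
    (colorObj H C)).trans (Eq.symm ?_))
  case' tensor_one A => refine Eq.trans ?_ ((op_tensorM_one (colorObj H A)).trans (Eq.symm ?_))
  case' plus_zero A => refine Eq.trans ?_ ((op_plusM_zero (colorObj H A)).trans (Eq.symm ?_))
  case' zero_plus A => refine Eq.trans ?_ ((op_zero_plusM (colorObj H A)).trans (Eq.symm ?_))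
  all_goals
    repeat' first
      | exact sem_splitR scal _
      | exact sem_splitL scal _
      | exact sem_mergeR scal _
      | exact sem_mergeL scal _
      | exact sem_tensorCongr scal _ _
      | exact sem_plusCongr scal _ _
      | exact (smul_tensor_smul scal _ _ _ _).symm
      | exact sem_adapter scal _ (.tensorAssoc _ _ _)
      | exact sem_adapter scal _ (.symm (.tensorAssoc _ _ _))
      | exact sem_adapter scal _ (.plusAssoc _ _ _)
      | exact sem_adapter scal _ (.symm (.plusAssoc _ _ _))
      | exact sem_adapter scal _ (.plusZero _)
      | exact sem_adapter scal _ (.symm (.plusZero _))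
      | exact sem_adapter scal _ (.zeroPlus _)
      | exact sem_adapter scal _ (.symm (.zeroPlus _))
      | exact sem_adapter scal _ (.trans (.tensorOne _) (.symm (.oneTensor _)))
      | exact sem_adapter scal _ (.trans (.oneTensor _) (.symm (.tensorOne _)))
      | refine sem_id_par_par_id scal ?_
      | refine sem_comp_eq ?_ ?_
      | refine sem_par_single_single ?_ ?_
      | refine sem_par_single_double ?_ ?_
      | refine sem_par_double_single ?_ ?_
      | refine sem_par_double_double ?_ ?_
      | refine sem_par_nil_single ?_ ?_
      | refine sem_par_single_nil ?_ ?_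
      | refine sem_nil_par_single ?_ ?_
      | refine sem_single_par_nil ?_ ?_
      | exact rfl

end FunctionalAxioms

/-! ### The unit generator and the cancellation matrix -/

section UnitOperations

variable {H : Type u} [Category.{v} H] [Limits.HasZeroMorphisms H] [Semiadditive H]
  [MonoidalCategory H] [SymmetricCategory H] [Distributive H]

/-- The unit generator, with a unit adjoined. -/
def opU (H : Type u) [Category.{v} H] [Limits.HasZeroMorphisms H] [Semiadditive H]
    [MonoidalCategory H] : ((Semiadditive.zeroObj : H) ⊕' 𝟙_ H) ⟶ (𝟙_ H ⊕' 𝟙_ H) :=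
  snd ≫ lift (𝟙 (𝟙_ H)) (𝟙 (𝟙_ H))

/-- The reflected unit generator, with a unit adjoined. -/
def opUm (H : Type u) [Category.{v} H] [Limits.HasZeroMorphisms H] [Semiadditive H]
    [MonoidalCategory H] : (𝟙_ H ⊕' 𝟙_ H) ⟶ ((Semiadditive.zeroObj : H) ⊕' 𝟙_ H) :=
  desc (𝟙 (𝟙_ H)) (𝟙 (𝟙_ H)) ≫ inr

/-- Adding a unit to the right of a wire. -/
def opAddU (X : H) : (X ⊕' 𝟙_ H) ⟶ (parObj X (𝟙_ H) ⊕' 𝟙_ H) :=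
  sumMap (parRightInv X) (𝟙 (𝟙_ H)) ≫ expandInv X (Semiadditive.zeroObj : H) ≫
    (𝟙 (X ⊕' 𝟙_ H) ⊗ₘ opU H) ≫ expandHom X (𝟙_ H)

/-- Removing a unit from the right of a wire. -/
def opRemU (X : H) : (parObj X (𝟙_ H) ⊕' 𝟙_ H) ⟶ (X ⊕' 𝟙_ H) :=
  expandInv X (𝟙_ H) ≫ (𝟙 (X ⊕' 𝟙_ H) ⊗ₘ opUm H) ≫ expandHom X (Semiadditive.zeroObj : H) ≫
    sumMap (parRightHom X) (𝟙 (𝟙_ H))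

/-- The second factor is an arbitrary element of the adjoined unit here, because the mirrored unit
sends elements of the wire there. -/
theorem sumR_sumR_expandHom_comp {S X Y : H} (x : S ⟶ 𝟙_ H) :
    tens (sumR X (𝟙 (𝟙_ H))) (sumR Y x) ≫ expandHom X Y = pre (λ_ S).hom (sumR (parObj X Y) x) := by
  simp only [expandHom_eq, ← Category.assoc, tens_sumR_distR, tens_leftUnitor,
    sumR_desc, pre_comp, comp_inr]

theorem sumR_opU {S : H} (x : S ⟶ 𝟙_ H) :
    sumR (Semiadditive.zeroObj : H) x ≫ opU H = sumL (𝟙_ H) x + sumR (𝟙_ H) x := by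
  rw [opU, ← Category.assoc, sumR_snd, comp_lift, Category.comp_id, lift_eq_add]; rfl

theorem sumL_opUm {S : H} (x : S ⟶ 𝟙_ H) :
    sumL (𝟙_ H) x ≫ opUm H = sumR (Semiadditive.zeroObj : H) x := by
  rw [opUm, ← Category.assoc, sumL_desc, Category.comp_id]; rfl

theorem sumR_opUm {S : H} (x : S ⟶ 𝟙_ H) :
    sumR (𝟙_ H) x ≫ opUm H = sumR (Semiadditive.zeroObj : H) x := by
  rw [opUm, ← Category.assoc, sumR_desc, Category.comp_id]; rfl

/-- The new unit is either present, giving x ⊗ 1, or absent, giving x alone. -/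
theorem sumL_opAddU {S X : H} (x : S ⟶ X) :
    sumL (𝟙_ H) x ≫ opAddU X
      = sumL (𝟙_ H) (pre (ρ_ S).inv (parT x (𝟙 (𝟙_ H)))) + sumL (𝟙_ H) (parL (𝟙_ H) x) := by
  simp only [opAddU, ← Category.assoc, sumL_sumMap, comp_parRightInv, parL_expandInv, pre_comp,
    tens_comp, Category.comp_id, sumR_opU, tens_add_right, add_comp, sumL_sumL_expandHom,
    sumL_sumR_expandHom, pre_add, pre_pre, Iso.inv_hom_id, pre_id, sumL_pre]

theorem sumR_opAddU {X : H} :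
    sumR X (𝟙 (𝟙_ H)) ≫ opAddU X
      = sumL (𝟙_ H) (parR X (𝟙 (𝟙_ H))) + sumR (parObj X (𝟙_ H)) (𝟙 (𝟙_ H)) := by
  simp only [opAddU, ← Category.assoc, sumR_sumMap, sumR_expandInv, pre_comp,
    tens_comp, Category.comp_id, sumR_opU, tens_add_right, add_comp, sumR_sumL_expandHom,
    sumR_sumR_expandHom, pre_add, pre_pre, Iso.inv_hom_id, pre_id]

theorem parT_opRemU {S X : H} (x : S ⟶ X) :
    sumL (𝟙_ H) (parT x (𝟙 (𝟙_ H))) ≫ opRemU X = pre (ρ_ S).hom (sumL (𝟙_ H) x) := by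
  simp only [opRemU, ← Category.assoc, parT_expandInv, tens_comp, Category.comp_id, sumL_opUm,
    sumL_sumR_expandHom, pre_comp, sumL_sumMap, parL_parRightHom]

theorem parL_opRemU {S X : H} (x : S ⟶ X) :
    sumL (𝟙_ H) (parL (𝟙_ H) x) ≫ opRemU X = sumL (𝟙_ H) x := by
  simp only [opRemU, ← Category.assoc, parL_expandInv, tens_comp, Category.comp_id, sumR_opUm,
    sumL_sumR_expandHom, pre_comp, sumL_sumMap, parL_parRightHom, pre_pre, Iso.inv_hom_id, pre_id]

theorem parR_opRemU {S X : H} (x : S ⟶ 𝟙_ H) :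
    sumL (𝟙_ H) (parR X x) ≫ opRemU X = sumR X x := by
  simp only [opRemU, ← Category.assoc, parR_expandInv, tens_comp, Category.comp_id, sumL_opUm,
    sumR_sumR_expandHom_comp, pre_comp, sumR_sumMap, pre_pre, Iso.inv_hom_id, pre_id]

theorem sumR_opRemU {X : H} :
    sumR (parObj X (𝟙_ H)) (𝟙 (𝟙_ H)) ≫ opRemU X = sumR X (𝟙 (𝟙_ H)) := by
  simp only [opRemU, ← Category.assoc, sumR_expandInv, tens_comp, Category.comp_id, sumR_opUm,
    sumR_sumR_expandHom, pre_comp, sumR_sumMap, pre_pre, Iso.inv_hom_id, pre_id]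

theorem opSplitR_opRemU (X : H) :
    sumMap (opSplitR X) (𝟙 (𝟙_ H)) ≫ opRemU X = 𝟙 (X ⊕' 𝟙_ H) := by
  apply sum_ext <;> simp only [← Category.assoc, sumL_sumMap, sumR_sumMap, comp_opSplitR, sumL_pre,
    pre_comp, parT_opRemU, pre_pre, Iso.inv_hom_id, pre_id, Category.comp_id, sumR_opRemU]

/-- Of the summands created by adding a unit, merging keeps x ⊗ 1 and discards the single wires; the
adjoined unit is untouched. -/
theorem opAddU_opMergeR (X : H) :
    opAddU X ≫ sumMap (opMergeR X) (𝟙 (𝟙_ H)) = 𝟙 (X ⊕' 𝟙_ H) := by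
  apply sum_ext <;> simp only [← Category.assoc, sumL_sumMap, sumR_sumMap, sumL_opAddU,
    sumR_opAddU, add_comp, pre_comp, parT_opMergeR, parL_opMergeR, parR_opMergeR, sumL_zero,
    add_zero, zero_add, pre_pre, Iso.inv_hom_id, pre_id, Category.comp_id]

theorem null_opUm : sumMap (0 : (Semiadditive.zeroObj : H) ⟶ 𝟙_ H) (𝟙 (𝟙_ H)) ≫ opUm H
    = 𝟙 ((Semiadditive.zeroObj : H) ⊕' 𝟙_ H) := by
  apply sum_ext
  · exact Semiadditive.isZero_zeroObj.eq_of_src _ _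
  · simp only [← Category.assoc, sumR_sumMap, sumR_opUm, Category.comp_id]

theorem opU_null : opU H ≫ sumMap (0 : 𝟙_ H ⟶ (Semiadditive.zeroObj : H)) (𝟙 (𝟙_ H))
    = 𝟙 ((Semiadditive.zeroObj : H) ⊕' 𝟙_ H) := by
  apply sum_ext
  · exact Semiadditive.isZero_zeroObj.eq_of_src _ _
  · simp only [← Category.assoc, sumR_opU, add_comp, sumL_sumMap, sumR_sumMap, Limits.comp_zero,
      sumL_zero, zero_add, Category.comp_id]

/-- The functional part of the cancellation diagram. -/
def opCan (f : 𝟙_ H ⟶ 𝟙_ H) : parObj (𝟙_ H) (𝟙_ H) ⟶ parObj (𝟙_ H) (𝟙_ H) :=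
  ((parMap (𝟙 (𝟙_ H)) (opKm (𝟙_ H)) ≫ parAssocInv (𝟙_ H) (𝟙_ H) (𝟙_ H)) ≫
    parMap (parSwap (𝟙_ H) (𝟙_ H)) f) ≫
    parAssocHom (𝟙_ H) (𝟙_ H) (𝟙_ H) ≫ parMap (𝟙 (𝟙_ H)) (opK (𝟙_ H))

/-- The morphism `f` meets only the branch in which the second copy is used. There the contraction
receives two elements at once and vanishes, so `f` leaves no trace on this summand. -/
theorem parT_opCan (f : 𝟙_ H ⟶ 𝟙_ H) :
    parT (𝟙 (𝟙_ H)) (𝟙 (𝟙_ H)) ≫ opCan f = parT (𝟙 (𝟙_ H)) (𝟙 (𝟙_ H)) := by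
  -- The swap of the two wires reverses their stages, which are both the unit object.
  have h : (β_ (𝟙_ H) (𝟙_ H)).hom = 𝟙 _ := by
    rw [braiding_tensorUnit_left, unitors_equal, Iso.hom_inv_id]
  simp only [opCan, ← Category.assoc, parT_parMap, Category.id_comp, comp_opKm, parT_add_right,
    add_comp, parT_parL_parAssocInv, parT_parR_parAssocInv, parL_parMap, parT_parSwap,
    parL_parSwap, parL_parT_parAssocHom, parT_parR_parAssocHom, parR_parMap,
    parL_opK, parT_opK, parR_zero, add_zero, h, pre_id]

theorem parL_opCan (f : 𝟙_ H ⟶ 𝟙_ H) :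
    parL (𝟙_ H) (𝟙 (𝟙_ H)) ≫ opCan f = parR (𝟙_ H) (𝟙 (𝟙_ H)) := by
  simp only [opCan, ← Category.assoc, parL_parMap, Category.comp_id, parL_parAssocInv,
    parL_parSwap, parL_parR_parAssocHom, parR_parMap, parL_opK]

theorem parR_opCan (f : 𝟙_ H ⟶ 𝟙_ H) :
    parR (𝟙_ H) (𝟙 (𝟙_ H)) ≫ opCan f = parL (𝟙_ H) (𝟙 (𝟙_ H)) + parR (𝟙_ H) f := by
  simp only [opCan, ← Category.assoc, parL_parMap, parR_parMap, Category.id_comp, Category.comp_id,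
    comp_opKm, parR_add, add_comp, parR_parL_parAssocInv, parR_parR_parAssocInv, parR_parSwap,
    parL_parL_parAssocHom, parR_parAssocHom, parR_opK]

/-- A 2 × 2 matrix on 1 ⊕ 1 whose entries are all 1 except for f + 1 between the adjoined units. The
summand f comes from the new unit wire carrying `f`, and the summand 1 from the case in which
neither wire is present. -/
theorem can_eq (f : 𝟙_ H ⟶ 𝟙_ H) :
    opAddU (𝟙_ H) ≫ sumMap (opCan f) (𝟙 (𝟙_ H)) ≫ opRemU (𝟙_ H)
      = desc (sumL (𝟙_ H) (𝟙 (𝟙_ H)) + sumR (𝟙_ H) (𝟙 (𝟙_ H)))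
          (sumL (𝟙_ H) (𝟙 (𝟙_ H)) + sumR (𝟙_ H) (f + 𝟙 (𝟙_ H))) := by
  apply sum_ext <;> simp only [← Category.assoc, sumL_opAddU, sumR_opAddU, add_comp, sumL_sumMap,
    sumR_sumMap, pre_comp, parT_opCan, parL_opCan, parR_opCan, sumL_pre, sumL_add, parT_opRemU,
    parL_opRemU, parR_opRemU, sumR_opRemU, pre_pre, Iso.inv_hom_id, pre_id, sumL_desc, sumR_desc,
    Category.id_comp, Category.comp_id, sumR_add, add_assoc]

end UnitOperations

/-! ### Soundness of the full calculus and of the functional calculus -/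

section FullAxioms

variable {R : Type w} [CommSemiring R] {H : Type u} [Category.{v} H] [Limits.HasZeroMorphisms H]
  [Semiadditive H] [MonoidalCategory H] [SymmetricCategory H] [Distributive H]
  (scal : ScalarIso R H)

theorem semFull_par_eq {X Y X' Y' : Wires} {d : FullDiag R X Y} {e : FullDiag R X' Y'}
    {f : (wiresObj H X ⊕' 𝟙_ H) ⟶ (wiresObj H Y ⊕' 𝟙_ H)}
    {g : (wiresObj H X' ⊕' 𝟙_ H) ⟶ (wiresObj H Y' ⊕' 𝟙_ H)}
    {p : wiresObj H (X.append X') ⟶ parObj (wiresObj H X) (wiresObj H X')}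
    {q : parObj (wiresObj H Y) (wiresObj H Y') ⟶ wiresObj H (Y.append Y')}
    (hp : appendInv H X X' = p) (hq : appendHom H Y Y' = q)
    (hd : semFull scal d = f) (he : semFull scal e = g) :
    semFull scal (d ⫽ e) = sumMap p (𝟙 (𝟙_ H)) ≫ expandInv (wiresObj H X) (wiresObj H X') ≫
      (f ⊗ₘ g) ≫ expandHom (wiresObj H Y) (wiresObj H Y') ≫ sumMap q (𝟙 (𝟙_ H)) := by
  subst hd he hp hq; rfl

theorem semFull_comp_eq {X Y Z : Wires} {d : FullDiag R X Y} {e : FullDiag R Y Z}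
    {f : (wiresObj H X ⊕' 𝟙_ H) ⟶ (wiresObj H Y ⊕' 𝟙_ H)}
    {g : (wiresObj H Y ⊕' 𝟙_ H) ⟶ (wiresObj H Z ⊕' 𝟙_ H)}
    (hd : semFull scal d = f) (he : semFull scal e = g) : semFull scal (d ⨾ e) = f ≫ g := by
  subst hd he; rfl

theorem opAddU_eq (X : H) :
    sumMap (parRightInv X) (𝟙 (𝟙_ H)) ≫ expandInv X (Semiadditive.zeroObj : H) ≫
      (𝟙 (X ⊕' 𝟙_ H) ⊗ₘ opU H) ≫ expandHom X (𝟙_ H) ≫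
        sumMap (𝟙 (parObj X (𝟙_ H))) (𝟙 (𝟙_ H)) = opAddU X := by
  rw [sumMap_id, Category.comp_id]; rfl

theorem opRemU_eq (X : H) :
    sumMap (𝟙 (parObj X (𝟙_ H))) (𝟙 (𝟙_ H)) ≫ expandInv X (𝟙_ H) ≫
      (𝟙 (X ⊕' 𝟙_ H) ⊗ₘ opUm H) ≫ expandHom X (Semiadditive.zeroObj : H) ≫
        sumMap (parRightHom X) (𝟙 (𝟙_ H)) = opRemU X := by
  rw [sumMap_id, Category.id_comp]; rfl

theorem semFull_addU (A : Color) :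
    semFull scal (FDiag.incl (I A) ⫽ U) = opAddU (colorObj H A) :=
  (semFull_par_eq scal rfl (appendHom_single _ _) rfl rfl).trans (opAddU_eq (colorObj H A))

theorem semFull_remU (A : Color) :
    semFull scal (FDiag.incl (I A) ⫽ Um) = opRemU (colorObj H A) :=
  (semFull_par_eq scal (appendInv_single _ _) rfl rfl rfl).trans (opRemU_eq (colorObj H A))

theorem semFull_incl_eq {X Y : Wires} {d : FDiag R X Y} {f : wiresObj H X ⟶ wiresObj H Y}
    (h : sem scal d = f) : semFull scal d.incl = sumMap f (𝟙 (𝟙_ H)) := by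
  rw [semFull_incl, h]

theorem sem_canDiag (s : R) :
    sem scal ((I .one ⫽ Km .one) ⨾ (σ .one .one ⫽ S s .one) ⨾ (I .one ⫽ K .one))
      = opCan (scal.toEquiv s) := by
  refine sem_comp_eq (sem_comp_eq ?_ ?_) ?_
  · exact sem_par_single_double rfl rfl
  · exact sem_par_single_single rfl (smul_unit scal s)
  · exact sem_par_double_single rfl rfl

/-- The functional core of c_s is its own mirror up to bracketing. -/
theorem sem_canDiag_mirror (s : R) :
    sem scal (Diag.mirror (fun g => FGen.mirror g)
        ((I .one ⫽ Km .one) ⨾ (σ .one .one ⫽ S s .one) ⨾ (I .one ⫽ K .one)))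
      = opCan (scal.toEquiv s) :=
  (Category.assoc _ _ _).symm.trans (sem_canDiag scal s)

theorem semFull_canDiag (s : R) :
    semFull scal (canDiag s)
      = opAddU (𝟙_ H) ≫ sumMap (opCan (scal.toEquiv s)) (𝟙 (𝟙_ H)) ≫ opRemU (𝟙_ H) := by
  refine semFull_comp_eq scal (semFull_addU scal .one) (semFull_comp_eq scal ?_ ?_)
  · exact semFull_incl_eq scal (sem_canDiag scal s)
  · exact semFull_remU scal .one

theorem semFull_canDiag_mirror (s : R) :
    semFull scal ((canDiag s).mirror (fun g => Gen.mirror g))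
      = opAddU (𝟙_ H) ≫ sumMap (opCan (scal.toEquiv s)) (𝟙 (𝟙_ H)) ≫ opRemU (𝟙_ H) := by
  refine Eq.trans ?_ (Category.assoc _ _ _)
  refine semFull_comp_eq scal (semFull_comp_eq scal (semFull_addU scal .one) ?_) ?_
  · rw [incl_mirror]
    exact semFull_incl_eq scal (sem_canDiag_mirror scal s)
  · exact semFull_remU scal .one

/-- By `can_eq` the scalar enters only through s + 1, and the isomorphism R ≅ H(1,1) respects sums
and the unit. -/
theorem can_congr {s t : R} (h : s + 1 = t + 1) :
    opAddU (𝟙_ H) ≫ sumMap (opCan (scal.toEquiv s)) (𝟙 (𝟙_ H)) ≫ opRemU (𝟙_ H)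
      = opAddU (𝟙_ H) ≫ sumMap (opCan (scal.toEquiv t)) (𝟙 (𝟙_ H)) ≫ opRemU (𝟙_ H) := by
  have e (r : R) : scal.toEquiv r + 𝟙 (𝟙_ H) = scal.toEquiv (r + 1) := by
    rw [scal.map_add, scal.map_one, homAdd_eq_add]
  rw [can_eq, can_eq, e, e, h]

theorem semFull_Ax {X Y : Wires} {d e : FullDiag R X Y} (h : Ax R d e) :
    semFull scal d = semFull scal e := by
  cases h with
  | fn h => rw [semFull_incl, semFull_incl, sem_FAx scal h]
  | tensor_unit A =>
    refine Eq.trans ?_ (opSplitR_opRemU (colorObj H A))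
    exact semFull_comp_eq scal (semFull_incl_eq scal (sem_splitR scal A)) (semFull_remU scal A)
  | null_unit => exact null_opUm
  | can s t h =>
    exact (semFull_canDiag scal s).trans ((can_congr scal h).trans (semFull_canDiag scal t).symm)

theorem semFull_Ax_mirror {X Y : Wires} {d e : FullDiag R X Y} (h : Ax R d e) :
    semFull scal (d.mirror (fun g => Gen.mirror g))
      = semFull scal (e.mirror (fun g => Gen.mirror g)) := by
  cases h with
  | fn h => rw [incl_mirror, incl_mirror, semFull_incl, semFull_incl, sem_FAx_mirror scal h]
  | tensor_unit A =>
    refine Eq.trans ?_ (opAddU_opMergeR (colorObj H A))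
    exact semFull_comp_eq scal (semFull_addU scal A) (semFull_incl_eq scal (sem_mergeR scal A))
  | null_unit => exact opU_null
  | can s t h =>
    exact (semFull_canDiag_mirror scal s).trans
      ((can_congr scal h).trans (semFull_canDiag_mirror scal t).symm)

theorem semFull_sound {X Y : Wires} {d e : FullDiag R X Y} (h : FullEquiv d e) :
    semFull scal d = semFull scal e :=
  (fullInterp scal).val_equiv _ _ (fun h => semFull_Ax scal h)
    (fun h => semFull_Ax_mirror scal h) h

theorem sem_sound {X Y : Wires} {d e : FDiag R X Y} (h : FEquiv d e) :
    sem scal d = sem scal e :=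
  -- The equation is proved for the morphisms with an identity on 1 adjoined, where the PROP laws
  -- are available, and then restricted to the first summand.
  sumMap_id_faithful ((functionalInterp scal).val_equiv _ _
    (fun h => congrArg (fun f => sumMap f (𝟙 (𝟙_ H))) (sem_FAx scal h))
    (fun h => congrArg (fun f => sumMap f (𝟙 (𝟙_ H))) (sem_FAx_mirror scal h)) h)

end FullAxioms

end TensorPlus

theorem mainTheorem3 {R : Type w} [CommSemiring R] {H : Type u} [Category.{v} H]
    [Limits.HasZeroMorphisms H] [TensorPlus.Semiadditive H] [MonoidalCategory H]
    [SymmetricCategory H] [TensorPlus.Distributive H] (scal : TensorPlus.ScalarIso R H)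
    {X Y : TensorPlus.Wires} :
    (∀ d e : TensorPlus.FDiag R X Y, TensorPlus.FEquiv d e →
      TensorPlus.sem scal d = TensorPlus.sem scal e) ∧
    (∀ d e : TensorPlus.FullDiag R X Y, TensorPlus.FullEquiv d e →
      TensorPlus.semFull scal d = TensorPlus.semFull scal e) ∧
    (∀ d : TensorPlus.FullDiag R X Y, TensorPlus.InPlusOne (TensorPlus.semFull scal d)) ∧
    (∀ d : TensorPlus.FDiag R X Y,
      TensorPlus.semFull scal d.incl
        = TensorPlus.sumMap (TensorPlus.sem scal d) (𝟙 (𝟙_ H))) :=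
  ⟨fun _ _ h => TensorPlus.sem_sound scal h, fun _ _ h => TensorPlus.semFull_sound scal h,
    fun d => TensorPlus.inPlusOne_semFull scal d, fun d => TensorPlus.semFull_incl scal d⟩
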